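/- Let $d\ge2$. Consider the Ising model on $\mathbb Z^d$, with spins $\sigma_i\in\{+1,-1\}$, given by the formal Hamiltonian $$H=-J\sum_{\langle i,j\rangle}\sigma_i\sigma_j+\frac12\sum_{i,j}K_{i,j}\sigma_i\sigma_j,\qquad K_{i,j}=|i-j|^{-s}\ (i\ne j),\quad K_{i,i}=0,$$ where $\langle i,j\rangle$ runs over unordered nearest-neighbor pairs, the second sum runs over ordered pairs, and $|\cdot|$ is the Euclidean norm. For finite $\Lambda\subset\mathbb Z^d$ let $H_\Lambda$ be obtained from $H$ by dropping all terms with both $i$ and $j$ outside $\Lambda$, and let $Z_{\Lambda,h}(\sigma_{\Lambda^c})=\sum_{\sigma_\Lambda}e^{-\beta(H_\Lambda(\sigma)-h\sum_{i\in\Lambda}\sigma_i)}$. With $\Lambda_L=[-L,L]^d\cap\mathbb Z^d$, let $$f(\beta,h)=-\frac1\beta\lim_{L\to\infty}\frac1{|\Lambda_L|}\log Z_{\Lambda_L,h}(\sigma_{\Lambda_L^c}),\qquad m_\star=-\frac{\partial f}{\partial h^+}\Big|_{h=0}$$ be the free energy and the spontaneous magnetization. A Gibbs state is a probability measure on $\{+1,-1\}^{\mathbb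 Z^d}$ such that, for every finite $\Lambda$, the conditional distribution of $\sigma_\Lambda$ given $\sigma_{\Lambda^c}$ is $Z_{\Lambda,0}(\sigma_{\Lambda^c})^{-1}e^{-\beta H_\Lambda(\sigma_\Lambda,\sigma_{\Lambda^c})}$; it is extremal if it is an extreme point of the convex set of all Gibbs states. There is a constant $C_0=C_0(d)\in(0,\infty)$, and for every $s>d+1$ a constant $J_0=J_0(s,d)\in(0,\infty)$, such that for all $\beta\in(0,\infty)$ and $J\in\mathbb R$ with $\beta(J-J_0)\ge C_0$ the following holds. The limit $f(\beta,h)$ exists for all $h\in\mathbb R$ and does not depend on the boundary condition, its right derivative at $h=0$ exists, and $$m_\star>0.$$ Moreover, there exist two distinct translation-invariant extremal Gibbs states $\langle-\rangle^+$ and $\langle-\rangle^-$ (at inverse temperature $\beta$ and zero field) such that $$\langle\sigma_0\rangle^+=-\langle\sigma_0\rangle^->0.$$ -/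

import Mathlib

open MeasureTheory Filter Topology
open scoped NNReal BigOperators

noncomputable section

namespace LongRangeIsing

/-- Sites of the lattice `ℤ^d`. -/
abbrev Site (d : ℕ) : Type := Fin d → ℤ

/-- Spin configurations on `ℤ^d`: each spin lies in `ℤˣ = {1, -1}`. The space carries the
product `σ`-algebra. -/
abbrev Config (d : ℕ) : Type := Site d → ℤˣ

/-- The real value `±1` of the spin at the site `i`. -/
def spin {d : ℕ} (σ : Config d) (i : Site d) : ℝ := ((σ i : ℤ) : ℝ)

/-- The Euclidean distance `|i - j|` between two sites. -/
def siteDist {d : ℕ} (i j : Site d) : ℝ :=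
  Real.sqrt (∑ k, ((i k : ℝ) - (j k : ℝ)) ^ 2)

/-- Two sites are nearest neighbours if they are at Euclidean distance `1`. -/
def IsNeighbor {d : ℕ} (i j : Site d) : Prop := siteDist i j = 1

/-- The long-range coupling `K_{i,j} = |i - j|^{-s}`, with `K_{i,i} = 0`. -/
def longRange {d : ℕ} (s : ℝ) (i j : Site d) : ℝ :=
  if i = j then 0 else 1 / siteDist i j ^ s

open Classical in
/-- The total coupling `-J 1_{i ~ j} + K_{i,j}`. In terms of it, the formal Hamiltonian
`-J ∑_{⟨i,j⟩} σ_i σ_j + (1/2) ∑_{i,j} K_{i,j} σ_i σ_j` (first sum over unordered nearest-neighbour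
pairs, second sum over ordered pairs) is `(1/2) ∑_{i,j} coupling i j * σ_i σ_j`
(sum over ordered pairs). -/
def coupling {d : ℕ} (s J : ℝ) (i j : Site d) : ℝ :=
  (if IsNeighbor i j then -J else 0) + longRange s i j

/-- The Hamiltonian `H_Λ`: the formal Hamiltonian without the terms that have both `i` and `j`
outside `Λ`. The ordered pairs inside `Λ` come with the factor `1/2`; of the two ordered
versions of a pair with exactly one site in `Λ`, only the one with `i ∈ Λ` is listed, so it
carries the factor `1`. -/
def hamiltonian {d : ℕ} (s J : ℝ) (Λ : Finset (Site d)) (σ : Config d) : ℝ :=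
  ∑ i ∈ Λ, ∑' j : Site d,
    (if j ∈ Λ then (1 / 2 : ℝ) else 1) * (coupling s J i j * spin σ i * spin σ j)

/-- The configuration equal to `τ` in `Λ` and to `η` outside `Λ`. -/
def glue {d : ℕ} (Λ : Finset (Site d)) (τ : Λ → ℤˣ) (η : Config d) : Config d :=
  fun i => if hi : i ∈ Λ then τ ⟨i, hi⟩ else η i

/-- The Boltzmann factor `exp (-β (H_Λ(σ) - h ∑_{i ∈ Λ} σ_i))`. -/
def boltzmann {d : ℕ} (s J β h : ℝ) (Λ : Finset (Site d)) (σ : Config d) : ℝ :=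
  Real.exp (-β * (hamiltonian s J Λ σ - h * ∑ i ∈ Λ, spin σ i))

/-- The partition function `Z_{Λ,h}(η)` in `Λ` with boundary condition `η` and field `h`. -/
def partitionFunction {d : ℕ} (s J β h : ℝ) (Λ : Finset (Site d)) (η : Config d) : ℝ :=
  ∑ τ : Λ → ℤˣ, boltzmann s J β h Λ (glue Λ τ η)

/-- The box `Λ_L = [-L, L]^d ∩ ℤ^d`. -/
def box (d L : ℕ) : Finset (Site d) :=
  Finset.Icc (fun _ => -(L : ℤ)) (fun _ => (L : ℤ))

/-- The free energy per site in the box `Λ_L` with boundary condition `η`. -/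
def boxFreeEnergy {d : ℕ} (s J β h : ℝ) (L : ℕ) (η : Config d) : ℝ :=
  -(1 / β) * ((1 / ((box d L).card : ℝ)) * Real.log (partitionFunction s J β h (box d L) η))

/-- The free energy `f(β, h)`: the limit of the free energies per site of the boxes, here taken
with plus boundary conditions. -/
def freeEnergy (d : ℕ) (s J β h : ℝ) : ℝ :=
  limUnder atTop (fun L : ℕ => boxFreeEnergy s J β h L (fun _ : Site d => (1 : ℤˣ)))

/-- The spontaneous magnetization `m_⋆(β)`: minus the right derivative of `h ↦ f(β, h)` at
`h = 0`. -/
def spontaneousMagnetization (d : ℕ) (s J β : ℝ) : ℝ :=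
  -derivWithin (fun h => freeEnergy d s J β h) (Set.Ici 0) 0

/-- The `σ`-algebra on configurations generated by the spins outside `Λ`. -/
abbrev outside {d : ℕ} (Λ : Finset (Site d)) : MeasurableSpace (Config d) :=
  MeasurableSpace.comap (fun (σ : Config d) (i : {i : Site d // i ∉ Λ}) => σ i) inferInstance

/-- Gibbs measures at zero field: probability measures on configurations such that for every
finite `Λ` the conditional probability of `{σ_Λ = τ}` given the spins outside `Λ` is
`exp (-β H_Λ(τ, σ_{Λᶜ})) / Z_Λ(σ_{Λᶜ})`. -/
structure IsGibbs {d : ℕ} (s J β : ℝ) (μ : Measure (Config d)) : Prop where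
  isProbabilityMeasure : IsProbabilityMeasure μ
  condDistrib : ∀ (Λ : Finset (Site d)) (τ : Λ → ℤˣ),
    μ[Set.indicator {σ : Config d | ∀ i : Λ, σ i = τ i} (fun _ => (1 : ℝ)) | outside Λ] =ᵐ[μ]
      fun η => boltzmann s J β 0 Λ (glue Λ τ η) / partitionFunction s J β 0 Λ η

/-- Extremal Gibbs measures: the extreme points of the convex set of all Gibbs measures. -/
def IsExtremalGibbs {d : ℕ} (s J β : ℝ) (μ : Measure (Config d)) : Prop :=
  μ ∈ Set.extremePoints ℝ≥0 {ν : Measure (Config d) | IsGibbs s J β ν}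

/-- Invariance of a measure on configurations under all lattice translations. -/
def IsTranslationInvariant {d : ℕ} (μ : Measure (Config d)) : Prop :=
  ∀ a : Site d, μ.map (fun (σ : Config d) (i : Site d) => σ (i + a)) = μ

end LongRangeIsing

end

noncomputable section

namespace LongRangeIsing

/-! The nearest-neighbour ferromagnet dominates, and the long-range antiferromagnetic term is only a
boundary perturbation. Since `s > d + 1`, the coupling `K` has a finite first moment κ
(`longRangeMoment`), so a finite set `A` interacts with its complement by at most `κ |∂A|`
(`sum_longRange_exit_le`). Reversing the spins inside a contour therefore gains at least `2 (J - κ)`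
per boundary edge (`flipEnergy_le`). Peierls' argument then bounds the probability of given contours
by `x ^ |∂A|` each, with `x = exp (-2β(J - κ))` (`measure_contours_le`), and a Kraft inequality
counts contours (`sum_contours_le`). Under plus boundary conditions every magnetization is at least
1/2, uniformly in the volume.

Spontaneous magnetization: up to boundary terms `log Z` is additive over disjoint sets, so the
pressure exists and forgets the boundary condition. It is convex in the field, so its right
derivative exists. Jensen's inequality bounds its slope below by the finite-volume plus
magnetization (`hasDerivWithinAt_freeEnergy`).

Gibbs states: the DLR equations are equivalent to quasi-invariance under finite spin flips
(`FlipInvariant`), a form stable under weak limits and well adapted to Peierls estimates. A limit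
point of the plus measures is flip invariant, and almost surely each of its minus spins is
surrounded by a contour (`exists_plus_state`).

The couplings have both signs, so monotonicity in the boundary condition is not available for
translation invariance and extremality. Both follow instead from uniqueness in the class of
flip-invariant measures with enclosed minus spins (`eq_of_enclosed`): a translate, or a component of
a convex decomposition, stays in that class. Uniqueness compares two independent configurations.
Reversing both on a set `T` where they differ exchanges them there. Pairs joining `T` to sites of
agreement contribute nothing in total to the energy change; neighbouring differing sites are kept in
the same cluster; the remaining long-range terms are absorbed by random bonds, open with probability
`1 - exp (-pairEnergy)`. Hence, if the cluster of a window `B` stays inside a box, the two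
configurations are exchangeable on `B` (`lintegral_mul_fkWeight`). A differing site is minus in one
configuration, hence lies inside a contour, so a cluster can escape only along a chain of distinct
contours linked by neighbours or bonds. Such chains are dominated by a convergent geometric series
(`tsum_chainWeight_le`), so escape from large boxes has vanishing probability. The minus state is
the image of the plus state under global spin reversal. -/

/-- The unit vector in the direction `k`. -/
def unitVec {d : ℕ} (k : Fin d) : Site d := Pi.single k 1

/-- Lattice edges: `(x, k)` joins `x` and `x + unitVec k`. -/
abbrev Edge (d : ℕ) : Type := Site d × Fin d

/-! ### Closed lattice 1-cochains are exact, and complements of boxes are connected. -/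

section Potential

lemma exists_int_antidifference {M : Type*} [AddCommGroup M] (a : ℤ → M) :
    ∃ A : ℤ → M, ∀ t, A (t + 1) - A t = a t := by
  refine ⟨fun t => ∑ i ∈ Finset.Ico 0 t, a i - ∑ i ∈ Finset.Ico t 0, a i, fun t => ?_⟩
  rcases le_or_gt 0 t with ht | ht
  · have h1 : Finset.Ico 0 (t + 1) = insert t (Finset.Ico 0 t) := by
      ext i; simp only [Finset.mem_insert, Finset.mem_Ico]; omega
    have h2 : Finset.Ico (t + 1) 0 = ∅ := Finset.Ico_eq_empty (by omega)
    have h3 : Finset.Ico t 0 = ∅ := Finset.Ico_eq_empty (by omega)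
    simp [h1, h2, h3]
  · have h1 : Finset.Ico t 0 = insert t (Finset.Ico (t + 1) 0) := by
      ext i; simp only [Finset.mem_insert, Finset.mem_Ico]; omega
    have h2 : Finset.Ico 0 (t + 1) = ∅ := Finset.Ico_eq_empty (by omega)
    have h3 : Finset.Ico 0 t = ∅ := Finset.Ico_eq_empty (by omega)
    simp [h1, h2, h3]

lemma update_add_unitVec_self {d : ℕ} (x : Site d) (k : Fin d) (t : ℤ) :
    Function.update (x + unitVec k) k t = Function.update x k t := by
  ext j
  by_cases h : j = k
  · subst h; simp
  · simp [h, unitVec]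

lemma update_add_unitVec_of_ne {d : ℕ} (x : Site d) {k l : Fin d} (h : k ≠ l) (t : ℤ) :
    Function.update (x + unitVec k) l t = Function.update x l t + unitVec k := by
  ext j
  by_cases hj : j = l
  · subst hj; simp [unitVec, h.symm]
  · simp [hj]

/-- A closed `1`-cochain on `ℤ^d` is exact. -/
lemma exists_potential {d : ℕ} {M : Type*} [AddCommGroup M] (φ : Site d → Fin d → M)
    (hφ : ∀ x k l, φ x k + φ (x + unitVec k) l = φ x l + φ (x + unitVec l) k) :
    ∃ g : Site d → M, ∀ x k, g (x + unitVec k) - g x = φ x k := by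
  -- Induction on the number of coordinate directions in which the increments are already correct.
  suffices H : ∀ m : ℕ, m ≤ d → ∃ g : Site d → M,
      ∀ x (k : Fin d), k.val < m → g (x + unitVec k) - g x = φ x k by
    obtain ⟨g, hg⟩ := H d le_rfl
    exact ⟨g, fun x k => hg x k k.isLt⟩
  intro m
  induction m with
  | zero => intro _; exact ⟨0, fun x k hk => absurd hk (Nat.not_lt_zero _)⟩
  | succ m ih =>
    intro hm
    obtain ⟨g, hg⟩ := ih (by omega)
    choose F hF using fun a : ℤ → M => exists_int_antidifference a
    let μ : Fin d := ⟨m, by omega⟩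
    -- The defect in the new direction. Closedness makes it constant along the earlier directions,
    -- so summing it along lines parallel to `μ` does not disturb the increments already obtained.
    let ψ : Site d → M := fun x => φ x μ - (g (x + unitVec μ) - g x)
    have hψ : ∀ x (k : Fin d), k.val < m → ψ (x + unitVec k) = ψ x := by
      intro x k hk
      have h1 := hφ x k μ
      have h2 := hg x k hk
      have h3 := hg (x + unitVec μ) k hk
      have h4 : x + unitVec μ + unitVec k = x + unitVec k + unitVec μ := add_right_comm _ _ _
      rw [← h2, ← h3, h4] at h1
      simp only [ψ]
      rw [← sub_eq_zero] at h1 ⊢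
      rw [← h1]; abel
    let line : Site d → ℤ → M := fun x t => ψ (Function.update x μ t)
    refine ⟨fun x => g x + F (line x) (x μ), fun x k hk => ?_⟩
    rcases Nat.lt_succ_iff_lt_or_eq.mp hk with hk | hk
    · have hne : k ≠ μ := fun h => by simp [h, μ] at hk
      have h1 : line (x + unitVec k) = line x := by
        funext t
        simp only [line, update_add_unitVec_of_ne x hne t, hψ _ k hk]
      have h2 : (x + unitVec k) μ = x μ := by simp [unitVec, hne.symm]
      simp only [h1, h2, ← hg x k hk]
      abel
    · have hk' : k = μ := Fin.ext hk
      subst hk'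
      have h1 : line (x + unitVec μ) = line x := by
        funext t
        simp only [line, update_add_unitVec_self]
      have h2 : (x + unitVec μ) μ = x μ + 1 := by simp [unitVec]
      have h3 : F (line x) (x μ + 1) - F (line x) (x μ) = ψ x := by
        rw [hF]; simp [line]
      simp only [h1, h2]
      have h4 : φ x μ = ψ x + (g (x + unitVec μ) - g x) := by simp [ψ]
      rw [h4, ← h3]
      abel

lemma int_fun_const {M : Type*} (f : ℤ → M) (h : ∀ t, f (t + 1) = f t) (s t : ℤ) : f s = f t := by
  have key : ∀ s, f s = f 0 := by
    intro s
    induction s using Int.induction_on with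
    | zero => rfl
    | succ i hi => rw [h, hi]
    | pred i hi => rw [← hi, ← h (-(i : ℤ) - 1), sub_add_cancel]
  rw [key s, key t]

lemma update_succ {d : ℕ} (x : Site d) (k : Fin d) (t : ℤ) :
    Function.update x k (t + 1) = Function.update x k t + unitVec k := by
  ext j
  by_cases h : j = k
  · subst h; simp [unitVec]
  · simp [h, unitVec]

/-- In dimension at least two the complement of a box is connected: a function without increments
outside the box is constant there. -/
lemma const_outside_box {d : ℕ} (hd : 2 ≤ d) {M : Type*} (g : Site d → M) (N : ℤ)
    (hg : ∀ x (k j : Fin d), j ≠ k → N < |x j| → g (x + unitVec k) = g x) (x : Site d)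
    (j : Fin d) (hx : N < |x j|) : g x = g (fun _ => |N| + 1) := by
  have hN : N < |(|N| + 1)| := by
    rw [abs_of_nonneg (by positivity)]; linarith [le_abs_self N]
  have line : ∀ x (k j : Fin d), j ≠ k → N < |x j| → ∀ t, g (Function.update x k t) = g x := by
    intro x k j hjk hx t
    have := int_fun_const (fun t => g (Function.update x k t)) (fun t => by
      simp only [update_succ]
      exact hg _ k j hjk (by rwa [Function.update_of_ne hjk])) t (x k)
    simpa using this
  have plane : ∀ x y (j : Fin d), x j = y j → N < |x j| → g x = g y := by
    intro x y j hxy hx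
    have : ∀ s : Finset (Fin d), j ∉ s → g (s.piecewise y x) = g x := by
      intro s
      induction s using Finset.induction_on with
      | empty => intro _; simp
      | insert a s ha ih =>
        intro hj
        simp only [Finset.mem_insert, not_or] at hj
        rw [Finset.piecewise_insert, line _ a j hj.1, ih hj.2]
        rwa [Finset.piecewise_eq_of_notMem _ _ _ hj.2]
    have h := this (Finset.univ.erase j) (by simp)
    rw [← h]
    congr 1
    ext i
    by_cases hi : i = j
    · subst hi; simp [hxy]
    · simp [hi]
  obtain ⟨k, hk⟩ : ∃ k : Fin d, j ≠ k := by
    have : Nontrivial (Fin d) := Fin.nontrivial_iff_two_le.mpr hd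
    obtain ⟨k, hk⟩ := exists_ne j
    exact ⟨k, hk.symm⟩
  -- Coordinate `j` is large, so coordinate `k` may be moved to `|N| + 1`; that coordinate then
  -- keeps the site outside the box while all others change, including `j`.
  rw [← line x k j hk hx (|N| + 1)]
  exact plane _ _ k (by simp) (by simpa using hN)

end Potential

/-! ### Edge boundaries and their connected components. -/

section EdgeBoundary

/-- The edge boundary of a finite set of sites. -/
def edgeBoundary {d : ℕ} (A : Finset (Site d)) : Finset (Edge d) :=
  ((A ∪ A.biUnion fun x => Finset.univ.image fun k => x - unitVec k) ×ˢ Finset.univ).filter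
    fun e => ¬(e.1 ∈ A ↔ e.1 + unitVec e.2 ∈ A)

lemma mem_edgeBoundary {d : ℕ} {A : Finset (Site d)} {e : Edge d} :
    e ∈ edgeBoundary A ↔ ¬(e.1 ∈ A ↔ e.1 + unitVec e.2 ∈ A) := by
  simp only [edgeBoundary, Finset.mem_filter, Finset.mem_product, Finset.mem_univ, and_true,
    and_iff_right_iff_imp, Finset.mem_union, Finset.mem_biUnion, Finset.mem_image, true_and]
  intro h
  by_cases h1 : e.1 ∈ A
  · exact Or.inl h1
  · have h2 : e.1 + unitVec e.2 ∈ A := by tauto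
    exact Or.inr ⟨_, h2, e.2, by simp⟩

/-- Two edges are adjacent if their base points are at distance at most one in the maximum norm. -/
def edgeAdj {d : ℕ} (e f : Edge d) : Prop := ∀ j, |e.1 j - f.1 j| ≤ 1

lemma edgeAdj_symm {d : ℕ} {e f : Edge d} (h : edgeAdj e f) : edgeAdj f e :=
  fun j => by rw [abs_sub_comm]; exact h j

/-- Connectedness of a finite set of edges. -/
def EdgeConnected {d : ℕ} (γ : Finset (Edge d)) : Prop :=
  ∀ U ⊆ γ, U.Nonempty → (∀ a ∈ U, ∀ b ∈ γ, edgeAdj a b → b ∈ U) → U = γ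

/-- The finite connected components of a set of edges. -/
structure IsEdgeComponent {d : ℕ} (γ : Finset (Edge d)) (S : Set (Edge d)) : Prop where
  nonempty : γ.Nonempty
  subset : ∀ e ∈ γ, e ∈ S
  closed : ∀ a ∈ γ, ∀ b ∈ S, edgeAdj a b → b ∈ γ
  connected : EdgeConnected γ

/-- A nonempty subset of least cardinality among those closed under adjacency in `S` has no proper
nonempty closed part, hence is connected. -/
lemma exists_isEdgeComponent {d : ℕ} (S : Finset (Edge d)) (hS : S.Nonempty) :
    ∃ γ, IsEdgeComponent γ (S : Set (Edge d)) := by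
  classical
  let P : Finset (Edge d) → Prop := fun γ =>
    γ.Nonempty ∧ γ ⊆ S ∧ ∀ a ∈ γ, ∀ b ∈ S, edgeAdj a b → b ∈ γ
  obtain ⟨γ, hγ, hmin⟩ := Finset.exists_min_image (S.powerset.filter P) Finset.card
    ⟨S, by simpa [P] using ⟨hS, fun a b _ c d hc _ => hc⟩⟩
  simp only [Finset.mem_filter, Finset.mem_powerset, P] at hγ hmin
  refine ⟨γ, hγ.2.1, fun e he => hγ.1 he, fun a ha b hb => hγ.2.2.2 a ha b hb, ?_⟩
  intro U hU hne hcl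
  refine Finset.eq_of_subset_of_card_le hU (hmin U ⟨hU.trans hγ.1, hne, hU.trans hγ.1, ?_⟩)
  intro a ha b hb hab
  exact hcl a ha b (hγ.2.2.2 a (hU ha) b hb hab) hab

lemma IsEdgeComponent.eq_of_inter {d : ℕ} {γ γ' : Finset (Edge d)} {S : Set (Edge d)}
    (h : IsEdgeComponent γ S) (h' : IsEdgeComponent γ' S) (e : Edge d) (he : e ∈ γ) (he' : e ∈ γ') :
    γ = γ' := by
  classical
  have h1 : γ ∩ γ' = γ := h.connected _ Finset.inter_subset_left ⟨e, by simp [he, he']⟩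
    fun a ha b hb hab => by
      simp only [Finset.mem_inter] at ha ⊢
      exact ⟨hb, h'.closed a ha.2 b (h.subset b hb) hab⟩
  have h2 : γ ∩ γ' = γ' := h'.connected _ Finset.inter_subset_right ⟨e, by simp [he, he']⟩
    fun a ha b hb hab => by
      simp only [Finset.mem_inter] at ha ⊢
      exact ⟨h.closed a ha.1 b (h'.subset b hb) hab, hb⟩
  rw [← h1, h2]

lemma abs_unitVec_le {d : ℕ} (k j : Fin d) : 0 ≤ unitVec k j ∧ unitVec k j ≤ 1 := by
  unfold unitVec
  by_cases h : j = k
  · subst h; simp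
  · simp [h]

/-- Every set of sites in the lattice has a box containing it. -/
lemma exists_box_bound {d : ℕ} (S : Finset (Site d)) : ∃ N : ℤ, ∀ x ∈ S, ∀ j, |x j| ≤ N := by
  refine ⟨∑ x ∈ S, ∑ j, |x j|, fun x hx j => ?_⟩
  calc |x j| ≤ ∑ j, |x j| := Finset.single_le_sum (f := fun j => |x j|)
        (fun _ _ => abs_nonneg _) (Finset.mem_univ j)
    _ ≤ _ := Finset.single_le_sum (f := fun x : Site d => ∑ j, |x j|)
        (fun _ _ => Finset.sum_nonneg fun _ _ => abs_nonneg _) hx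

/-- This is why adjacency uses the maximum norm: the four edges of a unit square become pairwise
adjacent, so a component of a boundary contains all boundary edges of any square it meets. -/
lemma edgeAdj_of_plaquette {d : ℕ} (x : Site d) (k l : Fin d) {y z : Site d} (m n : Fin d)
    (hy : y = x ∨ y = x + unitVec k ∨ y = x + unitVec l)
    (hz : z = x ∨ z = x + unitVec k ∨ z = x + unitVec l) :
    edgeAdj (y, m) (z, n) := by
  intro j
  have h1 := abs_unitVec_le k j
  have h2 := abs_unitVec_le l j
  rw [abs_le]
  rcases hy with rfl | rfl | rfl <;> rcases hz with rfl | rfl | rfl <;>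
    simp only [Pi.add_apply] <;> constructor <;> omega

/-- A connected component of the boundary of a finite set is itself the boundary of a finite
set. -/
lemma exists_edgeBoundary_eq {d : ℕ} (hd : 2 ≤ d) (S : Finset (Site d)) (γ : Finset (Edge d))
    (hγ : IsEdgeComponent γ (edgeBoundary S : Set (Edge d))) :
    ∃ A : Finset (Site d), edgeBoundary A = γ := by
  classical
  let φ : Site d → Fin d → ZMod 2 := fun x k => if (x, k) ∈ γ then 1 else 0
  let s : Site d → ZMod 2 := fun x => if x ∈ S then 1 else 0
  have hs : ∀ x k, (if (x, k) ∈ edgeBoundary S then (1 : ZMod 2) else 0)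
      = s (x + unitVec k) - s x := by
    intro x k
    simp only [mem_edgeBoundary, s]
    by_cases h1 : x ∈ S <;> by_cases h2 : x + unitVec k ∈ S <;> simp [h1, h2]
  have hclosed : ∀ x k l, φ x k + φ (x + unitVec k) l = φ x l + φ (x + unitVec l) k := by
    intro x k l
    -- On a square met by `γ`, the cochain agrees with the coboundary of the indicator of `S`; on
    -- every other square it vanishes. It is closed in both cases.
    by_cases hp : (x, k) ∈ γ ∨ (x + unitVec k, l) ∈ γ ∨ (x, l) ∈ γ ∨ (x + unitVec l, k) ∈ γ
    · have key : ∀ y m, (y = x ∨ y = x + unitVec k ∨ y = x + unitVec l) →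
          φ y m = s (y + unitVec m) - s y := by
        intro y m hy
        rw [← hs]
        have : (y, m) ∈ γ ↔ (y, m) ∈ edgeBoundary S := by
          refine ⟨fun h => hγ.subset _ h, fun h => ?_⟩
          rcases hp with hp | hp | hp | hp <;>
            exact hγ.closed _ hp _ h (edgeAdj_of_plaquette x k l _ _ (by simp) hy)
        simp only [φ, this]
      rw [key x k (by simp), key x l (by simp), key (x + unitVec k) l (by simp),
        key (x + unitVec l) k (by simp), add_right_comm x (unitVec k) (unitVec l)]
      abel
    · push Not at hp
      simp [φ, hp]
  obtain ⟨g, hg⟩ := exists_potential φ hclosed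
  obtain ⟨N, hN⟩ := exists_box_bound S
  have hout : ∀ x (j : Fin d), N < |x j| → g x = g (fun _ => |N| + 1) := by
    refine const_outside_box hd g N fun x k j hjk hx => ?_
    have h1 : x ∉ S := fun h => absurd (hN x h j) (not_le.mpr hx)
    have h2 : x + unitVec k ∉ S := fun h => by
      have := hN _ h j
      simp only [Pi.add_apply, unitVec, Pi.single_eq_of_ne hjk, add_zero] at this
      exact absurd this (not_le.mpr hx)
    have h3 : (x, k) ∉ γ := fun h => by
      have := hγ.subset _ h
      simp [mem_edgeBoundary, h1, h2] at this
    have := hg x k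
    simp only [φ, h3, if_false] at this
    exact sub_eq_zero.mp this
  have hfin : {x : Site d | g x ≠ g (fun _ => |N| + 1)}.Finite := by
    refine (Set.finite_Icc (fun _ => -N : Site d) (fun _ => N)).subset fun x hx => ?_
    by_contra hcon
    have : ∃ j, N < |x j| := by
      by_contra! h
      exact hcon ⟨fun j => (abs_le.mp (h j)).1, fun j => (abs_le.mp (h j)).2⟩
    obtain ⟨j, hj⟩ := this
    exact hx (hout x j hj)
  -- The interior is the set where the mod 2 potential differs from its constant value at infinity;
  -- this choice makes it finite.
  refine ⟨hfin.toFinset, ?_⟩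
  ext ⟨x, k⟩
  simp only [mem_edgeBoundary, Set.Finite.mem_toFinset, Set.mem_ofPred_eq]
  have h1 := hg x k
  have h2 : ∀ a b c f : ZMod 2, b - a = f → ((¬(a ≠ c ↔ b ≠ c)) ↔ f = 1) := by decide
  rw [h2 _ _ _ _ h1]
  simp [φ]

open scoped symmDiff in
lemma edgeBoundary_symmDiff {d : ℕ} (A B : Finset (Site d)) :
    edgeBoundary (A ∆ B) = edgeBoundary A ∆ edgeBoundary B := by
  ext e
  simp only [mem_edgeBoundary, Finset.mem_symmDiff]
  tauto

lemma edgeBoundary_nonempty {d : ℕ} (hd : 0 < d) {A : Finset (Site d)} (hA : A.Nonempty) :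
    (edgeBoundary A).Nonempty := by
  obtain ⟨N, hN⟩ := exists_box_bound A
  obtain ⟨x, hx⟩ := hA
  by_contra h
  rw [Finset.not_nonempty_iff_eq_empty] at h
  have h1 : ∀ y k, (y ∈ A ↔ y + unitVec k ∈ A) := by
    intro y k
    by_contra hc
    have : (y, k) ∈ edgeBoundary A := mem_edgeBoundary.mpr hc
    simp [h] at this
  have h2 := int_fun_const (fun t => Function.update x ⟨0, hd⟩ t ∈ A) (fun t => by
    simp only [update_succ]; exact propext (h1 _ _).symm) (x ⟨0, hd⟩) (|N| + 1)
  simp only [Function.update_eq_self, eq_iff_iff] at h2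
  have := hN _ (h2.mp hx) ⟨0, hd⟩
  simp only [Function.update_self] at this
  rw [abs_of_nonneg (by positivity)] at this
  linarith [le_abs_self N]

/-- Boundaries add mod 2 under symmetric difference, and a nonempty finite set has a nonempty
boundary. Contours can thus be counted through their interiors or their edges interchangeably. -/
lemma edgeBoundary_injective {d : ℕ} (hd : 0 < d) :
    Function.Injective (edgeBoundary : Finset (Site d) → Finset (Edge d)) := by
  intro A B h
  by_contra hne
  have h1 : (symmDiff A B).Nonempty := by
    rw [Finset.nonempty_iff_ne_empty]
    simpa [← Finset.bot_eq_empty, symmDiff_eq_bot] using hne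
  have h2 := edgeBoundary_nonempty hd h1
  rw [edgeBoundary_symmDiff, h, symmDiff_self] at h2
  simp at h2

/-- Each site of a finite set lies inside a component of its boundary. -/
lemma exists_component_around {d : ℕ} (hd : 2 ≤ d) (S : Finset (Site d)) (v : Site d)
    (hv : v ∈ S) : ∃ A : Finset (Site d), v ∈ A ∧
      IsEdgeComponent (edgeBoundary A) (edgeBoundary S : Set (Edge d)) := by
  induction hn : (edgeBoundary S).card using Nat.strong_induction_on generalizing S with
  | _ n ih =>
    obtain ⟨γ, hγ⟩ := exists_isEdgeComponent _ (edgeBoundary_nonempty (by omega) ⟨v, hv⟩)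
    obtain ⟨A, rfl⟩ := exists_edgeBoundary_eq hd S γ hγ
    by_cases hvA : v ∈ A
    · exact ⟨A, hvA, hγ⟩
    -- If the component does not surround `v`, replacing `S` by `S ∆ A` erases exactly that
    -- component and keeps `v` in the set.
    have hsub : edgeBoundary A ⊆ edgeBoundary S := fun e he => hγ.subset e he
    have hb : edgeBoundary (symmDiff S A) = edgeBoundary S \ edgeBoundary A := by
      rw [edgeBoundary_symmDiff]
      ext e
      simp only [Finset.mem_symmDiff, Finset.mem_sdiff]
      have := @hsub e
      tauto
    have hcard : (edgeBoundary (symmDiff S A)).card < n := by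
      rw [hb, ← hn]
      refine Finset.card_lt_card ⟨Finset.sdiff_subset, fun h => ?_⟩
      obtain ⟨e, he⟩ := hγ.nonempty
      have := h (hsub he)
      simp [he] at this
    obtain ⟨A', hvA', hA'⟩ := ih _ hcard (symmDiff S A)
      (by simp [Finset.mem_symmDiff, hv, hvA]) rfl
    rw [hb] at hA'
    refine ⟨A', hvA', hA'.nonempty, fun e he => ?_, fun a ha b hbS hab => ?_, hA'.connected⟩
    · have := hA'.subset e he
      simp only [Finset.coe_sdiff, Set.mem_sdiff] at this
      exact this.1
    -- A component of what remains is a component of the whole: the erased part was itself closed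
    -- under adjacency, so nothing left is adjacent to it.
    · by_cases hbA : b ∈ edgeBoundary A
      · have h1 := hA'.subset a ha
        simp only [Finset.coe_sdiff, Set.mem_sdiff, Finset.mem_coe] at h1
        exact absurd (hγ.closed b hbA a h1.1 (edgeAdj_symm hab)) h1.2
      · exact hA'.closed a ha b (by simpa [hbA] using hbS) hab

end EdgeBoundary

/-! ### Counting connected contours. -/

section Counting

/-- The set of edges adjacent to `e`. -/
def edgeNbrs {d : ℕ} (e : Edge d) : Finset (Edge d) :=
  Finset.Icc (fun j => e.1 j - 1) (fun j => e.1 j + 1) ×ˢ Finset.univ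

lemma mem_edgeNbrs {d : ℕ} {e f : Edge d} : f ∈ edgeNbrs e ↔ edgeAdj e f := by
  simp only [edgeNbrs, Finset.mem_product, Finset.mem_Icc, Pi.le_def, Finset.mem_univ, and_true,
    edgeAdj, abs_le, ← forall_and]
  refine forall_congr' fun j => ?_
  constructor <;> rintro ⟨h1, h2⟩ <;> constructor <;> omega

/-- The number of edges adjacent to a given edge. -/
def adjDegree (d : ℕ) : ℕ := 3 ^ d * d

lemma card_edgeNbrs {d : ℕ} (e : Edge d) : (edgeNbrs e).card = adjDegree d := by
  simp only [edgeNbrs, Finset.card_product, Pi.card_Icc, Int.card_Icc, Finset.card_univ,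
    Fintype.card_fin, adjDegree]
  congr 1
  rw [Finset.prod_congr rfl (g := fun _ => 3) (fun j _ => by omega)]
  simp

/-- Both sets are the component of `e` in `ω`. This makes the cylinders in the Kraft inequality
disjoint. -/
lemma EdgeConnected.eq_of_window {d : ℕ} {E E' ω : Finset (Edge d)} (hE : EdgeConnected E)
    (hE' : EdgeConnected E') {e : Edge d} (he : e ∈ E) (he' : e ∈ E')
    (h : E ⊆ ω) (h' : E' ⊆ ω) (hc : ∀ a ∈ E, ∀ b ∈ ω, edgeAdj a b → b ∈ E)
    (hc' : ∀ a ∈ E', ∀ b ∈ ω, edgeAdj a b → b ∈ E') : E = E' := by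
  classical
  have h1 : E ∩ E' = E := hE _ Finset.inter_subset_left ⟨e, by simp [he, he']⟩
    fun a ha b hb hab => by
      simp only [Finset.mem_inter] at ha ⊢
      exact ⟨hb, hc' a ha.2 b (h hb) hab⟩
  have h2 : E ∩ E' = E' := hE' _ Finset.inter_subset_right ⟨e, by simp [he, he']⟩
    fun a ha b hb hab => by
      simp only [Finset.mem_inter] at ha ⊢
      exact ⟨hc a ha.1 b (h' hb) hab, hb⟩
  rw [← h1, h2]

/-- A Kraft inequality for the connected edge sets that contain a given edge. -/
lemma sum_connected_le_one {d : ℕ} (e : Edge d) (𝓔 : Finset (Finset (Edge d)))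
    (h𝓔 : ∀ E ∈ 𝓔, e ∈ E ∧ EdgeConnected E) :
    ∑ E ∈ 𝓔, (1 / 2 : ℝ) ^ (adjDegree d * E.card) ≤ 1 := by
  classical
  -- Choose each edge by a fair coin. The event that `E` is exactly the component of `e` fixes only
  -- the edges of `P E`, so it has probability `2 ^ (-|P E|)`; these events are disjoint, whence the
  -- sum is at most one.
  let P : Finset (Edge d) → Finset (Edge d) := fun E => E ∪ E.biUnion edgeNbrs
  have hPE : ∀ E, E.biUnion edgeNbrs = P E := fun E => by
    refine (Finset.union_eq_right.mpr fun a ha => ?_).symm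
    exact Finset.mem_biUnion.mpr ⟨a, ha, mem_edgeNbrs.mpr fun j => by simp⟩
  have hPc : ∀ E, (P E).card ≤ adjDegree d * E.card := fun E => by
    rw [← hPE, mul_comm]
    exact Finset.card_biUnion_le_card_mul _ _ _ fun a _ => (card_edgeNbrs a).le
  let V := 𝓔.biUnion P
  -- The outcomes in the finite window `V` for which `E` is present and isolated.
  let cyl : Finset (Edge d) → Finset (Finset (Edge d)) := fun E =>
    (V \ P E).powerset.image fun w => E ∪ w
  have hmem : ∀ E, ∀ ω ∈ cyl E, E ⊆ ω ∧ ∀ a ∈ E, ∀ b ∈ ω, edgeAdj a b → b ∈ E := by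
    intro E ω hω
    simp only [cyl, Finset.mem_image, Finset.mem_powerset] at hω
    obtain ⟨w, hw, rfl⟩ := hω
    refine ⟨Finset.subset_union_left, fun a ha b hb hab => ?_⟩
    rcases Finset.mem_union.mp hb with hb | hb
    · exact hb
    · have := Finset.mem_sdiff.mp (hw hb)
      refine absurd ?_ this.2
      rw [← hPE]
      exact Finset.mem_biUnion.mpr ⟨a, ha, mem_edgeNbrs.mpr hab⟩
  have hcard : ∀ E ∈ 𝓔, (cyl E).card = 2 ^ (V.card - (P E).card) := by
    intro E hE
    have hPV : P E ⊆ V := Finset.subset_biUnion_of_mem P hE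
    rw [← Finset.card_sdiff_of_subset hPV, ← Finset.card_powerset]
    refine Finset.card_image_of_injOn fun w hw w' hw' hww => ?_
    have hdis : ∀ w ⊆ V \ P E, (E ∪ w) \ E = w := by
      intro w hw
      rw [Finset.union_sdiff_left, Finset.sdiff_eq_self_iff_disjoint]
      refine Finset.disjoint_left.mpr fun a ha haE => ?_
      exact (Finset.mem_sdiff.mp (hw ha)).2 (Finset.mem_union_left _ haE)
    rw [← hdis w (Finset.mem_powerset.mp (Finset.mem_coe.mp hw)),
      ← hdis w' (Finset.mem_powerset.mp (Finset.mem_coe.mp hw'))]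
    exact congrArg (· \ E) hww
  have hdisj : (𝓔 : Set (Finset (Edge d))).PairwiseDisjoint cyl := by
    intro E hE E' hE' hne
    refine Finset.disjoint_left.mpr fun ω hω hω' => hne ?_
    have h1 := hmem E ω hω
    have h2 := hmem E' ω hω'
    exact (h𝓔 E hE).2.eq_of_window (h𝓔 E' hE').2 (h𝓔 E hE).1 (h𝓔 E' hE').1 h1.1 h2.1 h1.2 h2.2
  have hsub : 𝓔.biUnion cyl ⊆ V.powerset := by
    intro ω hω
    simp only [Finset.mem_biUnion, cyl, Finset.mem_image, Finset.mem_powerset] at hω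
    obtain ⟨E, hE, w, hw, rfl⟩ := hω
    have hPV : P E ⊆ V := Finset.subset_biUnion_of_mem P hE
    exact Finset.mem_powerset.mpr (Finset.union_subset
      (Finset.subset_union_left.trans hPV) (hw.trans Finset.sdiff_subset))
  have hsum : ∑ E ∈ 𝓔, 2 ^ (V.card - (P E).card) ≤ 2 ^ V.card := by
    rw [← Finset.sum_congr rfl hcard, ← Finset.card_biUnion hdisj, ← Finset.card_powerset]
    exact Finset.card_le_card hsub
  have hsum' : ∑ E ∈ 𝓔, (2 : ℝ) ^ (V.card - (P E).card) ≤ 2 ^ V.card := by exact_mod_cast hsum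
  have hpos : (0 : ℝ) < 2 ^ V.card := by positivity
  refine le_of_mul_le_mul_left ?_ hpos
  rw [mul_one, Finset.mul_sum]
  refine (Finset.sum_le_sum fun E hE => ?_).trans hsum'
  have hPV : (P E).card ≤ V.card := Finset.card_le_card (Finset.subset_biUnion_of_mem P hE)
  calc (2 : ℝ) ^ V.card * (1 / 2) ^ (adjDegree d * E.card)
      ≤ 2 ^ V.card * (1 / 2) ^ (P E).card := by
        refine mul_le_mul_of_nonneg_left ?_ hpos.le
        exact pow_le_pow_of_le_one (by norm_num) (by norm_num) (hPc E)
    _ = 2 ^ (V.card - (P E).card) := by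
        rw [pow_sub₀ _ (by norm_num) hPV, one_div, inv_pow]

lemma exists_edge_on_line {d : ℕ} {A : Finset (Site d)} {x : Site d} (hx : x ∈ A) (l : Fin d) :
    ∃ y, (y, l) ∈ edgeBoundary A ∧ ∀ k, k ≠ l → y k = x k := by
  obtain ⟨N, hN⟩ := exists_box_bound A
  by_contra! h
  have h1 : ∀ t, (Function.update x l t ∈ A ↔ Function.update x l (t + 1) ∈ A) := by
    intro t
    by_contra hc
    rw [update_succ] at hc
    obtain ⟨k, hk, hne⟩ := h _ (mem_edgeBoundary.mpr hc)
    exact hne (Function.update_of_ne hk _ _)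
  have h2 := int_fun_const (fun t => Function.update x l t ∈ A)
    (fun t => propext (h1 _).symm) (x l) (|N| + 1)
  simp only [Function.update_eq_self, eq_iff_iff] at h2
  have := hN _ (h2.mp hx) l
  simp only [Function.update_self] at this
  rw [abs_of_nonneg (by positivity)] at this
  linarith [le_abs_self N]

/-- Through a site of `A` at each level of coordinate `k` runs a line in another direction, and that
line must leave `A` at the same level. Distinct levels give distinct boundary edges. -/
lemma card_image_coord_le {d : ℕ} (hd : 2 ≤ d) (A : Finset (Site d)) (k : Fin d) :
    (A.image fun x => x k).card ≤ (edgeBoundary A).card := by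
  classical
  have : Nontrivial (Fin d) := Fin.nontrivial_iff_two_le.mpr hd
  obtain ⟨l, hl⟩ := exists_ne k
  refine le_trans (Finset.card_le_card ?_)
    (Finset.card_image_le (s := edgeBoundary A) (f := fun e => e.1 k))
  intro t ht
  obtain ⟨x, hx, rfl⟩ := Finset.mem_image.mp ht
  obtain ⟨y, hy, hyx⟩ := exists_edge_on_line hx l
  exact Finset.mem_image.mpr ⟨_, hy, hyx k hl.symm⟩

lemma card_le_card_edgeBoundary_pow {d : ℕ} (hd : 2 ≤ d) (A : Finset (Site d)) :
    A.card ≤ (edgeBoundary A).card ^ d := by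
  classical
  have h1 : A ⊆ Fintype.piFinset fun k => A.image fun x => x k := fun x hx =>
    Fintype.mem_piFinset.mpr fun k => Finset.mem_image_of_mem _ hx
  refine (Finset.card_le_card h1).trans ?_
  rw [Fintype.card_piFinset]
  refine (Finset.prod_le_pow_card _ _ _ fun k _ => card_image_coord_le hd A k).trans ?_
  simp

/-- Walk from `a` in the first direction to the first exit. The `t + 1` sites traversed have
distinct first coordinates, so `t + 1 ≤ |∂A|`. This pins the contour to one of few edges at a
distance paid for by its length. -/
lemma exists_anchor {d : ℕ} (hd : 2 ≤ d) (A : Finset (Site d)) (a : Site d) (ha : a ∈ A) :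
    ∃ t : ℕ, t < (edgeBoundary A).card ∧
      (Function.update a ⟨0, by omega⟩ (a ⟨0, by omega⟩ + t), (⟨0, by omega⟩ : Fin d))
        ∈ edgeBoundary A := by
  classical
  let o : Fin d := ⟨0, by omega⟩
  let p : ℕ → Site d := fun t => Function.update a o (a o + t)
  change ∃ t : ℕ, t < (edgeBoundary A).card ∧ (p t, o) ∈ edgeBoundary A
  obtain ⟨N, hN⟩ := exists_box_bound A
  have hp0 : p 0 = a := by simp [p]
  have hex : ∃ t : ℕ, p t ∉ A := by
    refine ⟨(|N| + 1 + |a o|).toNat, fun h => ?_⟩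
    have := hN _ h o
    simp only [p, Function.update_self, Int.toNat_of_nonneg (show 0 ≤ |N| + 1 + |a o| by positivity)]
      at this
    have h3 := le_abs_self (a o + (|N| + 1 + |a o|))
    have h4 := neg_abs_le (a o)
    linarith [le_abs_self N]
  have hspec := Nat.find_spec hex
  have hmin : ∀ m < Nat.find hex, p m ∈ A := fun m hm => by simpa using Nat.find_min hex hm
  obtain ⟨t, ht⟩ : ∃ t, Nat.find hex = t + 1 := by
    refine Nat.exists_eq_succ_of_ne_zero fun h => ?_
    rw [h, hp0] at hspec
    exact hspec ha
  rw [ht] at hspec hmin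
  have hsucc : p (t + 1) = p t + unitVec o := by
    simp only [p, Nat.cast_add, Nat.cast_one, ← add_assoc, update_succ]
  refine ⟨t, ?_, ?_⟩
  · have h1 : ((Finset.range (t + 1)).image fun s : ℕ => a o + (s : ℤ)) ⊆ A.image fun x => x o := by
      intro z hz
      obtain ⟨s, hs, rfl⟩ := Finset.mem_image.mp hz
      exact Finset.mem_image.mpr ⟨p s, hmin s (Finset.mem_range.mp hs), by simp [p]⟩
    have h2 := (Finset.card_le_card h1).trans (card_image_coord_le hd A o)
    rw [Finset.card_image_of_injective _ (fun s s' h => by simpa using h), Finset.card_range] at h2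
    omega
  · rw [mem_edgeBoundary]
    simp only [← hsucc, hmin t (by omega), hspec, iff_false, not_true_eq_false, not_false_eq_true]

/-- The base of the exponential in the contour counting estimates. -/
def contourBase (d : ℕ) : ℝ := 2 ^ (d + adjDegree d)

lemma contourBase_pos (d : ℕ) : 0 < contourBase d := by unfold contourBase; positivity

/-- With `n = |∂A|`, the volume satisfies `|A| ≤ n ^ d ≤ 2 ^ (d n)`, and the Kraft weight costs `2 ^
(adjDegree n)`; `contourBase` absorbs both. Since the anchor at distance `t` forces `n ≥ t + 1`,
each anchor contributes at most `y ^ (t + 1)`, and these form a geometric series. -/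
lemma sum_contours_le {d : ℕ} (hd : 2 ≤ d) (x : ℝ) (hx : 0 ≤ x) (hx' : contourBase d * x ≤ 1 / 2)
    (a : Site d) (𝓕 : Finset (Finset (Site d)))
    (h𝓕 : ∀ A ∈ 𝓕, a ∈ A ∧ EdgeConnected (edgeBoundary A)) :
    ∑ A ∈ 𝓕, (A.card : ℝ) * x ^ (edgeBoundary A).card ≤ 2 * (contourBase d * x) := by
  classical
  set y := contourBase d * x with hy
  have hy0 : 0 ≤ y := mul_nonneg (contourBase_pos d).le hx
  let o : Fin d := ⟨0, by omega⟩
  have hanch : ∀ A : Finset (Site d), ∃ t : ℕ, a ∈ A → t < (edgeBoundary A).card ∧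
      (Function.update a o (a o + t), o) ∈ edgeBoundary A := by
    intro A
    by_cases h : a ∈ A
    · obtain ⟨t, ht⟩ := exists_anchor hd A a h
      exact ⟨t, fun _ => ht⟩
    · exact ⟨0, fun h' => absurd h' h⟩
  choose t ht using hanch
  have hterm : ∀ A ∈ 𝓕, (A.card : ℝ) * x ^ (edgeBoundary A).card ≤
      y ^ (t A + 1) * (1 / 2 : ℝ) ^ (adjDegree d * (edgeBoundary A).card) := by
    intro A hA
    set n := (edgeBoundary A).card
    have h1 : (A.card : ℝ) ≤ (2 ^ n) ^ d := by
      have := card_le_card_edgeBoundary_pow hd A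
      have h2 : n ^ d ≤ (2 ^ n) ^ d := Nat.pow_le_pow_left (Nat.lt_two_pow_self).le d
      exact_mod_cast this.trans h2
    have h3 : y ^ n ≤ y ^ (t A + 1) :=
      pow_le_pow_of_le_one hy0 (hx'.trans (by norm_num)) (ht A (h𝓕 A hA).1).1
    calc (A.card : ℝ) * x ^ n ≤ (2 ^ n) ^ d * x ^ n :=
          mul_le_mul_of_nonneg_right h1 (by positivity)
      _ = y ^ n * (1 / 2 : ℝ) ^ (adjDegree d * n) := by
          rw [hy, contourBase, pow_mul, ← mul_pow, ← pow_mul, mul_comm n d, pow_mul, ← mul_pow]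
          congr 1
          rw [pow_add, one_div, inv_pow]
          field_simp
      _ ≤ _ := mul_le_mul_of_nonneg_right h3 (by positivity)
  refine (Finset.sum_le_sum hterm).trans ?_
  obtain ⟨n, hn⟩ : ∃ n, ∀ A ∈ 𝓕, t A ∈ Finset.range n :=
    ⟨(𝓕.sup t) + 1, fun A hA => Finset.mem_range.mpr (Nat.lt_succ_of_le (Finset.le_sup hA))⟩
  rw [← Finset.sum_fiberwise_of_maps_to hn]
  have hfib : ∀ s ∈ Finset.range n, ∑ A ∈ 𝓕 with t A = s,
      y ^ (t A + 1) * (1 / 2 : ℝ) ^ (adjDegree d * (edgeBoundary A).card) ≤ y ^ (s + 1) := by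
    intro s _
    rw [Finset.sum_congr rfl (g := fun A => y ^ (s + 1) *
      (1 / 2 : ℝ) ^ (adjDegree d * (edgeBoundary A).card)) (fun A hA => by
        rw [(Finset.mem_filter.mp hA).2]), ← Finset.mul_sum]
    refine mul_le_of_le_one_right (by positivity) ?_
    have := sum_connected_le_one (Function.update a o (a o + s), o)
      ((𝓕.filter fun A => t A = s).image edgeBoundary) (fun E hE => by
        obtain ⟨A, hA, rfl⟩ := Finset.mem_image.mp hE
        obtain ⟨hA1, hA2⟩ := Finset.mem_filter.mp hA
        have h1 := (ht A (h𝓕 A hA1).1).2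
        rw [hA2] at h1
        exact ⟨h1, (h𝓕 A hA1).2⟩)
    rwa [Finset.sum_image (fun A _ B _ h => edgeBoundary_injective (by omega) h)] at this
  refine (Finset.sum_le_sum hfib).trans ?_
  have hgeom : ∑ s ∈ Finset.range n, y ^ s ≤ 2 := by
    have h1 : ∑ s ∈ Finset.range n, y ^ s ≤ ∑ s ∈ Finset.range n, (1 / 2 : ℝ) ^ s :=
      Finset.sum_le_sum fun s _ => pow_le_pow_left₀ hy0 hx' s
    exact h1.trans (sum_geometric_two_le n)
  calc ∑ s ∈ Finset.range n, y ^ (s + 1) = (∑ s ∈ Finset.range n, y ^ s) * y := by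
        rw [Finset.sum_mul]; simp only [pow_succ]
    _ ≤ 2 * y := mul_le_mul_of_nonneg_right hgeom hy0

end Counting

/-! ### Interaction across a boundary is controlled by the boundary length. -/

section Geometry

variable {d : ℕ}

lemma siteDist_add (a i j : Site d) : siteDist (i + a) (j + a) = siteDist i j := by
  unfold siteDist
  congr 1
  refine Finset.sum_congr rfl fun k _ => ?_
  simp only [Pi.add_apply, Int.cast_add]
  ring

lemma siteDist_comm (i j : Site d) : siteDist i j = siteDist j i := by
  unfold siteDist
  congr 1
  exact Finset.sum_congr rfl fun k _ => by ring

lemma siteDist_nonneg (i j : Site d) : 0 ≤ siteDist i j := Real.sqrt_nonneg _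

lemma abs_coord_le_siteDist (x : Site d) (k : Fin d) : |(x k : ℝ)| ≤ siteDist 0 x := by
  unfold siteDist
  rw [← Real.sqrt_sq_eq_abs]
  refine Real.sqrt_le_sqrt ?_
  have := Finset.single_le_sum (f := fun k => (((0 : Site d) k : ℝ) - (x k : ℝ)) ^ 2)
    (fun _ _ => sq_nonneg _) (Finset.mem_univ k)
  simpa using this

lemma isNeighbor_comm (i j : Site d) : IsNeighbor i j ↔ IsNeighbor j i := by
  unfold IsNeighbor; rw [siteDist_comm]

lemma isNeighbor_add (a i j : Site d) : IsNeighbor (i + a) (j + a) ↔ IsNeighbor i j := by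
  unfold IsNeighbor; rw [siteDist_add]

lemma isNeighbor_iff (i j : Site d) :
    IsNeighbor i j ↔ ∃ k, j = i + unitVec k ∨ i = j + unitVec k := by
  constructor
  · intro h
    unfold IsNeighbor siteDist at h
    rw [Real.sqrt_eq_one] at h
    have h1 : ∑ k, (i k - j k) ^ 2 = 1 := by exact_mod_cast h
    obtain ⟨k, hk⟩ : ∃ k, i k - j k ≠ 0 := by
      by_contra! hc
      simp [hc] at h1
    have h2 := Finset.add_sum_erase Finset.univ (fun k => (i k - j k) ^ 2) (Finset.mem_univ k)
    simp only [h1] at h2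
    have h3 : 0 ≤ ∑ k ∈ Finset.univ.erase k, (i k - j k) ^ 2 :=
      Finset.sum_nonneg fun _ _ => sq_nonneg _
    have h4 : 1 ≤ (i k - j k) ^ 2 := by
      have := sq_pos_of_ne_zero hk
      omega
    have h5 : ∑ k ∈ Finset.univ.erase k, (i k - j k) ^ 2 = 0 := by omega
    have h6 : (i k - j k) ^ 2 = 1 := by omega
    rw [Finset.sum_eq_zero_iff_of_nonneg (fun _ _ => sq_nonneg _)] at h5
    have h7 : ∀ l, l ≠ k → i l = j l := fun l hl => by
      have := h5 l (by simp [hl])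
      have := pow_eq_zero_iff (two_ne_zero) |>.mp this
      omega
    refine ⟨k, ?_⟩
    rcases sq_eq_one_iff.mp h6 with h8 | h8
    · right
      ext l
      by_cases hl : l = k
      · subst hl; simp [unitVec]; omega
      · simp [unitVec, hl, h7 l hl]
    · left
      ext l
      by_cases hl : l = k
      · subst hl; simp [unitVec]; omega
      · simp [unitVec, hl, h7 l hl]
  · have key : ∀ (i : Site d) k, IsNeighbor i (i + unitVec k) := by
      intro i k
      unfold IsNeighbor siteDist
      rw [Real.sqrt_eq_one, Finset.sum_eq_single k]
      · simp [unitVec]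
      · intro l _ hl
        simp [unitVec, hl]
      · simp
    rintro ⟨k, rfl | rfl⟩
    · exact key _ _
    · exact (isNeighbor_comm _ _).mpr (key _ _)

/-- The set of nearest neighbours of a site. -/
def nbrs (i : Site d) : Finset (Site d) :=
  (Finset.univ.image fun k => i + unitVec k) ∪ Finset.univ.image fun k => i - unitVec k

lemma mem_nbrs {i j : Site d} : j ∈ nbrs i ↔ IsNeighbor i j := by
  rw [isNeighbor_iff]
  simp only [nbrs, Finset.mem_union, Finset.mem_image, Finset.mem_univ, true_and, ← exists_or]
  refine exists_congr fun k => or_congr eq_comm ?_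
  rw [sub_eq_iff_eq_add]

lemma card_nbrs_le (i : Site d) : (nbrs i).card ≤ 2 * d := by
  refine (Finset.card_union_le _ _).trans ?_
  have h1 : (Finset.univ.image fun k => i + unitVec k : Finset (Site d)).card ≤ d :=
    Finset.card_image_le.trans (by simp)
  have h2 : (Finset.univ.image fun k => i - unitVec k : Finset (Site d)).card ≤ d :=
    Finset.card_image_le.trans (by simp)
  omega

/-- The `ℓ¹` norm of a lattice vector. -/
def latticeNorm (x : Site d) : ℕ := ∑ k, (x k).natAbs

/-- The number of sites of `A` that leave `A` under translation by `x`. -/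
def exitCount (A : Finset (Site d)) (x : Site d) : ℕ := (A.filter fun i => i + x ∉ A).card

/-- A site leaving under `x + y` either leaves under `x`, or lands in `A` and then leaves under `y`.
-/
lemma exitCount_add_le (A : Finset (Site d)) (x y : Site d) :
    exitCount A (x + y) ≤ exitCount A x + exitCount A y := by
  classical
  unfold exitCount
  have h : (A.filter fun i => i + (x + y) ∉ A) ⊆ (A.filter fun i => i + x ∉ A) ∪
      (A.filter fun i => i + y ∉ A).image fun i => i - x := by
    intro i hi
    simp only [Finset.mem_filter, Finset.mem_union, Finset.mem_image] at hi ⊢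
    by_cases hx : i + x ∈ A
    · exact Or.inr ⟨i + x, ⟨hx, by rw [add_assoc]; exact hi.2⟩, by simp⟩
    · exact Or.inl ⟨hi.1, hx⟩
  refine (Finset.card_le_card h).trans ((Finset.card_union_le _ _).trans ?_)
  exact Nat.add_le_add_left Finset.card_image_le _

lemma exitCount_unitVec_le (A : Finset (Site d)) (k : Fin d) :
    exitCount A (unitVec k) ≤ (edgeBoundary A).card := by
  refine Finset.card_le_card_of_injOn (fun i => (i, k)) (fun i hi => ?_)
    (fun i _ j _ h => (Prod.mk.inj h).1)
  simp only [Finset.coe_filter, Set.mem_ofPred_eq] at hi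
  simp [mem_edgeBoundary, hi.1, hi.2]

lemma exitCount_neg_unitVec_le (A : Finset (Site d)) (k : Fin d) :
    exitCount A (-unitVec k) ≤ (edgeBoundary A).card := by
  refine Finset.card_le_card_of_injOn (fun i => (i - unitVec k, k)) (fun i hi => ?_)
    (fun i _ j _ h => by simpa using (Prod.mk.inj h).1)
  simp only [Finset.coe_filter, Set.mem_ofPred_eq, ← sub_eq_add_neg] at hi
  simp [mem_edgeBoundary, hi.1, hi.2]

lemma exitCount_zero (A : Finset (Site d)) : exitCount A 0 = 0 := by
  simp [exitCount]

lemma exitCount_nsmul_le (A : Finset (Site d)) (x : Site d) (n : ℕ) :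
    exitCount A (n • x) ≤ n * exitCount A x := by
  induction n with
  | zero => simp [exitCount_zero]
  | succ n ih =>
    rw [succ_nsmul, Nat.succ_mul]
    exact (exitCount_add_le _ _ _).trans (by omega)

lemma exitCount_sum_le {ι : Type*} (A : Finset (Site d)) (s : Finset ι) (x : ι → Site d) :
    exitCount A (∑ k ∈ s, x k) ≤ ∑ k ∈ s, exitCount A (x k) := by
  classical
  induction s using Finset.induction_on with
  | empty => simp [exitCount_zero]
  | insert a s ha ih =>
    rw [Finset.sum_insert ha, Finset.sum_insert ha]
    exact (exitCount_add_le _ _ _).trans (by omega)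

/-- Decompose `x` into unit steps; by subadditivity each step costs at most one boundary length. -/
lemma exitCount_le (A : Finset (Site d)) (x : Site d) :
    exitCount A x ≤ latticeNorm x * (edgeBoundary A).card := by
  have hx : x = ∑ k, x k • (unitVec k : Site d) := by
    ext l
    simp [Finset.sum_apply, unitVec, Pi.single_apply]
  have h1 : ∀ k, exitCount A (x k • (unitVec k : Site d)) ≤ (x k).natAbs * (edgeBoundary A).card := by
    intro k
    rcases Int.natAbs_eq (x k) with h | h
    · rw [h, natCast_zsmul, Int.natAbs_natCast]
      exact (exitCount_nsmul_le _ _ _).trans (Nat.mul_le_mul_left _ (exitCount_unitVec_le A k))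
    · have : x k • (unitVec k : Site d) = (x k).natAbs • (-unitVec k : Site d) := by
        conv_lhs => rw [h]
        rw [neg_smul, natCast_zsmul, smul_neg]
      rw [this]
      exact (exitCount_nsmul_le _ _ _).trans (Nat.mul_le_mul_left _ (exitCount_neg_unitVec_le A k))
  conv_lhs => rw [hx]
  refine (exitCount_sum_le _ _ _).trans ((Finset.sum_le_sum fun k _ => h1 k).trans ?_)
  rw [latticeNorm, Finset.sum_mul]

/-- The total interaction across the boundary of a finite set is bounded by a multiple of the
length of the boundary. -/
lemma sum_tsum_exit_le (k : Site d → ℝ) (hk : ∀ x, 0 ≤ k x) (hk0 : Summable k)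
    (hk1 : Summable fun x => k x * latticeNorm x) (A : Finset (Site d)) :
    ∑ i ∈ A, ∑' j, (if j ∈ A then 0 else k (j - i)) ≤
      (∑' x, k x * latticeNorm x) * (edgeBoundary A).card := by
  -- Summing over displacements instead of endpoints turns the inner sum over `A` into `exitCount`.
  have h1 : ∀ i, ∑' j, (if j ∈ A then 0 else k (j - i)) =
      ∑' x, (if i + x ∈ A then 0 else k x) := by
    intro i
    rw [← (Equiv.addLeft i).tsum_eq]
    simp
  have hs : ∀ i, Summable fun x => (if i + x ∈ A then 0 else k x) := fun i =>
    hk0.of_nonneg_of_le (fun x => by split_ifs <;> simp [hk]) (fun x => by split_ifs <;> simp [hk])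
  rw [Finset.sum_congr rfl fun i _ => h1 i, ← Summable.tsum_finsetSum fun i _ => hs i,
    ← tsum_mul_right]
  refine Summable.tsum_le_tsum (fun x => ?_) (summable_sum fun i _ => hs i) (hk1.mul_right _)
  have h2 : ∑ i ∈ A, (if i + x ∈ A then 0 else k x) = exitCount A x * k x := by
    rw [exitCount, Finset.card_filter, Nat.cast_sum, Finset.sum_mul]
    refine Finset.sum_congr rfl fun i _ => ?_
    by_cases h : i + x ∈ A <;> simp [h]
  rw [h2, mul_assoc, mul_comm]
  refine mul_le_mul_of_nonneg_left ?_ (hk x)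
  exact_mod_cast exitCount_le A x

/-- The number of nearest-neighbour pairs across the boundary. -/
lemma card_edgeBoundary_le (A : Finset (Site d)) :
    (edgeBoundary A).card ≤ ∑ i ∈ A, ((nbrs i).filter fun j => j ∉ A).card := by
  classical
  rw [← Finset.card_sigma]
  -- Send each boundary edge to the ordered pair of its inner and its outer endpoint.
  refine Finset.card_le_card_of_injOn
    (fun e => if e.1 ∈ A then ⟨e.1, e.1 + unitVec e.2⟩ else ⟨e.1 + unitVec e.2, e.1⟩) ?_ ?_
  · intro e he
    have he := mem_edgeBoundary.mp (Finset.mem_coe.mp he)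
    by_cases h : e.1 ∈ A
    · have h2 : e.1 + unitVec e.2 ∉ A := by tauto
      simpa [h, h2, mem_nbrs, isNeighbor_iff] using ⟨e.2, Or.inl rfl⟩
    · have h2 : e.1 + unitVec e.2 ∈ A := by tauto
      simpa [h, h2, mem_nbrs, isNeighbor_iff] using ⟨e.2, Or.inr rfl⟩
  · have hu : ∀ k l : Fin d, (unitVec k : Site d) = unitVec l → k = l := by
      intro k l h
      have := congrFun h k
      simp only [unitVec, Pi.single_eq_same] at this
      by_contra hne
      simp [Pi.single_eq_of_ne hne] at this
    have hn : ∀ k l : Fin d, (unitVec k : Site d) + unitVec l ≠ 0 := by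
      intro k l h
      have := congrFun h k
      have h1 := abs_unitVec_le l k
      have h2 : (unitVec k : Site d) k = 1 := by simp [unitVec]
      simp only [Pi.add_apply, Pi.zero_apply] at this
      omega
    rintro ⟨x, k⟩ _ ⟨y, l⟩ _ h
    simp only at h
    split_ifs at h with h1 h2 h2
    · simp only [Sigma.mk.injEq, heq_eq_eq] at h
      obtain ⟨rfl, h⟩ := h
      rw [hu k l (by simpa using h)]
    · simp only [Sigma.mk.injEq, heq_eq_eq] at h
      obtain ⟨rfl, h⟩ := h
      exact absurd (by rw [add_assoc] at h; simpa using h) (hn l k)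
    · simp only [Sigma.mk.injEq, heq_eq_eq] at h
      obtain ⟨h, rfl⟩ := h
      exact absurd (by rw [add_assoc] at h; simpa using h) (hn l k)
    · simp only [Sigma.mk.injEq, heq_eq_eq] at h
      obtain ⟨h, rfl⟩ := h
      rw [hu k l (by simpa using h)]

end Geometry

/-! ### Summability and first moments of the couplings. -/

section Coupling

variable {d : ℕ}

lemma longRange_nonneg (s : ℝ) (i j : Site d) : 0 ≤ longRange s i j := by
  unfold longRange
  split_ifs
  · exact le_rfl
  · exact div_nonneg zero_le_one (Real.rpow_nonneg (siteDist_nonneg _ _) _)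

lemma longRange_comm (s : ℝ) (i j : Site d) : longRange s i j = longRange s j i := by
  unfold longRange; simp only [siteDist_comm i j, eq_comm]

lemma longRange_add (s : ℝ) (a i j : Site d) :
    longRange s (i + a) (j + a) = longRange s i j := by
  unfold longRange; simp only [siteDist_add, add_left_inj]

lemma longRange_eq_sub (s : ℝ) (i j : Site d) : longRange s i j = longRange s 0 (j - i) := by
  rw [← longRange_add s i 0 (j - i)]; simp

lemma coupling_comm (s J : ℝ) (i j : Site d) : coupling s J i j = coupling s J j i := by
  unfold coupling
  rw [longRange_comm s i j]
  congr 1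
  classical exact if_congr (isNeighbor_comm i j) rfl rfl

lemma coupling_add (s J : ℝ) (a i j : Site d) :
    coupling s J (i + a) (j + a) = coupling s J i j := by
  unfold coupling
  rw [longRange_add]
  congr 1
  classical exact if_congr (isNeighbor_add a i j) rfl rfl

lemma coupling_eq_sub (s J : ℝ) (i j : Site d) : coupling s J i j = coupling s J 0 (j - i) := by
  rw [← coupling_add s J i 0 (j - i)]; simp

lemma coupling_of_not_isNeighbor (s J : ℝ) {i j : Site d} (h : ¬IsNeighbor i j) :
    coupling s J i j = longRange s i j := by simp [coupling, h]

/-- Sites embed injectively in the integral span of the standard basis of Euclidean space, where the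
lattice sum is known to converge. -/
lemma summable_siteDist_rpow {r : ℝ} (hr : r < -(d : ℝ)) :
    Summable fun x : Site d => siteDist 0 x ^ r := by
  let b := (EuclideanSpace.basisFun (Fin d) ℝ).toBasis
  let L := Submodule.span ℤ (Set.range b)
  have hrank : Module.finrank ℤ L = d := by
    rw [ZLattice.rank ℝ L]; simp
  have h1 := ZLattice.summable_norm_rpow L r (by rw [hrank]; exact hr)
  have hmem : ∀ x : Site d, WithLp.toLp 2 (fun k => (x k : ℝ)) ∈ L := by
    intro x
    have : WithLp.toLp 2 (fun k => (x k : ℝ)) = ∑ k, x k • b k := by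
      ext l
      simp [b, Finset.sum_apply, Pi.single_apply]
    rw [this]
    exact Submodule.sum_mem _ fun k _ => Submodule.smul_mem _ _
      (Submodule.subset_span (Set.mem_range_self k))
  have h2 := h1.comp_injective (i := fun x : Site d => (⟨_, hmem x⟩ : L)) (fun x y h => by
    have h := congrArg Subtype.val h
    ext k
    have : (x k : ℝ) = y k := congrFun (congrArg WithLp.ofLp h) k
    exact_mod_cast this)
  refine h2.congr fun x => ?_
  simp [siteDist, EuclideanSpace.norm_eq]

lemma latticeNorm_le (x : Site d) : (latticeNorm x : ℝ) ≤ d * siteDist 0 x := by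
  have : (latticeNorm x : ℝ) = ∑ k, |(x k : ℝ)| := by
    simp [latticeNorm, Nat.cast_natAbs]
  rw [this]
  refine (Finset.sum_le_sum fun k _ => abs_coord_le_siteDist x k).trans ?_
  simp

lemma latticeNorm_pos {x : Site d} (hx : x ≠ 0) : 1 ≤ latticeNorm x := by
  obtain ⟨k, hk⟩ := Function.ne_iff.mp hx
  calc 1 ≤ (x k).natAbs := Int.natAbs_pos.mpr hk
    _ ≤ _ := Finset.single_le_sum (f := fun k => (x k).natAbs) (fun _ _ => Nat.zero_le _)
        (Finset.mem_univ k)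

lemma siteDist_pos {x : Site d} (hx : x ≠ 0) : 0 < siteDist 0 x := by
  obtain ⟨k, hk⟩ := Function.ne_iff.mp hx
  refine lt_of_lt_of_le ?_ (abs_coord_le_siteDist x k)
  simpa using hk

/-- The condition `s > d + 1` enters here: the summand is at most `d |x| ^ (1 - s)`, and `1 - s <
-d`. -/
lemma summable_longRange_mul {s : ℝ} (hs : (d : ℝ) + 1 < s) :
    Summable fun x : Site d => longRange s 0 x * latticeNorm x := by
  refine ((summable_siteDist_rpow (d := d) (r := 1 - s) (by linarith)).mul_left (d : ℝ)).of_nonneg_of_le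
    (fun x => mul_nonneg (longRange_nonneg _ _ _) (Nat.cast_nonneg _)) fun x => ?_
  by_cases hx : x = 0
  · subst hx
    simp only [longRange, if_true, zero_mul]
    exact mul_nonneg (Nat.cast_nonneg _) (Real.rpow_nonneg (siteDist_nonneg _ _) _)
  · rw [longRange, if_neg (Ne.symm hx), Real.rpow_sub (siteDist_pos hx), Real.rpow_one]
    have h := latticeNorm_le x
    have h2 : 0 < siteDist 0 x ^ s := Real.rpow_pos_of_pos (siteDist_pos hx) _
    rw [one_div, inv_mul_eq_div, mul_div_assoc']
    gcongr

lemma summable_of_latticeNorm {k : Site d → ℝ} (hk : ∀ x, 0 ≤ k x)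
    (h : Summable fun x => k x * latticeNorm x) : Summable k := by
  have h0 : Summable fun x : Site d => (if x = 0 then k 0 else 0) :=
    summable_of_ne_finset_zero (s := {0}) fun x hx => by simp at hx; simp [hx]
  refine (h.add h0).of_nonneg_of_le hk fun x => ?_
  by_cases hx : x = 0
  · subst hx
    simp only [if_true]
    exact le_add_of_nonneg_left (mul_nonneg (hk _) (Nat.cast_nonneg _))
  · simp only [hx, if_false, add_zero]
    exact le_mul_of_one_le_right (hk x) (by exact_mod_cast latticeNorm_pos hx)

lemma summable_longRange {s : ℝ} (hs : (d : ℝ) + 1 < s) (i : Site d) :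
    Summable fun j : Site d => longRange s i j := by
  have h := summable_of_latticeNorm (fun x => longRange_nonneg s 0 x) (summable_longRange_mul hs)
  refine ((Equiv.subRight i).summable_iff.mpr h).congr fun j => ?_
  simp [longRange_eq_sub s i j]

open Classical in
lemma abs_coupling_le (s J : ℝ) (i j : Site d) :
    |coupling s J i j| ≤ (if IsNeighbor i j then |J| else 0) + longRange s i j := by
  unfold coupling
  refine (abs_add_le _ _).trans ?_
  rw [abs_of_nonneg (longRange_nonneg s i j)]
  gcongr
  split_ifs <;> simp

lemma summable_coupling_mul {s : ℝ} (hs : (d : ℝ) + 1 < s) (J : ℝ) :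
    Summable fun x : Site d => |coupling s J 0 x| * latticeNorm x := by
  classical
  have h0 : Summable fun x : Site d => (if IsNeighbor 0 x then |J| else 0) * (latticeNorm x : ℝ) :=
    summable_of_ne_finset_zero (s := nbrs 0) fun x hx => by
      rw [mem_nbrs] at hx; simp [hx]
  refine (h0.add (summable_longRange_mul hs)).of_nonneg_of_le
    (fun x => by positivity) fun x => ?_
  rw [← add_mul]
  exact mul_le_mul_of_nonneg_right (abs_coupling_le s J 0 x) (Nat.cast_nonneg _)

lemma summable_abs_coupling {s : ℝ} (hs : (d : ℝ) + 1 < s) (J : ℝ) (i : Site d) :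
    Summable fun j : Site d => |coupling s J i j| := by
  have h := summable_of_latticeNorm (fun x => abs_nonneg _) (summable_coupling_mul hs J)
  refine ((Equiv.subRight i).summable_iff.mpr h).congr fun j => ?_
  simp [coupling_eq_sub s J i j]

lemma tsum_longRange {s : ℝ} (i : Site d) :
    ∑' j, longRange s i j = ∑' j, longRange s (0 : Site d) j := by
  rw [← (Equiv.subRight i).tsum_eq fun j => longRange s (0 : Site d) j]
  simp [← longRange_eq_sub s i]

/-- The first moment of the long-range coupling. -/
def longRangeMoment (d : ℕ) (s : ℝ) : ℝ := ∑' x : Site d, longRange s 0 x * latticeNorm x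

lemma longRangeMoment_nonneg (d : ℕ) (s : ℝ) : 0 ≤ longRangeMoment d s :=
  tsum_nonneg fun _ => mul_nonneg (longRange_nonneg _ _ _) (Nat.cast_nonneg _)

lemma sum_longRange_exit_le {s : ℝ} (hs : (d : ℝ) + 1 < s) (A : Finset (Site d)) :
    ∑ i ∈ A, ∑' j, (if j ∈ A then 0 else longRange s i j) ≤
      longRangeMoment d s * (edgeBoundary A).card := by
  have h1 := summable_longRange_mul (d := d) hs
  have := sum_tsum_exit_le _ (fun x => longRange_nonneg s 0 x)
    (summable_of_latticeNorm (fun x => longRange_nonneg s 0 x) h1) h1 A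
  simpa only [← longRange_eq_sub, longRangeMoment] using this

lemma sum_coupling_exit_le {s : ℝ} (hs : (d : ℝ) + 1 < s) (J : ℝ) (A : Finset (Site d)) :
    ∑ i ∈ A, ∑' j, (if j ∈ A then 0 else |coupling s J i j|) ≤
      (∑' x : Site d, |coupling s J 0 x| * latticeNorm x) * (edgeBoundary A).card := by
  have h1 := summable_coupling_mul (d := d) hs J
  have := sum_tsum_exit_le _ (fun x => abs_nonneg (coupling s J 0 x))
    (summable_of_latticeNorm (fun x => abs_nonneg _) h1) h1 A
  simpa only [← coupling_eq_sub] using this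

end Coupling

/-! ### Spin flips and their energy. -/

section Spins

variable {d : ℕ}

instance instMeasurableSingletonClassSign : MeasurableSingletonClass ℤˣ :=
  ⟨fun u => ⟨{(u : ℤ)}, measurableSet_singleton _, by ext v; simp [Units.ext_iff]⟩⟩

instance instBorelSpaceSign : BorelSpace ℤˣ :=
  ⟨by
    have h1 : (inferInstance : MeasurableSpace ℤˣ) = ⊤ :=
      top_le_iff.mp fun s _ => (Set.toFinite s).measurableSet
    have h2 : borel ℤˣ = ⊤ :=
      top_le_iff.mp fun s _ => MeasurableSpace.measurableSet_generateFrom (isOpen_discrete s)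
    rw [h2]; exact h1⟩

/-- The configuration with the spins in `T` reversed. -/
def flipSet (T : Finset (Site d)) (σ : Config d) : Config d :=
  fun i => if i ∈ T then -σ i else σ i

lemma flipSet_flipSet (T : Finset (Site d)) (σ : Config d) : flipSet T (flipSet T σ) = σ := by
  ext i
  by_cases h : i ∈ T <;> simp [flipSet, h]

lemma flipSet_of_mem {T : Finset (Site d)} {i : Site d} (h : i ∈ T) (σ : Config d) :
    flipSet T σ i = -σ i := if_pos h

lemma flipSet_of_notMem {T : Finset (Site d)} {i : Site d} (h : i ∉ T) (σ : Config d) :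
    flipSet T σ i = σ i := if_neg h

lemma continuous_flipSet (T : Finset (Site d)) : Continuous (flipSet T) := by
  refine continuous_pi fun i => ?_
  by_cases h : i ∈ T
  · simp only [flipSet_of_mem h]
    exact continuous_of_discreteTopology.comp (continuous_apply i)
  · simp only [flipSet_of_notMem h]
    exact continuous_apply i

lemma measurable_flipSet (T : Finset (Site d)) : Measurable (flipSet T) :=
  (continuous_flipSet T).measurable

lemma spin_eq (σ : Config d) (i : Site d) : spin σ i = 1 ∨ spin σ i = -1 := by
  unfold spin
  rcases Int.units_eq_one_or (σ i) with h | h <;> simp [h]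

lemma abs_spin (σ : Config d) (i : Site d) : |spin σ i| = 1 := by
  rcases spin_eq σ i with h | h <;> simp [h]

lemma spin_flipSet (T : Finset (Site d)) (σ : Config d) (i : Site d) :
    spin (flipSet T σ) i = if i ∈ T then -spin σ i else spin σ i := by
  unfold spin flipSet
  split_ifs <;> simp

lemma continuous_spin (i : Site d) : Continuous fun σ : Config d => spin σ i :=
  (continuous_of_discreteTopology (f := fun u : ℤˣ => ((u : ℤ) : ℝ))).comp (continuous_apply i)

lemma abs_coupling_spin (s J : ℝ) (σ : Config d) (i j : Site d) :
    |coupling s J i j * spin σ i * spin σ j| = |coupling s J i j| := by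
  rw [abs_mul, abs_mul, abs_spin, abs_spin, mul_one, mul_one]

/-- The energy difference `H(flipSet T σ) - H(σ)`. -/
def flipEnergy (s J : ℝ) (T : Finset (Site d)) (σ : Config d) : ℝ :=
  -2 * ∑ i ∈ T, ∑' j, (if j ∈ T then 0 else coupling s J i j * spin σ i * spin σ j)

/-- Only pairs with exactly one site in `T` change sign. The difference does not depend on `Λ ⊇ T`,
which is what makes a volume-free form of the Gibbs property possible. -/
lemma hamiltonian_flipSet {s : ℝ} (hs : (d : ℝ) + 1 < s) (J : ℝ) {T Λ : Finset (Site d)}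
    (hT : T ⊆ Λ) (σ : Config d) :
    hamiltonian s J Λ (flipSet T σ) = hamiltonian s J Λ σ + flipEnergy s J T σ := by
  classical
  set a : Site d → Site d → ℝ := fun i j => coupling s J i j * spin σ i * spin σ j with ha
  have hsymm : ∀ i j, a i j = a j i := fun i j => by
    simp only [ha]; rw [coupling_comm]; ring
  have hsum : ∀ i (c : Site d → ℝ), (∀ j, |c j| ≤ 2) → Summable fun j => c j * a i j := by
    intro i c hc
    refine Summable.of_abs (((summable_abs_coupling hs J i).mul_left 2).of_nonneg_of_le
      (fun _ => abs_nonneg _) fun j => ?_)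
    rw [abs_mul, ha, abs_coupling_spin]
    exact mul_le_mul_of_nonneg_right (hc j) (abs_nonneg _)
  let q : Site d → ℝ := fun j => if j ∈ Λ then 1 / 2 else 1
  have hq : ∀ j, |q j| ≤ 2 := fun j => by simp only [q]; split_ifs <;> norm_num
  have hrow : ∀ i, ∑' j, q j * (coupling s J i j * spin (flipSet T σ) i * spin (flipSet T σ) j)
      = ∑' j, q j * a i j + -2 * ∑' j, (if (i ∈ T ↔ j ∈ T) then 0 else q j) * a i j := by
    intro i
    rw [← tsum_mul_left, ← Summable.tsum_add (hsum i q hq)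
      ((hsum i _ fun j => by split_ifs <;> simp [hq]).mul_left _)]
    refine tsum_congr fun j => ?_
    simp only [spin_flipSet, ha]
    by_cases h1 : i ∈ T <;> by_cases h2 : j ∈ T <;> simp [h1, h2] <;> ring
  have hH : ∀ σ', hamiltonian s J Λ σ' =
      ∑ i ∈ Λ, ∑' j, q j * (coupling s J i j * spin σ' i * spin σ' j) := fun _ => rfl
  rw [hH, hH, Finset.sum_congr rfl fun i _ => hrow i, Finset.sum_add_distrib, ← Finset.mul_sum]
  congr 1
  unfold flipEnergy
  congr 1
  rw [← Finset.sum_sdiff hT]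
  -- Pairs between `T` and `Λ \ T` appear in both orders with weight 1/2. By symmetry the rows
  -- outside `T` supply the half missing from the rows in `T`.
  have h1 : ∑ i ∈ Λ \ T, ∑' j, (if (i ∈ T ↔ j ∈ T) then 0 else q j) * a i j =
      ∑ i ∈ T, ∑ j ∈ Λ \ T, 1 / 2 * a i j := by
    rw [Finset.sum_comm]
    refine Finset.sum_congr rfl fun i hi => ?_
    have hiT := (Finset.mem_sdiff.mp hi).2
    rw [tsum_eq_sum (s := T) fun j hj => by simp [hiT, hj]]
    refine Finset.sum_congr rfl fun j hj => ?_
    simp [hiT, hj, q, hT hj, hsymm i j]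
  rw [h1, ← Finset.sum_add_distrib]
  refine Finset.sum_congr rfl fun i hi => ?_
  have h2 : ∑ j ∈ Λ \ T, 1 / 2 * a i j = ∑' j, (if j ∈ Λ \ T then 1 / 2 else 0) * a i j := by
    rw [tsum_eq_sum (s := Λ \ T) fun j hj => by simp only [hj, if_false, zero_mul]]
    exact Finset.sum_congr rfl fun j hj => by simp only [hj, if_true]
  rw [h2, ← Summable.tsum_add (hsum i _ fun j => by split_ifs <;> norm_num)
    (hsum i _ fun j => by split_ifs <;> simp [hq])]
  refine tsum_congr fun j => ?_
  by_cases h3 : j ∈ T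
  · simp [h3, hi]
  · by_cases h4 : j ∈ Λ <;> simp [h3, h4, hi, q, ha]
    ring

lemma continuous_flipEnergy {s : ℝ} (hs : (d : ℝ) + 1 < s) (J : ℝ) (T : Finset (Site d)) :
    Continuous (flipEnergy s J T) := by
  refine continuous_const.mul (continuous_finsetSum _ fun i _ => ?_)
  refine continuous_tsum (u := fun j => |coupling s J i j|) (fun j => ?_)
    (summable_abs_coupling hs J i) fun j σ => ?_
  · split_ifs
    · exact continuous_const
    · exact (continuous_const.mul (continuous_spin i)).mul (continuous_spin j)
  · split_ifs
    · simp
    · rw [Real.norm_eq_abs, abs_coupling_spin]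

lemma measurable_flipEnergy {s : ℝ} (hs : (d : ℝ) + 1 < s) (J : ℝ) (T : Finset (Site d)) :
    Measurable (flipEnergy s J T) := (continuous_flipEnergy hs J T).measurable

lemma continuous_hamiltonian {s : ℝ} (hs : (d : ℝ) + 1 < s) (J : ℝ) (Λ : Finset (Site d)) :
    Continuous (hamiltonian s J Λ) := by
  refine continuous_finsetSum _ fun i _ => ?_
  refine continuous_tsum (u := fun j => |coupling s J i j|) (fun j => ?_)
    (summable_abs_coupling hs J i) fun j σ => ?_
  · exact continuous_const.mul ((continuous_const.mul (continuous_spin i)).mul (continuous_spin j))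
  · rw [norm_mul, Real.norm_eq_abs (coupling s J i j * _ * _), abs_coupling_spin]
    refine mul_le_of_le_one_left (abs_nonneg _) ?_
    split_ifs <;> norm_num

end Spins

/-! ### Gibbs measures as flip-invariant measures. -/

section Gibbs

variable {d : ℕ}

lemma glue_of_mem {Λ : Finset (Site d)} {i : Site d} (h : i ∈ Λ) (τ : Λ → ℤˣ) (η : Config d) :
    glue Λ τ η i = τ ⟨i, h⟩ := dif_pos h

lemma glue_of_notMem {Λ : Finset (Site d)} {i : Site d} (h : i ∉ Λ) (τ : Λ → ℤˣ)
    (η : Config d) : glue Λ τ η i = η i := dif_neg h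

lemma glue_restrict (Λ : Finset (Site d)) (σ : Config d) : glue Λ (fun i => σ i.1) σ = σ := by
  funext i
  by_cases h : i ∈ Λ
  · rw [glue_of_mem h]
  · rw [glue_of_notMem h]

lemma flipSet_glue (T : Finset (Site d)) (τ : T → ℤˣ) (η : Config d) :
    flipSet T (glue T τ η) = glue T (-τ) η := by
  funext i
  by_cases h : i ∈ T
  · rw [flipSet_of_mem h, glue_of_mem h, glue_of_mem h]; rfl
  · rw [flipSet_of_notMem h, glue_of_notMem h, glue_of_notMem h]

lemma measurable_outside_apply {Λ : Finset (Site d)} {i : Site d} (h : i ∉ Λ) :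
    Measurable[outside Λ] fun σ : Config d => σ i := by
  intro S hS
  exact ⟨(fun f : {i : Site d // i ∉ Λ} → ℤˣ => f ⟨i, h⟩) ⁻¹' S, measurable_pi_apply _ hS, rfl⟩

lemma measurable_glue (Λ : Finset (Site d)) (τ : Λ → ℤˣ) : Measurable[outside Λ] (glue Λ τ) := by
  refine @measurable_pi_lambda _ _ _ (outside Λ) _ _ fun i => ?_
  by_cases h : i ∈ Λ
  · simp only [glue_of_mem h]
    exact @measurable_const _ _ _ (outside Λ) _
  · simp only [glue_of_notMem h]
    exact measurable_outside_apply h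

lemma outside_le (Λ : Finset (Site d)) : outside Λ ≤ (inferInstance : MeasurableSpace (Config d)) :=
  Measurable.comap_le (by fun_prop)

lemma eq_of_measurable_outside {Λ : Finset (Site d)} {φ : Config d → ENNReal}
    (hφ : Measurable[outside Λ] φ) {σ σ' : Config d} (h : ∀ i, i ∉ Λ → σ i = σ' i) :
    φ σ = φ σ' := by
  obtain ⟨S, _, hS⟩ := hφ (measurableSet_singleton (φ σ))
  have h1 : σ ∈ φ ⁻¹' {φ σ} := rfl
  rw [← hS] at h1
  have h2 : σ' ∈ φ ⁻¹' {φ σ} := by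
    rw [← hS]
    have : (fun i : {i : Site d // i ∉ Λ} => σ' i.1) = fun i => σ i.1 := by
      funext i; exact (h i i.2).symm
    simpa only [Set.mem_preimage, this] using h1
  exact h2.symm

/-- The Gibbs specification at zero field. -/
def gibbsKernel (s J β : ℝ) (Λ : Finset (Site d)) (τ : Λ → ℤˣ) (η : Config d) : ℝ :=
  boltzmann s J β 0 Λ (glue Λ τ η) / partitionFunction s J β 0 Λ η

lemma boltzmann_pos (s J β h : ℝ) (Λ : Finset (Site d)) (σ : Config d) :
    0 < boltzmann s J β h Λ σ := Real.exp_pos _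

lemma partitionFunction_pos (s J β h : ℝ) (Λ : Finset (Site d)) (η : Config d) :
    0 < partitionFunction s J β h Λ η :=
  Finset.sum_pos (fun _ _ => boltzmann_pos _ _ _ _ _ _) Finset.univ_nonempty

lemma gibbsKernel_pos (s J β : ℝ) (Λ : Finset (Site d)) (τ : Λ → ℤˣ) (η : Config d) :
    0 < gibbsKernel s J β Λ τ η := div_pos (boltzmann_pos _ _ _ _ _ _) (partitionFunction_pos _ _ _ _ _ _)

lemma sum_gibbsKernel (s J β : ℝ) (Λ : Finset (Site d)) (η : Config d) :
    ∑ τ, gibbsKernel s J β Λ τ η = 1 := by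
  unfold gibbsKernel
  rw [← Finset.sum_div]
  exact div_self (partitionFunction_pos _ _ _ _ _ _).ne'

lemma gibbsKernel_le_one (s J β : ℝ) (Λ : Finset (Site d)) (τ : Λ → ℤˣ) (η : Config d) :
    gibbsKernel s J β Λ τ η ≤ 1 := by
  rw [← sum_gibbsKernel s J β Λ η]
  exact Finset.single_le_sum (fun τ _ => (gibbsKernel_pos s J β Λ τ η).le) (Finset.mem_univ τ)

lemma measurable_boltzmann {s : ℝ} (hs : (d : ℝ) + 1 < s) (J β h : ℝ) (Λ : Finset (Site d)) :
    Measurable (boltzmann s J β h Λ) := by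
  have h1 : Continuous (boltzmann s J β h Λ) := by
    refine Real.continuous_exp.comp (continuous_const.mul ((continuous_hamiltonian hs J Λ).sub
      (continuous_const.mul (continuous_finsetSum _ fun i _ => continuous_spin i))))
  exact h1.measurable

lemma measurable_gibbsKernel {s : ℝ} (hs : (d : ℝ) + 1 < s) (J β : ℝ) (Λ : Finset (Site d))
    (τ : Λ → ℤˣ) : Measurable[outside Λ] (gibbsKernel s J β Λ τ) := by
  have h : ∀ τ : Λ → ℤˣ, Measurable[outside Λ] fun η => boltzmann s J β 0 Λ (glue Λ τ η) :=
    fun τ => (measurable_boltzmann hs J β 0 Λ).comp (measurable_glue Λ τ)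
  have h2 : Measurable[outside Λ] fun η => partitionFunction s J β 0 Λ η := by
    unfold partitionFunction
    exact Finset.measurable_fun_sum _ fun τ _ => h τ
  exact (h τ).div h2

lemma boltzmann_flipSet {s : ℝ} (hs : (d : ℝ) + 1 < s) (J β : ℝ) {T Λ : Finset (Site d)}
    (hT : T ⊆ Λ) (σ : Config d) : boltzmann s J β 0 Λ (flipSet T σ) =
      boltzmann s J β 0 Λ σ * Real.exp (-β * flipEnergy s J T σ) := by
  unfold boltzmann
  rw [← Real.exp_add, hamiltonian_flipSet hs J hT]
  congr 1
  ring

/-- Quasi-invariance under finite spin flips, with the Boltzmann weight as density. -/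
def FlipInvariant (s J β : ℝ) (μ : Measure (Config d)) : Prop :=
  ∀ (T : Finset (Site d)) (g : Config d → ENNReal), Measurable g →
    ∫⁻ σ, g (flipSet T σ) ∂μ = ∫⁻ σ, g σ * ENNReal.ofReal (Real.exp (-β * flipEnergy s J T σ)) ∂μ

/-- The event that the configuration agrees with `τ` on `Λ`. -/
def agree (Λ : Finset (Site d)) (τ : Λ → ℤˣ) : Set (Config d) := {σ | ∀ i : Λ, σ i = τ i}

lemma measurableSet_agree (Λ : Finset (Site d)) (τ : Λ → ℤˣ) : MeasurableSet (agree Λ τ) := by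
  unfold agree
  simp only [Set.ofPred_forall]
  exact MeasurableSet.iInter fun i => by
    have h1 : Measurable fun σ : Config d => σ i := measurable_pi_apply (i : Site d)
    exact h1 (measurableSet_singleton (τ i))

lemma glue_of_mem_agree {Λ : Finset (Site d)} {τ : Λ → ℤˣ} {σ : Config d} (h : σ ∈ agree Λ τ) :
    glue Λ τ σ = σ := by
  have : τ = fun i => σ i.1 := funext fun i => (h i).symm
  rw [this, glue_restrict]

lemma lintegral_eq_sum_agree (Λ : Finset (Site d)) (μ : Measure (Config d))
    (g : Config d → ENNReal) (hg : Measurable g) :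
    ∫⁻ σ, g σ ∂μ = ∑ τ : Λ → ℤˣ, ∫⁻ σ, (agree Λ τ).indicator g σ ∂μ := by
  classical
  rw [← lintegral_finsetSum _ fun τ _ => hg.indicator (measurableSet_agree Λ τ)]
  refine lintegral_congr fun σ => ?_
  rw [Finset.sum_eq_single (fun i : Λ => σ i)]
  · rw [Set.indicator_of_mem (show σ ∈ agree Λ (fun i : Λ => σ i) from fun i => rfl)]
  · intro τ _ hτ
    exact Set.indicator_of_notMem (fun h : σ ∈ agree Λ τ => hτ (funext fun i => (h i).symm)) _
  · simp

/-- The conditional expectation identity in integrated form: restriction to the cylinder and the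
measure with density `gibbsKernel` agree on the outside σ-algebra. -/
lemma IsGibbs.lintegral_agree {s : ℝ} (hs : (d : ℝ) + 1 < s) {J β : ℝ} {μ : Measure (Config d)}
    (h : IsGibbs s J β μ) (Λ : Finset (Site d)) (τ : Λ → ℤˣ) (φ : Config d → ENNReal)
    (hφ : Measurable[outside Λ] φ) :
    ∫⁻ σ, (agree Λ τ).indicator φ σ ∂μ = ∫⁻ σ, φ σ * ENNReal.ofReal (gibbsKernel s J β Λ τ σ) ∂μ := by
  have := h.isProbabilityMeasure
  have hm := outside_le Λ
  have hker := (measurable_gibbsKernel hs J β Λ τ).mono hm le_rfl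
  have hkerint : Integrable (gibbsKernel s J β Λ τ) μ :=
    Integrable.of_bound hker.aestronglyMeasurable 1 (Filter.Eventually.of_forall fun η => by
      rw [Real.norm_eq_abs, abs_of_pos (gibbsKernel_pos _ _ _ _ _ _)]
      exact gibbsKernel_le_one _ _ _ _ _ _)
  have key : (μ.restrict (agree Λ τ)).trim hm =
      (μ.withDensity fun σ => ENNReal.ofReal (gibbsKernel s J β Λ τ σ)).trim hm := by
    refine @Measure.ext _ (outside Λ) _ _ fun S hS => ?_
    rw [trim_measurableSet_eq hm hS, trim_measurableSet_eq hm hS, Measure.restrict_apply (hm S hS),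
      withDensity_apply _ (hm S hS), ← ofReal_integral_eq_lintegral_ofReal hkerint.integrableOn
        (Filter.Eventually.of_forall fun η => (gibbsKernel_pos _ _ _ _ _ _).le)]
    have hind : Integrable ((agree Λ τ).indicator fun _ => (1 : ℝ)) μ :=
      (integrable_const _).indicator (measurableSet_agree Λ τ)
    have h1 := setIntegral_condExp hm hind hS
    have h2 : ∫ σ in S, (μ[(agree Λ τ).indicator (fun _ => (1 : ℝ)) | outside Λ]) σ ∂μ =
        ∫ σ in S, gibbsKernel s J β Λ τ σ ∂μ :=
      integral_congr_ae (ae_restrict_of_ae (h.condDistrib Λ τ))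
    rw [h2, setIntegral_indicator (measurableSet_agree Λ τ)] at h1
    rw [h1, Set.inter_comm]
    simp
  rw [lintegral_indicator (measurableSet_agree Λ τ), ← lintegral_trim hm hφ, key,
    lintegral_trim hm hφ, lintegral_withDensity_eq_lintegral_mul _ hker.ennreal_ofReal
      (hφ.mono hm le_rfl)]
  exact lintegral_congr fun σ => mul_comm _ _

/-- Condition on the spins outside `T`. Flipping `T` permutes the inner patterns by `τ ↦ -τ`, and
the ratio of two kernels is a Boltzmann factor, because the partition function cancels. -/
lemma IsGibbs.flipInvariant {s : ℝ} (hs : (d : ℝ) + 1 < s) {J β : ℝ} {μ : Measure (Config d)}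
    (h : IsGibbs s J β μ) : FlipInvariant s J β μ := by
  intro T g hg
  have hexp : Measurable fun σ : Config d => ENNReal.ofReal (Real.exp (-β * flipEnergy s J T σ)) :=
    ((measurable_flipEnergy hs J T).const_mul _).exp.ennreal_ofReal
  have hG : ∀ (f : Config d → ENNReal), Measurable f → ∫⁻ σ, f σ ∂μ = ∑ τ : T → ℤˣ,
      ∫⁻ σ, f (glue T τ σ) * ENNReal.ofReal (gibbsKernel s J β T τ σ) ∂μ := by
    intro f hf
    rw [lintegral_eq_sum_agree T μ f hf]
    refine Finset.sum_congr rfl fun τ _ => ?_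
    rw [← h.lintegral_agree hs T τ (fun σ => f (glue T τ σ)) (hf.comp (measurable_glue T τ))]
    refine lintegral_congr fun σ => ?_
    by_cases hσ : σ ∈ agree T τ
    · rw [Set.indicator_of_mem hσ, Set.indicator_of_mem hσ, glue_of_mem_agree hσ]
    · rw [Set.indicator_of_notMem hσ, Set.indicator_of_notMem hσ]
  have hG1 := hG _ (hg.comp (measurable_flipSet T))
  have hG2 := hG _ (hg.mul hexp)
  simp only [Function.comp_apply, Pi.mul_apply] at hG1 hG2
  rw [hG1, hG2, ← (Equiv.neg (T → ℤˣ)).sum_comp]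
  swap
  · simp
  refine Finset.sum_congr rfl fun τ _ => lintegral_congr fun σ => ?_
  simp only [Equiv.neg_apply, flipSet_glue, neg_neg]
  rw [mul_assoc, ← ENNReal.ofReal_mul (Real.exp_nonneg _)]
  congr 2
  unfold gibbsKernel
  rw [← flipSet_glue, boltzmann_flipSet hs J β subset_rfl]
  ring

/-- Any two patterns on `Λ` differ by a flip, so flip invariance is detailed balance between
patterns; summing it over one of the two patterns yields the conditional probabilities. -/
lemma FlipInvariant.isGibbs {s : ℝ} (hs : (d : ℝ) + 1 < s) {J β : ℝ} {μ : Measure (Config d)}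
    [IsProbabilityMeasure μ] (h : FlipInvariant s J β μ) : IsGibbs s J β μ := by
  classical
  refine ⟨inferInstance, fun Λ τ => ?_⟩
  have hm := outside_le Λ
  have hker := fun τ => (measurable_gibbsKernel hs J β Λ τ).mono hm le_rfl
  have hkerint : Integrable (gibbsKernel s J β Λ τ) μ :=
    Integrable.of_bound (hker τ).aestronglyMeasurable 1 (Filter.Eventually.of_forall fun η => by
      rw [Real.norm_eq_abs, abs_of_pos (gibbsKernel_pos _ _ _ _ _ _)]
      exact gibbsKernel_le_one _ _ _ _ _ _)
  -- Detailed balance, from the flip on the sites where `τ` and `τ'` differ.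
  have key : ∀ φ : Config d → ENNReal, Measurable[outside Λ] φ → ∀ τ',
      ∫⁻ σ, (agree Λ τ).indicator (fun σ => φ σ * ENNReal.ofReal (gibbsKernel s J β Λ τ' σ)) σ ∂μ =
      ∫⁻ σ, (agree Λ τ').indicator (fun σ => φ σ * ENNReal.ofReal (gibbsKernel s J β Λ τ σ)) σ ∂μ := by
    intro φ hφ τ'
    let T : Finset (Site d) := (Finset.univ.filter fun i : Λ => τ i ≠ τ' i).map
      (Function.Embedding.subtype _)
    have hTΛ : T ⊆ Λ := fun i hi => by
      obtain ⟨j, _, rfl⟩ := Finset.mem_map.mp hi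
      exact j.2
    have hTmem : ∀ i : Λ, (i : Site d) ∈ T ↔ τ i ≠ τ' i := fun i => by simp [T]
    have hφ' := hφ.mul (measurable_gibbsKernel hs J β Λ τ).ennreal_ofReal
    have hflip := h T ((agree Λ τ).indicator
      fun σ => φ σ * ENNReal.ofReal (gibbsKernel s J β Λ τ σ))
      ((hφ'.mono hm le_rfl).indicator (measurableSet_agree Λ τ))
    have hag : ∀ σ, flipSet T σ ∈ agree Λ τ ↔ σ ∈ agree Λ τ' := by
      intro σ
      refine forall_congr' fun i => ?_
      by_cases hi : (i : Site d) ∈ T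
      · rw [flipSet_of_mem hi]
        have := (hTmem i).mp hi
        rcases Int.units_eq_one_or (σ i) with h1 | h1 <;>
          rcases Int.units_eq_one_or (τ i) with h2 | h2 <;>
          rcases Int.units_eq_one_or (τ' i) with h3 | h3 <;> simp_all
      · rw [flipSet_of_notMem hi, not_not.mp (fun hc => hi ((hTmem i).mpr hc))]
    have hR : ∀ σ, (agree Λ τ).indicator (fun σ => φ σ * ENNReal.ofReal (gibbsKernel s J β Λ τ σ))
        (flipSet T σ) = (agree Λ τ').indicator
          (fun σ => φ σ * ENNReal.ofReal (gibbsKernel s J β Λ τ σ)) σ := by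
      intro σ
      have hinv := eq_of_measurable_outside hφ' (σ := flipSet T σ) (σ' := σ)
        fun i hi => flipSet_of_notMem (fun hc => hi (hTΛ hc)) σ
      simp only [Pi.mul_apply] at hinv
      by_cases hσ : σ ∈ agree Λ τ'
      · rw [Set.indicator_of_mem hσ, Set.indicator_of_mem ((hag σ).mpr hσ)]
        exact hinv
      · rw [Set.indicator_of_notMem hσ, Set.indicator_of_notMem (fun hc => hσ ((hag σ).mp hc))]
    rw [lintegral_congr hR] at hflip
    rw [hflip]
    refine lintegral_congr fun σ => ?_
    by_cases hσ : σ ∈ agree Λ τ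
    · rw [Set.indicator_of_mem hσ, Set.indicator_of_mem hσ, mul_assoc,
        ← ENNReal.ofReal_mul (gibbsKernel_pos _ _ _ _ _ _).le]
      congr 2
      unfold gibbsKernel
      have h1 : glue Λ τ' σ = flipSet T σ := by
        have h2 : flipSet T σ ∈ agree Λ τ' := by
          intro i
          by_cases hi : (i : Site d) ∈ T
          · rw [flipSet_of_mem hi, hσ i]
            have := (hTmem i).mp hi
            rcases Int.units_eq_one_or (τ i) with h2 | h2 <;>
              rcases Int.units_eq_one_or (τ' i) with h3 | h3 <;> simp_all
          · rw [flipSet_of_notMem hi, hσ i]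
            exact not_not.mp (fun hc => hi ((hTmem i).mpr hc))
        rw [← glue_of_mem_agree h2]
        funext i
        by_cases hi : i ∈ Λ
        · rw [glue_of_mem hi, glue_of_mem hi]
        · rw [glue_of_notMem hi, glue_of_notMem hi, flipSet_of_notMem fun hc => hi (hTΛ hc)]
      rw [h1, glue_of_mem_agree hσ, boltzmann_flipSet hs J β hTΛ]
      ring
    · rw [Set.indicator_of_notMem hσ, Set.indicator_of_notMem hσ, zero_mul]
  -- Sum over `τ'`: on one side the kernels add up to one, on the other the cylinders exhaust the
  -- space.
  have key2 : ∀ φ : Config d → ENNReal, Measurable[outside Λ] φ →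
      ∫⁻ σ, (agree Λ τ).indicator φ σ ∂μ =
        ∫⁻ σ, φ σ * ENNReal.ofReal (gibbsKernel s J β Λ τ σ) ∂μ := by
    intro φ hφ
    have hφ' := hφ.mono hm le_rfl
    have hL := lintegral_eq_sum_agree Λ μ _ (hφ'.mul (hker τ).ennreal_ofReal)
    simp only [Pi.mul_apply, Pi.mul_def] at hL
    rw [hL, ← Finset.sum_congr rfl fun τ' _ => key φ hφ τ', ← lintegral_finsetSum]
    swap
    · exact fun τ' _ => (hφ'.mul (hker τ').ennreal_ofReal).indicator (measurableSet_agree Λ τ)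
    refine lintegral_congr fun σ => ?_
    by_cases hσ : σ ∈ agree Λ τ
    · simp only [Set.indicator_of_mem hσ]
      rw [← Finset.mul_sum, ← ENNReal.ofReal_sum_of_nonneg fun τ' _ =>
        (gibbsKernel_pos _ _ _ _ _ _).le, sum_gibbsKernel, ENNReal.ofReal_one, mul_one]
    · simp only [Set.indicator_of_notMem hσ, Finset.sum_const_zero]
  refine (ae_eq_condExp_of_forall_setIntegral_eq hm
    ((integrable_const _).indicator (measurableSet_agree Λ τ)) (fun S _ _ => hkerint.integrableOn)
    (fun S hS _ => ?_) (measurable_gibbsKernel hs J β Λ τ).stronglyMeasurable.aestronglyMeasurable).symm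
  rw [integral_eq_lintegral_of_nonneg_ae (Filter.Eventually.of_forall fun η =>
      (gibbsKernel_pos _ _ _ _ _ _).le) (hker τ).aestronglyMeasurable.restrict]
  have h1 := key2 (S.indicator 1) (Measurable.indicator (m := outside Λ) (@measurable_const _ _ _ (outside Λ) 1) hS)
  have h2 : ∫⁻ σ, S.indicator 1 σ * ENNReal.ofReal (gibbsKernel s J β Λ τ σ) ∂μ =
      ∫⁻ σ in S, ENNReal.ofReal (gibbsKernel s J β Λ τ σ) ∂μ := by
    rw [← lintegral_indicator (hm S hS)]
    refine lintegral_congr fun σ => ?_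
    by_cases hσ : σ ∈ S <;> simp [hσ]
  change _ = ∫ σ in S, (agree Λ τ).indicator (fun _ => (1 : ℝ)) σ ∂μ
  rw [← h2, ← h1, setIntegral_indicator (measurableSet_agree Λ τ),
    lintegral_indicator (measurableSet_agree Λ τ), lintegral_indicator_one (hm S hS),
    Measure.restrict_apply (hm S hS)]
  simp [Measure.real]

end Gibbs

/-! ### Contours and the Peierls estimate. -/

section Contours

variable {d : ℕ}

/-- The edges whose endpoints carry different spins. -/
def disagree (σ : Config d) : Set (Edge d) := {e | σ e.1 ≠ σ (e.1 + unitVec e.2)}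

/-- `A` is the interior of a contour of `σ`: its boundary is a connected component of the set of
disagreement edges. -/
def IsContour (σ : Config d) (A : Finset (Site d)) : Prop :=
  IsEdgeComponent (edgeBoundary A) (disagree σ)

lemma isClopen_disagree (e : Edge d) : IsClopen {σ : Config d | e ∈ disagree σ} := by
  have h : Continuous fun σ : Config d => (σ e.1, σ (e.1 + unitVec e.2)) :=
    (continuous_apply _).prodMk (continuous_apply _)
  exact (isClopen_discrete {p : ℤˣ × ℤˣ | p.1 ≠ p.2}).preimage h

/-- A contour is a local event: only the boundary edges and their neighbours are inspected. It is
therefore clopen, and its probability passes to weak limits. -/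
lemma isContour_iff (σ : Config d) (A : Finset (Site d)) : IsContour σ A ↔
    ((edgeBoundary A).Nonempty ∧ EdgeConnected (edgeBoundary A)) ∧
    (∀ e ∈ edgeBoundary A, e ∈ disagree σ) ∧
    ∀ e ∈ (edgeBoundary A).biUnion edgeNbrs \ edgeBoundary A, e ∉ disagree σ := by
  constructor
  · intro h
    refine ⟨⟨h.nonempty, h.connected⟩, h.subset, fun e he hσ => ?_⟩
    simp only [Finset.mem_sdiff, Finset.mem_biUnion, mem_edgeNbrs] at he
    obtain ⟨⟨a, ha, hae⟩, hne⟩ := he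
    exact hne (h.closed a ha e hσ hae)
  · rintro ⟨⟨h1, h2⟩, h3, h4⟩
    refine ⟨h1, h3, fun a ha b hb hab => ?_, h2⟩
    by_contra hc
    refine h4 b ?_ hb
    simp only [Finset.mem_sdiff, Finset.mem_biUnion, mem_edgeNbrs]
    exact ⟨⟨a, ha, hab⟩, hc⟩

lemma isClopen_isContour (A : Finset (Site d)) : IsClopen {σ : Config d | IsContour σ A} := by
  have : {σ : Config d | IsContour σ A} = {_σ : Config d | (edgeBoundary A).Nonempty ∧
        EdgeConnected (edgeBoundary A)} ∩
      ((⋂ e ∈ edgeBoundary A, {σ | e ∈ disagree σ}) ∩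
      ⋂ e ∈ (edgeBoundary A).biUnion edgeNbrs \ edgeBoundary A, {σ | e ∈ disagree σ}ᶜ) := by
    ext σ
    simp only [Set.mem_ofPred_eq, isContour_iff, Set.mem_inter_iff, Set.mem_iInter,
      Set.mem_compl_iff]
  rw [this]
  refine IsClopen.inter ?_ (IsClopen.inter ?_ ?_)
  · by_cases h : (edgeBoundary A).Nonempty ∧ EdgeConnected (edgeBoundary A)
    · simp only [h, and_self]; exact isClopen_univ
    · simp only [h]; exact isClopen_empty
  · exact isClopen_biInter_finset fun e _ => isClopen_disagree e
  · exact isClopen_biInter_finset fun e _ => (isClopen_disagree e).compl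

lemma measurableSet_isContour (A : Finset (Site d)) :
    MeasurableSet {σ : Config d | IsContour σ A} := (isClopen_isContour A).2.measurableSet

lemma IsContour.edgeBoundary_disjoint (hd : 0 < d) {σ : Config d} {A B : Finset (Site d)}
    (hA : IsContour σ A) (hB : IsContour σ B) (h : A ≠ B) :
    Disjoint (edgeBoundary A) (edgeBoundary B) :=
  Finset.disjoint_left.mpr fun e he he' =>
    h (edgeBoundary_injective hd (hA.eq_of_inter hB e he he'))

lemma mul_spin_of_edgeBoundary {σ : Config d} {T : Finset (Site d)}
    (hT : ∀ e ∈ edgeBoundary T, e ∈ disagree σ) {i j : Site d} (hi : i ∈ T) (hj : j ∉ T)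
    (hij : IsNeighbor i j) : spin σ i * spin σ j = -1 := by
  have key : ∀ u v : ℤˣ, u ≠ v → ((u : ℤ) : ℝ) * ((v : ℤ) : ℝ) = -1 := by
    intro u v huv
    rcases Int.units_eq_one_or u with h1 | h1 <;> rcases Int.units_eq_one_or v with h2 | h2 <;>
      simp_all
  obtain ⟨k, rfl | rfl⟩ := (isNeighbor_iff i j).mp hij
  · exact key _ _ (hT (i, k) (mem_edgeBoundary.mpr (by simp [hi, hj])))
  · have := hT (j, k) (mem_edgeBoundary.mpr (by simp [hi, hj]))
    exact key _ _ (Ne.symm this)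

/-- Reversing the spins inside a region bounded by disagreement edges lowers the energy. -/
lemma flipEnergy_le {s : ℝ} (hs : (d : ℝ) + 1 < s) {J : ℝ} (hJ : 0 ≤ J) {T : Finset (Site d)}
    {σ : Config d} (hT : ∀ e ∈ edgeBoundary T, e ∈ disagree σ) :
    flipEnergy s J T σ ≤ -2 * (J - longRangeMoment d s) * (edgeBoundary T).card := by
  classical
  -- Every neighbour pair across the boundary disagrees and gains the full `J`; each long-range pair
  -- is estimated by its worst sign.
  have h1 : ∀ i ∈ T, J * ((nbrs i).filter fun j => j ∉ T).card -
      ∑' j, (if j ∈ T then 0 else longRange s i j) ≤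
      ∑' j, (if j ∈ T then 0 else coupling s J i j * spin σ i * spin σ j) := by
    intro i hi
    have hs1 : Summable fun j => (if j ∈ (nbrs i).filter fun j => j ∉ T then J else 0) :=
      summable_of_ne_finset_zero (s := (nbrs i).filter fun j => j ∉ T) fun j hj => if_neg hj
    have hs2 : Summable fun j => (if j ∈ T then 0 else longRange s i j) :=
      (summable_longRange hs i).of_nonneg_of_le
        (fun j => by split_ifs <;> simp [longRange_nonneg])
        (fun j => by split_ifs <;> simp [longRange_nonneg])
    have hs3 : Summable fun j => (if j ∈ T then 0 else coupling s J i j * spin σ i * spin σ j) := by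
      refine Summable.of_abs ((summable_abs_coupling hs J i).of_nonneg_of_le
        (fun _ => abs_nonneg _) fun j => ?_)
      split_ifs
      · simp
      · rw [abs_coupling_spin]
    have h2 : J * ((nbrs i).filter fun j => j ∉ T).card =
        ∑' j, (if j ∈ (nbrs i).filter fun j => j ∉ T then J else 0) := by
      rw [tsum_eq_sum (s := (nbrs i).filter fun j => j ∉ T) fun j hj => if_neg hj,
        Finset.sum_congr rfl fun j hj => if_pos hj]
      simp [mul_comm]
    rw [h2, ← Summable.tsum_sub hs1 hs2]
    refine Summable.tsum_le_tsum (fun j => ?_) (hs1.sub hs2) hs3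
    by_cases hj : j ∈ T
    · simp [hj]
    have h3 : -longRange s i j ≤ longRange s i j * (spin σ i * spin σ j) := by
      have h4 : -1 ≤ spin σ i * spin σ j := by
        rcases spin_eq σ i with h | h <;> rcases spin_eq σ j with h' | h' <;> norm_num [h, h']
      nlinarith [longRange_nonneg s i j]
    simp only [Finset.mem_filter, mem_nbrs, hj, not_false_eq_true, and_true, if_false]
    rw [mul_assoc]
    by_cases hij : IsNeighbor i j
    · rw [coupling, if_pos hij, if_pos hij, add_mul, mul_spin_of_edgeBoundary hT hi hj hij]
      rw [mul_spin_of_edgeBoundary hT hi hj hij] at h3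
      linarith
    · rw [coupling_of_not_isNeighbor s J hij, if_neg hij]
      linarith
  have h2 := Finset.sum_le_sum h1
  rw [Finset.sum_sub_distrib, ← Finset.mul_sum] at h2
  have h3 := sum_longRange_exit_le hs T
  have h4 : ((edgeBoundary T).card : ℝ) ≤ ∑ i ∈ T, (((nbrs i).filter fun j => j ∉ T).card : ℝ) := by
    exact_mod_cast card_edgeBoundary_le T
  have h5 := mul_le_mul_of_nonneg_left h4 hJ
  unfold flipEnergy
  linarith

/-- The weight of a boundary edge in the Peierls estimate. -/
def peierlsWeight (d : ℕ) (s J β : ℝ) : ENNReal :=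
  ENNReal.ofReal (Real.exp (-2 * β * (J - longRangeMoment d s)))

/-- The identity of `FlipInvariant` for a single set. -/
def FlipIdentity (s J β : ℝ) (μ : Measure (Config d)) (T : Finset (Site d)) : Prop :=
  ∀ g : Config d → ENNReal, Measurable g →
    ∫⁻ σ, g (flipSet T σ) ∂μ = ∫⁻ σ, g σ * ENNReal.ofReal (Real.exp (-β * flipEnergy s J T σ)) ∂μ

/-- Apply the flip identity to the indicator of `E`. One side is at most one; on the other, the
density exceeds the inverse of the claimed bound throughout `E`. Only the identity for this `T` is
required, so finite-volume measures qualify. -/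
lemma measure_le_peierlsWeight_pow {s : ℝ} (hs : (d : ℝ) + 1 < s) {J β : ℝ} (hJ : 0 ≤ J)
    (hβ : 0 ≤ β) {μ : Measure (Config d)} [IsProbabilityMeasure μ] {T : Finset (Site d)}
    (h : FlipIdentity s J β μ T) {E : Set (Config d)} (hE : MeasurableSet E)
    (hET : ∀ σ ∈ E, ∀ e ∈ edgeBoundary T, e ∈ disagree σ) :
    μ E ≤ peierlsWeight d s J β ^ (edgeBoundary T).card := by
  set n := (edgeBoundary T).card
  set a := -2 * β * (J - longRangeMoment d s) with ha
  have h1 := h (E.indicator 1) (measurable_one.indicator hE)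
  have h2 : ∫⁻ σ, E.indicator 1 (flipSet T σ) ∂μ ≤ 1 := by
    calc ∫⁻ σ, E.indicator 1 (flipSet T σ) ∂μ ≤ ∫⁻ _, 1 ∂μ :=
          lintegral_mono fun σ => Set.indicator_le_self' (fun _ _ => zero_le_one) _
      _ = 1 := by simp
  have h3 : ENNReal.ofReal (Real.exp (-(a * n))) * μ E ≤
      ∫⁻ σ, E.indicator 1 σ * ENNReal.ofReal (Real.exp (-β * flipEnergy s J T σ)) ∂μ := by
    rw [← lintegral_indicator_one hE, ← lintegral_const_mul _ (measurable_one.indicator hE)]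
    refine lintegral_mono fun σ => ?_
    by_cases hσ : σ ∈ E
    · simp only [Set.indicator_of_mem hσ, Pi.one_apply, mul_one, one_mul]
      refine ENNReal.ofReal_le_ofReal (Real.exp_le_exp.mpr ?_)
      have := mul_le_mul_of_nonneg_left (flipEnergy_le hs hJ (hET σ hσ)) hβ
      rw [ha]
      linarith
    · simp [Set.indicator_of_notMem hσ]
  have h4 : ENNReal.ofReal (Real.exp (-(a * n))) * μ E ≤ 1 := (h3.trans h1.ge).trans h2
  have h5 : peierlsWeight d s J β ^ n = (ENNReal.ofReal (Real.exp (-(a * n))))⁻¹ := by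
    rw [peierlsWeight, ← ENNReal.ofReal_pow (Real.exp_nonneg _), ← Real.exp_nat_mul,
      ← ENNReal.ofReal_inv_of_pos (Real.exp_pos _), ← Real.exp_neg, neg_neg, ← ha, mul_comm]
  rw [h5, ENNReal.le_inv_iff_mul_le, mul_comm]
  exact h4

/-- The interiors may be nested, so their symmetric difference is the right set: its boundary is the
mod 2 sum of disjoint boundaries. One flip then removes all the contours together. -/
lemma exists_edgeBoundary_eq_biUnion (𝓐 : Finset (Finset (Site d)))
    (h : (𝓐 : Set (Finset (Site d))).PairwiseDisjoint edgeBoundary) :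
    ∃ T : Finset (Site d), edgeBoundary T = 𝓐.biUnion edgeBoundary := by
  classical
  induction 𝓐 using Finset.induction_on with
  | empty => exact ⟨∅, by ext e; simp [mem_edgeBoundary]⟩
  | insert A 𝓐 hA ih =>
    obtain ⟨T, hT⟩ := ih (h.subset (by simp))
    refine ⟨symmDiff A T, ?_⟩
    rw [edgeBoundary_symmDiff, hT, Finset.biUnion_insert]
    refine Disjoint.symmDiff_eq_sup ?_
    rw [Finset.disjoint_biUnion_right]
    intro B hB
    refine h (by simp) (by simp [hB]) fun hAB => ?_
    rw [hAB] at hA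
    exact hA hB

/-- The Peierls estimate for several contours. -/
lemma measure_contours_le (hd : 0 < d) {s : ℝ} (hs : (d : ℝ) + 1 < s) {J β : ℝ} (hJ : 0 ≤ J)
    (hβ : 0 ≤ β) {μ : Measure (Config d)} [IsProbabilityMeasure μ] (h : FlipInvariant s J β μ)
    (𝓐 : Finset (Finset (Site d))) :
    μ {σ | ∀ A ∈ 𝓐, IsContour σ A} ≤
      ∏ A ∈ 𝓐, peierlsWeight d s J β ^ (edgeBoundary A).card := by
  -- A single configuration showing all these contours proves that their boundaries are disjoint.
  rcases Set.eq_empty_or_nonempty {σ : Config d | ∀ A ∈ 𝓐, IsContour σ A} with h0 | ⟨σ₀, hσ₀⟩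
  · simp [h0]
  have hdisj : (𝓐 : Set (Finset (Site d))).PairwiseDisjoint edgeBoundary :=
    fun A hA B hB hAB => (hσ₀ A hA).edgeBoundary_disjoint hd (hσ₀ B hB) hAB
  obtain ⟨T, hT⟩ := exists_edgeBoundary_eq_biUnion 𝓐 hdisj
  rw [Finset.prod_pow_eq_pow_sum, ← Finset.card_biUnion hdisj, ← hT]
  refine measure_le_peierlsWeight_pow hs hJ hβ (h T) ?_ fun σ hσ e he => ?_
  · simp only [Set.ofPred_forall]
    exact Finset.measurableSet_biInter _ fun A _ => measurableSet_isContour A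
  · rw [hT, Finset.mem_biUnion] at he
    obtain ⟨A, hA, he⟩ := he
    exact (hσ A hA).subset e he

open Classical in
/-- The sum over contours around `a` of the weight `|A| x ^ |∂A|`. -/
def contourSum (x : ENNReal) (a : Site d) : ENNReal :=
  ∑' A : Finset (Site d), if a ∈ A ∧ EdgeConnected (edgeBoundary A) then
    (A.card : ENNReal) * x ^ (edgeBoundary A).card else 0

lemma contourSum_le (hd : 2 ≤ d) {x : ℝ} (hx : 0 ≤ x) (hx' : contourBase d * x ≤ 1 / 2)
    (a : Site d) : contourSum (ENNReal.ofReal x) a ≤ ENNReal.ofReal (2 * (contourBase d * x)) := by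
  classical
  unfold contourSum
  rw [ENNReal.tsum_eq_iSup_sum]
  refine iSup_le fun 𝓕 => ?_
  rw [← Finset.sum_filter]
  have := sum_contours_le hd x hx hx' a
    (𝓕.filter fun A => a ∈ A ∧ EdgeConnected (edgeBoundary A))
    fun A hA => (Finset.mem_filter.mp hA).2
  refine le_trans (le_of_eq ?_) (ENNReal.ofReal_le_ofReal this)
  rw [ENNReal.ofReal_sum_of_nonneg fun A _ => by positivity]
  refine Finset.sum_congr rfl fun A _ => ?_
  rw [ENNReal.ofReal_mul (by positivity), ENNReal.ofReal_natCast, ENNReal.ofReal_pow hx]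

/-- Almost every configuration has each of its minus spins enclosed by a contour. -/
def Enclosed (μ : Measure (Config d)) : Prop :=
  ∀ v : Site d, ∀ᵐ σ ∂μ, σ v = -1 → ∃ A, v ∈ A ∧ IsContour σ A

lemma disagree_eq_edgeBoundary {σ : Config d} {S : Finset (Site d)}
    (hS : ∀ v, v ∈ S ↔ σ v = -1) : disagree σ = (edgeBoundary S : Set (Edge d)) := by
  ext e
  simp only [disagree, Set.mem_ofPred_eq, Finset.mem_coe, mem_edgeBoundary, hS]
  rcases Int.units_eq_one_or (σ e.1) with h1 | h1 <;>
    rcases Int.units_eq_one_or (σ (e.1 + unitVec e.2)) with h2 | h2 <;> simp [h1, h2]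

/-- The contours of a configuration equal to plus outside a box lie inside that box. -/
lemma subset_box_of_edgeBoundary_subset (hd : 2 ≤ d) {L : ℕ} {S A : Finset (Site d)}
    (hS : S ⊆ box d L) (hA : edgeBoundary A ⊆ edgeBoundary S) : A ⊆ box d L := by
  have hbox : ∀ x : Site d, x ∉ box d L → ∃ j, (L : ℤ) < |x j| := by
    intro x hx
    by_contra! h
    exact hx (Finset.mem_Icc.mpr ⟨fun j => (abs_le.mp (h j)).1, fun j => (abs_le.mp (h j)).2⟩)
  have hbox' : ∀ x : Site d, (∃ j, (L : ℤ) < |x j|) → x ∉ box d L := by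
    rintro x ⟨j, hj⟩ hx
    have := Finset.mem_Icc.mp hx
    exact absurd (abs_le.mpr ⟨this.1 j, this.2 j⟩) (not_le.mpr hj)
  have hstep : ∀ N : ℤ, (L : ℤ) ≤ N → ∀ x (k j : Fin d), j ≠ k → N < |x j| →
      (x + unitVec k ∈ A) = (x ∈ A) := by
    intro N hN x k j hjk hx
    have h1 : x ∉ S := fun h => hbox' x ⟨j, hN.trans_lt hx⟩ (hS h)
    have h2 : x + unitVec k ∉ S := fun h => by
      refine hbox' _ ⟨j, ?_⟩ (hS h)
      simpa [unitVec, Pi.single_eq_of_ne hjk] using hN.trans_lt hx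
    by_contra hc
    have h3 : (x, k) ∈ edgeBoundary A :=
      mem_edgeBoundary.mpr fun h => hc (propext h.symm)
    have := mem_edgeBoundary.mp (hA h3)
    exact this (by simp [h1, h2])
  obtain ⟨N, hN⟩ := exists_box_bound A
  intro x hx
  by_contra hxb
  obtain ⟨j, hj⟩ := hbox x hxb
  have h1 := const_outside_box hd (fun y => y ∈ A) L (hstep L le_rfl) x j hj
  have hy : (L : ℤ) < |(fun _ : Fin d => |N| + 1 + L) j| := by
    rw [abs_of_nonneg (by positivity)]; linarith [abs_nonneg N]
  have h2 := const_outside_box hd (fun y => y ∈ A) L (hstep L le_rfl) (fun _ => |N| + 1 + L) j hy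
  have h3 : (fun _ => |N| + 1 + (L : ℤ)) ∈ A := by rw [h2, ← h1]; exact hx
  have h4 := hN _ h3 j
  rw [abs_of_nonneg (by positivity)] at h4
  linarith [le_abs_self N]

/-- With plus spins outside the box, the set of minus spins is finite and its boundary is the whole
disagreement set. -/
lemma exists_contour_of_minus (hd : 2 ≤ d) {L : ℕ} {σ : Config d}
    (hσ : ∀ i, i ∉ box d L → σ i = 1) {v : Site d} (hv : σ v = -1) :
    ∃ A ⊆ box d L, v ∈ A ∧ IsContour σ A := by
  classical
  let S := (box d L).filter fun v => σ v = -1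
  have hS : ∀ v, v ∈ S ↔ σ v = -1 := by
    intro v
    simp only [S, Finset.mem_filter, and_iff_right_iff_imp]
    intro h
    by_contra hc
    rw [hσ v hc] at h
    exact absurd h (by decide)
  obtain ⟨A, hvA, hA⟩ := exists_component_around hd S v ((hS v).mpr hv)
  refine ⟨A, subset_box_of_edgeBoundary_subset hd (Finset.filter_subset _ _)
    fun e he => hA.subset e he, hvA, ?_⟩
  rw [IsContour, disagree_eq_edgeBoundary hS]
  exact hA

end Contours

/-! ### Chains of contours and their total weight. -/

section Chains

variable {d : ℕ}

/-- A contour of one of two configurations. -/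
abbrev Node (d : ℕ) : Type := Bool × Finset (Site d)

/-- A step of a chain of contours: a contour, the site where the chain leaves it, and the site to
which it jumps. -/
abbrev Item (d : ℕ) : Type := Node d × Site d × Site d

open Classical in
/-- The weight of a step that starts at the site `a`. -/
def itemWeight (x : ENNReal) (k : Site d → Site d → ENNReal) (a : Site d) (it : Item d) : ENNReal :=
  if a ∈ it.1.2 ∧ it.2.1 ∈ it.1.2 ∧ EdgeConnected (edgeBoundary it.1.2) then
    x ^ (edgeBoundary it.1.2).card * k it.2.1 it.2.2 else 0

/-- The weight of a chain that starts at `a`. -/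
def chainWeight (x : ENNReal) (k : Site d → Site d → ENNReal) : Site d → List (Item d) → ENNReal
  | _, [] => 1
  | a, it :: l => itemWeight x k a it * chainWeight x k it.2.2 l

/-- The site reached by a chain that starts at `a`. -/
def chainEnd : Site d → List (Item d) → Site d
  | a, [] => a
  | _, it :: l => chainEnd it.2.2 l

lemma chainEnd_append (a : Site d) (l : List (Item d)) (it : Item d) :
    chainEnd a (l ++ [it]) = it.2.2 := by
  induction l generalizing a with
  | nil => rfl
  | cons it' l ih => exact ih _

/-- The factor 2 is the choice of configuration. Summing over the landing site gives `κ`; summing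
over the exit site gives `|A|`, which is why `contourSum` carries the volume. -/
lemma tsum_itemWeight_le (x : ENNReal) (k : Site d → Site d → ENNReal) {c κ : ENNReal}
    (hc : ∀ a : Site d, contourSum x a ≤ c) (hκ : ∀ b, ∑' a, k b a ≤ κ) (a : Site d) :
    ∑' it, itemWeight x k a it ≤ 2 * (c * κ) := by
  classical
  have h1 : ∀ N : Node d, ∑' q : Site d × Site d, itemWeight x k a (N, q) ≤
      (if a ∈ N.2 ∧ EdgeConnected (edgeBoundary N.2) then
        (N.2.card : ENNReal) * x ^ (edgeBoundary N.2).card else 0) * κ := by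
    intro N
    rw [ENNReal.tsum_prod']
    by_cases h : a ∈ N.2 ∧ EdgeConnected (edgeBoundary N.2)
    · have h2 : ∀ b, ∑' a', itemWeight x k a (N, b, a') ≤
          if b ∈ N.2 then x ^ (edgeBoundary N.2).card * κ else 0 := by
        intro b
        by_cases hb : b ∈ N.2
        · simp only [itemWeight, h.1, hb, h.2, and_self, if_true]
          rw [ENNReal.tsum_mul_left]
          gcongr
          exact hκ b
        · simp [itemWeight, hb]
      refine (ENNReal.tsum_le_tsum h2).trans ?_
      rw [tsum_eq_sum (s := N.2) fun b hb => if_neg hb, Finset.sum_congr rfl fun b hb => if_pos hb]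
      simp only [h.1, h.2, and_self, if_true, Finset.sum_const, nsmul_eq_mul, mul_assoc, le_refl]
    · have h2 : ∀ b a', itemWeight x k a (N, b, a') = 0 := by
        intro b a'
        exact if_neg fun hc => h ⟨hc.1, hc.2.2⟩
      simp [h2]
  rw [ENNReal.tsum_prod']
  refine (ENNReal.tsum_le_tsum h1).trans ?_
  rw [ENNReal.tsum_mul_right, ENNReal.tsum_prod', tsum_fintype]
  simp only [Fintype.sum_bool]
  rw [← two_mul, mul_assoc]
  gcongr
  exact hc a

lemma tsum_list {α : Type*} (f : List α → ENNReal) :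
    ∑' l, f l = f [] + ∑' a, ∑' l, f (a :: l) := by
  classical
  have hinj : Function.Injective fun q : α × List α => q.1 :: q.2 := fun q q' h => by
    simp only [List.cons.injEq] at h
    exact Prod.ext h.1 h.2
  rw [ENNReal.tsum_eq_add_tsum_ite [], ← hinj.tsum_eq, ENNReal.tsum_prod']
  · simp
  · intro l hl
    cases l with
    | nil => simp at hl
    | cons a l => exact ⟨(a, l), rfl⟩

/-- A geometric series of ratio 1/2. Truncating by length permits induction: the empty chain
contributes 1, and a first step contributes at most `1/2 * 2`. -/
lemma tsum_chainWeight_le (x : ENNReal) (k : Site d → Site d → ENNReal)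
    (h : ∀ a, ∑' it, itemWeight x k a it ≤ 1 / 2) (a : Site d) :
    ∑' l, chainWeight x k a l ≤ 2 := by
  have key : ∀ (n : ℕ) a, ∑' l : List (Item d), (if l.length ≤ n then chainWeight x k a l else 0)
      ≤ 2 := by
    intro n
    induction n with
    | zero =>
      intro a
      rw [tsum_list]
      simp [chainWeight]
    | succ n ih =>
      intro a
      rw [tsum_list]
      have h1 : ∀ it : Item d, ∑' l : List (Item d),
          (if (it :: l).length ≤ n + 1 then chainWeight x k a (it :: l) else 0) ≤
          itemWeight x k a it * 2 := by
        intro it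
        have h2 : ∀ l : List (Item d),
            (if (it :: l).length ≤ n + 1 then chainWeight x k a (it :: l) else 0) =
            itemWeight x k a it * if l.length ≤ n then chainWeight x k it.2.2 l else 0 := by
          intro l
          simp only [List.length_cons, add_le_add_iff_right, chainWeight, mul_ite, mul_zero]
        rw [tsum_congr h2, ENNReal.tsum_mul_left]
        gcongr
        exact ih _
      have h3 := (ENNReal.tsum_le_tsum h1).trans
        (ENNReal.tsum_mul_right.trans_le (mul_le_mul_left (h a) 2))
      refine (add_le_add (a := _) (b := 1) (by simp [chainWeight]) h3).trans ?_
      rw [one_div, ENNReal.inv_mul_cancel two_ne_zero ENNReal.ofNat_ne_top]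
      norm_num
  rw [ENNReal.tsum_eq_iSup_sum]
  refine iSup_le fun s => ?_
  refine le_trans ?_ (key (s.sup List.length) a)
  refine le_trans (Finset.sum_le_sum fun l hl => ?_) (ENNReal.sum_le_tsum s)
  rw [if_pos (Finset.le_sup hl)]

lemma exists_box_superset (S : Finset (Site d)) : ∃ L : ℕ, S ⊆ box d L := by
  obtain ⟨N, hN⟩ := exists_box_bound S
  refine ⟨N.toNat, fun x hx => Finset.mem_Icc.mpr ⟨fun j => ?_, fun j => ?_⟩⟩
  · have := abs_le.mp (hN x hx j); have := Int.self_le_toNat N; linarith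
  · have := abs_le.mp (hN x hx j); have := Int.self_le_toNat N; linarith

/-- Chains rarely leave a large box. -/
lemma exists_box_tsum_chainWeight_lt (x : ENNReal) (k : Site d → Site d → ENNReal)
    (h : ∀ a, ∑' it, itemWeight x k a it ≤ 1 / 2) (B : Finset (Site d)) {ε : ENNReal}
    (hε : 0 < ε) : ∃ L : ℕ, B ⊆ box d L ∧
      ∑ a ∈ B, ∑' l, (if chainEnd a l ∉ box d L then chainWeight x k a l else 0) < ε := by
  classical
  let f : Site d × List (Item d) → ENNReal := fun q => if q.1 ∈ B then chainWeight x k q.1 q.2 else 0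
  have hf : ∑' q, f q ≠ ⊤ := by
    rw [ENNReal.tsum_prod', tsum_eq_sum (s := B) fun a ha => by simp [f, ha]]
    refine ENNReal.sum_ne_top.mpr fun a ha => ?_
    simp only [f, ha, if_true]
    exact ne_top_of_le_ne_top ENNReal.ofNat_ne_top (tsum_chainWeight_le x k h a)
  -- Finitely many chains carry all but `ε` of the weight; a box containing their endpoints does the
  -- job.
  obtain ⟨F, hF⟩ := ((ENNReal.tendsto_tsum_compl_atTop_zero hf).eventually_lt_const hε).exists
  obtain ⟨L, hL⟩ := exists_box_superset (B ∪ F.image fun q => chainEnd q.1 q.2)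
  refine ⟨L, Finset.union_subset_left hL, lt_of_le_of_lt ?_ hF⟩
  rw [show ∑' b : {q // q ∉ F}, f b = ∑' q, {q | q ∉ F}.indicator f q from
    tsum_subtype {q | q ∉ F} f, ENNReal.tsum_prod']
  refine le_trans ?_ (ENNReal.sum_le_tsum B)
  refine Finset.sum_le_sum fun a ha => ENNReal.tsum_le_tsum fun l => ?_
  by_cases hl : chainEnd a l ∉ box d L
  · have h1 : (a, l) ∉ F := fun hc => hl (hL (Finset.mem_union_right _
      (Finset.mem_image_of_mem (fun q : Site d × List (Item d) => chainEnd q.1 q.2) hc)))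
    rw [if_pos hl, Set.indicator_of_mem (show (a, l) ∈ {q | q ∉ F} from h1)]
    simp [f, ha]
  · rw [if_neg hl]; exact zero_le

end Chains

/-! ### Loop erasure at the level of contours. -/

section Routes

variable {d : ℕ}

/-- `l` is a chain from `a` to `i` that leaves each contour at a site assigned to it, through a
pair in `R`. -/
def IsRoute (R : Site d → Site d → Prop) (node : Site d → Node d) (i : Site d) :
    Site d → List (Item d) → Prop
  | a, [] => node a = node i
  | a, it :: l => node a = it.1 ∧ node it.2.1 = it.1 ∧ R it.2.1 it.2.2 ∧
      IsRoute R node i it.2.2 l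

/-- Loop erasure: two sites joined by a path are joined by a chain that visits each contour at
most once. -/
lemma exists_isRoute {R : Site d → Site d → Prop} (hR : ∀ u v, R u v → R v u)
    (node : Site d → Node d) {a i : Site d} (h : Relation.ReflTransGen R a i) :
    ∃ l, IsRoute R node i a l ∧ (l.map Prod.fst ++ [node i]).Nodup := by
  classical
  -- The path is projected to a graph whose vertices are contours. A simple path there lifts back to
  -- a chain: between two jumps it may move to any site assigned to the same contour.
  let Γ : SimpleGraph (Node d) :=
    { Adj := fun N N' => N ≠ N' ∧ ∃ u v, R u v ∧ node u = N ∧ node v = N'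
      symm := ⟨fun N N' h => by
        obtain ⟨hne, u, v, huv, hu, hv⟩ := h
        exact ⟨hne.symm, v, u, hR u v huv, hv, hu⟩⟩
      loopless := ⟨fun N h => h.1 rfl⟩ }
  have hreach : Γ.Reachable (node a) (node i) := by
    induction h with
    | refl => exact SimpleGraph.Reachable.refl _
    | tail _ hbc ih =>
      rename_i b c _
      by_cases hne : node b = node c
      · rwa [← hne]
      · exact ih.trans (SimpleGraph.Adj.reachable ⟨hne, b, c, hbc, rfl, rfl⟩)
  have hwalk : ∀ (N N' : Node d) (p : Γ.Walk N N') (a : Site d), node a = N → node i = N' →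
      ∃ l, IsRoute R node i a l ∧ l.map Prod.fst ++ [node i] = p.support := by
    intro N N' p
    induction p with
    | nil =>
      intro a ha hi
      exact ⟨[], ha.trans hi.symm, by simp [hi]⟩
    | cons hadj p ih =>
      intro a ha hi
      obtain ⟨_, u, v, huv, hu, hv⟩ := hadj
      obtain ⟨l, hl, hls⟩ := ih v hv hi
      refine ⟨(node u, u, v) :: l, ⟨ha.trans hu.symm, rfl, huv, hl⟩, ?_⟩
      simp [hls, hu]
  obtain ⟨p, hp⟩ := hreach.exists_isPath
  obtain ⟨l, hl, hls⟩ := hwalk _ _ p a rfl rfl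
  exact ⟨l, hl, hls ▸ hp.support_nodup⟩

/-- The pair of sites through which a step jumps. -/
def Item.bond (it : Item d) : Sym2 (Site d) := s(it.2.1, it.2.2)

lemma IsRoute.node_mem {R : Site d → Site d → Prop} {node : Site d → Node d} {i a : Site d}
    {l : List (Item d)} (h : IsRoute R node i a l) :
    node a ∈ l.map Prod.fst ++ [node i] ∧ ∀ it ∈ l, ∀ v ∈ Item.bond it,
      node v ∈ l.map Prod.fst ++ [node i] := by
  induction l generalizing a with
  | nil => simp only [IsRoute] at h; simp [h]
  | cons it l ih =>
    obtain ⟨h1, h2, h3, h4⟩ := h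
    obtain ⟨ih1, ih2⟩ := ih h4
    refine ⟨by simp [h1], fun it' hit' v hv => ?_⟩
    rcases List.mem_cons.mp hit' with rfl | hit'
    · rcases Sym2.mem_iff.mp hv with rfl | rfl
      · simp [h2]
      · exact List.mem_cons_of_mem _ ih1
    · exact List.mem_cons_of_mem _ (ih2 it' hit' v hv)

/-- A repeated bond would bring the chain back to a contour already left. Distinct bonds are
independent, which is needed to multiply their probabilities. -/
lemma IsRoute.nodup_bonds {R : Site d → Site d → Prop} {node : Site d → Node d} {i a : Site d}
    {l : List (Item d)} (h : IsRoute R node i a l) (hl : (l.map Prod.fst ++ [node i]).Nodup) :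
    (l.map Item.bond).Nodup := by
  induction l generalizing a with
  | nil => simp
  | cons it l ih =>
    obtain ⟨h1, h2, h3, h4⟩ := h
    simp only [List.map_cons, List.cons_append, List.nodup_cons] at hl ⊢
    refine ⟨fun hc => ?_, ih h4 hl.2⟩
    obtain ⟨it', hit', hb⟩ := List.mem_map.mp hc
    refine hl.1 ?_
    rw [← h2]
    refine h4.node_mem.2 it' hit' _ ?_
    rw [hb]
    exact Sym2.mem_mk_left _ _

lemma IsRoute.rel {R : Site d → Site d → Prop} {node : Site d → Node d} {i a : Site d}
    {l : List (Item d)} (h : IsRoute R node i a l) : ∀ it ∈ l, R it.2.1 it.2.2 := by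
  induction l generalizing a with
  | nil => simp
  | cons it l ih =>
    obtain ⟨h1, h2, h3, h4⟩ := h
    intro it' hit'
    rcases List.mem_cons.mp hit' with rfl | hit'
    · exact h3
    · exact ih h4 it' hit'

lemma IsRoute.node_eq {R : Site d → Site d → Prop} {node : Site d → Node d} {i a : Site d}
    {l : List (Item d)} (h : IsRoute R node i a l) : ∀ it ∈ l, node it.2.1 = it.1 := by
  induction l generalizing a with
  | nil => simp
  | cons it l ih =>
    obtain ⟨h1, h2, h3, h4⟩ := h
    intro it' hit'
    rcases List.mem_cons.mp hit' with rfl | hit'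
    · exact h2
    · exact ih h4 it' hit'

end Routes

/-! ### Two replicas with random bonds, and exchange on a cluster. -/

section RandomBonds

variable {d : ℕ}

/-- The sites where two configurations differ. -/
def diffAt (p : Config d × Config d) (i : Site d) : Prop := p.1 i ≠ p.2 i

/-- Reversal of the spins in `T` in both configurations. -/
def flipPair (T : Finset (Site d)) (p : Config d × Config d) : Config d × Config d :=
  (flipSet T p.1, flipSet T p.2)

lemma flipPair_flipPair (T : Finset (Site d)) (p : Config d × Config d) :
    flipPair T (flipPair T p) = p := by
  simp [flipPair, flipSet_flipSet]

lemma diffAt_flipPair (T : Finset (Site d)) (p : Config d × Config d) (i : Site d) :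
    diffAt (flipPair T p) i ↔ diffAt p i := by
  unfold diffAt flipPair
  by_cases h : i ∈ T
  · simp [flipSet_of_mem h]
  · simp [flipSet_of_notMem h]

lemma spin_snd_of_diffAt {p : Config d × Config d} {i : Site d} (h : diffAt p i) :
    spin p.2 i = -spin p.1 i := by
  unfold diffAt at h
  unfold spin
  rcases Int.units_eq_one_or (p.1 i) with h1 | h1 <;>
    rcases Int.units_eq_one_or (p.2 i) with h2 | h2 <;> simp_all

lemma spin_snd_of_not_diffAt {p : Config d × Config d} {i : Site d} (h : ¬diffAt p i) :
    spin p.2 i = spin p.1 i := by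
  unfold diffAt at h
  unfold spin
  rw [not_not.mp h]

lemma neg_fst_of_diffAt {p : Config d × Config d} {i : Site d} (h : diffAt p i) :
    -p.1 i = p.2 i := by
  unfold diffAt at h
  rcases Int.units_eq_one_or (p.1 i) with h1 | h1 <;>
    rcases Int.units_eq_one_or (p.2 i) with h2 | h2 <;> simp_all

open Classical in
/-- The exponent that governs the opening of the bond between two sites. -/
def pairEnergy (s β : ℝ) (p : Config d × Config d) (i j : Site d) : ℝ :=
  if diffAt p i ∧ diffAt p j then 2 * β * longRange s i j * (1 - spin p.1 i * spin p.1 j) else 0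

lemma pairEnergy_comm (s β : ℝ) (p : Config d × Config d) (i j : Site d) :
    pairEnergy s β p i j = pairEnergy s β p j i := by
  unfold pairEnergy
  rw [longRange_comm, mul_comm (spin p.1 i)]
  by_cases h1 : diffAt p i <;> by_cases h2 : diffAt p j <;> simp [h1, h2]

lemma spin_mul_spin_mem (σ : Config d) (i j : Site d) :
    -1 ≤ spin σ i * spin σ j ∧ spin σ i * spin σ j ≤ 1 := by
  rcases spin_eq σ i with h | h <;> rcases spin_eq σ j with h' | h' <;> norm_num [h, h']

lemma pairEnergy_nonneg {s β : ℝ} (hβ : 0 ≤ β) (p : Config d × Config d) (i j : Site d) :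
    0 ≤ pairEnergy s β p i j := by
  unfold pairEnergy
  split_ifs
  · have := spin_mul_spin_mem p.1 i j
    exact mul_nonneg (mul_nonneg (by positivity) (longRange_nonneg _ _ _)) (by linarith)
  · exact le_rfl

lemma pairEnergy_le {s β : ℝ} (hβ : 0 ≤ β) (p : Config d × Config d) (i j : Site d) :
    pairEnergy s β p i j ≤ 4 * β * longRange s i j := by
  unfold pairEnergy
  have h0 : 0 ≤ β * longRange s i j := mul_nonneg hβ (longRange_nonneg _ _ _)
  split_ifs
  · have := spin_mul_spin_mem p.1 i j
    nlinarith
  · linarith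

lemma continuous_pairEnergy (s β : ℝ) (i j : Site d) :
    Continuous fun p : Config d × Config d => pairEnergy s β p i j := by
  classical
  have h : Continuous fun p : Config d × Config d => ((p.1 i, p.2 i), (p.1 j, p.2 j)) := by
    fun_prop
  refine ((continuous_of_discreteTopology (f := fun q : (ℤˣ × ℤˣ) × (ℤˣ × ℤˣ) =>
    if q.1.1 ≠ q.1.2 ∧ q.2.1 ≠ q.2.2 then
      2 * β * longRange s i j * (1 - ((q.1.1 : ℤ) : ℝ) * ((q.2.1 : ℤ) : ℝ)) else 0)).comp h).congr fun p => ?_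
  by_cases h1 : diffAt p i <;> by_cases h2 : diffAt p j <;>
    simp only [Function.comp_apply, pairEnergy, h1, h2, and_self, and_true, and_false, if_true,
      if_false, spin, ← diffAt.eq_1]

lemma pairEnergy_flipPair_of_iff (s β : ℝ) {T : Finset (Site d)} (p : Config d × Config d)
    {i j : Site d} (h : i ∈ T ↔ j ∈ T) : pairEnergy s β (flipPair T p) i j = pairEnergy s β p i j := by
  unfold pairEnergy
  have h1 : spin (flipPair T p).1 i * spin (flipPair T p).1 j = spin p.1 i * spin p.1 j := by
    simp only [flipPair, spin_flipSet]
    by_cases hi : i ∈ T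
    · simp [hi, h.mp hi]
    · have hj : j ∉ T := fun hj => hi (h.mpr hj)
      simp [hi, hj]
  rw [h1]
  by_cases hc : diffAt p i ∧ diffAt p j
  · rw [if_pos hc, if_pos (by rwa [diffAt_flipPair, diffAt_flipPair])]
  · rw [if_neg hc, if_neg (by rwa [diffAt_flipPair, diffAt_flipPair])]

lemma pairEnergy_of_not_diffAt (s β : ℝ) {p : Config d × Config d} {i j : Site d}
    (h : ¬diffAt p j) : pairEnergy s β p i j = 0 := if_neg fun hc => h hc.2

/-- The bond exponent on unordered pairs. -/
def bondEnergy (s β : ℝ) (p : Config d × Config d) : Sym2 (Site d) → ℝ :=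
  Sym2.lift ⟨pairEnergy s β p, pairEnergy_comm s β p⟩

lemma bondEnergy_nonneg {s β : ℝ} (hβ : 0 ≤ β) (p : Config d × Config d) (e : Sym2 (Site d)) :
    0 ≤ bondEnergy s β p e := by
  obtain ⟨i, j⟩ := e
  exact pairEnergy_nonneg hβ p i j

open Classical in
/-- The conditional probability that `G` is the set of open bonds among the bonds in `𝓑`. -/
def bondProb (s β : ℝ) (p : Config d × Config d) (𝓑 G : Finset (Sym2 (Site d))) : ℝ :=
  (∏ e ∈ G, (1 - Real.exp (-bondEnergy s β p e))) * ∏ e ∈ 𝓑 \ G, Real.exp (-bondEnergy s β p e)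

lemma one_sub_exp_nonneg {s β : ℝ} (hβ : 0 ≤ β) (p : Config d × Config d) (e : Sym2 (Site d)) :
    0 ≤ 1 - Real.exp (-bondEnergy s β p e) := by
  have : Real.exp (-bondEnergy s β p e) ≤ 1 :=
    Real.exp_le_one_iff.mpr (by linarith [bondEnergy_nonneg (s := s) hβ p e])
  linarith

lemma bondProb_nonneg {s β : ℝ} (hβ : 0 ≤ β) (p : Config d × Config d)
    (𝓑 G : Finset (Sym2 (Site d))) : 0 ≤ bondProb s β p 𝓑 G :=
  mul_nonneg (Finset.prod_nonneg fun e _ => one_sub_exp_nonneg hβ p e)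
    (Finset.prod_nonneg fun _ _ => (Real.exp_pos _).le)

lemma sum_bondProb (s β : ℝ) (p : Config d × Config d) (𝓑 : Finset (Sym2 (Site d))) :
    ∑ G ∈ 𝓑.powerset, bondProb s β p 𝓑 G = 1 := by
  classical
  unfold bondProb
  rw [← Finset.prod_add]
  simp

-- Bonds are open independently. Expanding the product after deleting the closed option on `E`
-- leaves exactly the outcomes containing `E`.
open Classical in
lemma sum_bondProb_superset (s β : ℝ) (p : Config d × Config d) {𝓑 E : Finset (Sym2 (Site d))}
    (hE : E ⊆ 𝓑) : ∑ G ∈ 𝓑.powerset, (if E ⊆ G then bondProb s β p 𝓑 G else 0) =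
      ∏ e ∈ E, (1 - Real.exp (-bondEnergy s β p e)) := by
  have h := Finset.prod_add (fun e => 1 - Real.exp (-bondEnergy s β p e))
    (fun e => if e ∈ E then 0 else Real.exp (-bondEnergy s β p e)) 𝓑
  have h1 : ∏ e ∈ 𝓑, (1 - Real.exp (-bondEnergy s β p e) +
      if e ∈ E then 0 else Real.exp (-bondEnergy s β p e)) =
      ∏ e ∈ E, (1 - Real.exp (-bondEnergy s β p e)) := by
    rw [← Finset.prod_subset hE fun e _ he => by simp [he]]
    exact Finset.prod_congr rfl fun e he => by simp [he]
  rw [← h1, h]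
  refine Finset.sum_congr rfl fun G hG => ?_
  have hG := Finset.mem_powerset.mp hG
  by_cases hEG : E ⊆ G
  · rw [if_pos hEG, bondProb]
    congr 1
    refine Finset.prod_congr rfl fun e he => ?_
    rw [if_neg fun hc => (Finset.mem_sdiff.mp he).2 (hEG hc)]
  · rw [if_neg hEG]
    obtain ⟨e, he, heG⟩ := Finset.not_subset.mp hEG
    have h0 : ∏ e ∈ 𝓑 \ G, (if e ∈ E then 0 else Real.exp (-bondEnergy s β p e)) = 0 :=
      Finset.prod_eq_zero (Finset.mem_sdiff.mpr ⟨hE he, heG⟩) (if_pos he)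
    rw [h0, mul_zero]

open Classical in
/-- The sites of `Λ` where the two configurations differ. -/
def diffSet (Λ : Finset (Site d)) (p : Config d × Config d) : Finset (Site d) := Λ.filter (diffAt p)

lemma mem_diffSet {Λ : Finset (Site d)} {p : Config d × Config d} {i : Site d} :
    i ∈ diffSet Λ p ↔ i ∈ Λ ∧ diffAt p i := by simp [diffSet]

lemma diffSet_flipPair (Λ T : Finset (Site d)) (p : Config d × Config d) :
    diffSet Λ (flipPair T p) = diffSet Λ p := by
  ext i; simp [mem_diffSet, diffAt_flipPair]

/-- Two sites of `D` are linked if they are neighbours or joined by a bond of `G`. -/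
def linkRel (D : Finset (Site d)) (G : Finset (Sym2 (Site d))) (u v : Site d) : Prop :=
  u ∈ D ∧ v ∈ D ∧ (IsNeighbor u v ∨ s(u, v) ∈ G)

lemma linkRel_symm (D : Finset (Site d)) (G : Finset (Sym2 (Site d))) (u v : Site d)
    (h : linkRel D G u v) : linkRel D G v u :=
  ⟨h.2.1, h.1, by rw [isNeighbor_comm, Sym2.eq_swap]; exact h.2.2⟩

open Classical in
/-- The set of sites of `D` that are connected to `B`. -/
def cluster (B D : Finset (Site d)) (G : Finset (Sym2 (Site d))) : Finset (Site d) :=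
  D.filter fun v => ∃ b ∈ B, b ∈ D ∧ Relation.ReflTransGen (linkRel D G) b v

lemma mem_cluster {B D : Finset (Site d)} {G : Finset (Sym2 (Site d))} {v : Site d} :
    v ∈ cluster B D G ↔ v ∈ D ∧ ∃ b ∈ B, b ∈ D ∧ Relation.ReflTransGen (linkRel D G) b v := by
  simp [cluster]

lemma cluster_closed {B D : Finset (Site d)} {G : Finset (Sym2 (Site d))} {u v : Site d}
    (hu : u ∈ cluster B D G) (hv : v ∈ D) (h : IsNeighbor u v ∨ s(u, v) ∈ G) :
    v ∈ cluster B D G := by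
  obtain ⟨huD, b, hb, hbD, hbu⟩ := mem_cluster.mp hu
  exact mem_cluster.mpr ⟨hv, b, hb, hbD, hbu.tail ⟨huD, hv, h⟩⟩

/-- No site of `T` has a neighbour outside `Λ` where the two configurations differ. -/
def Isolated (Λ T : Finset (Site d)) (p : Config d × Config d) : Prop :=
  ∀ i ∈ T, ∀ j ∈ nbrs i \ Λ, ¬diffAt p j

/-- The total bond exponent between `T` and the complement of `Λ`. -/
def escEnergy (s β : ℝ) (Λ T : Finset (Site d)) (p : Config d × Config d) : ℝ :=
  ∑ i ∈ T, ∑' j, (if j ∈ Λ then 0 else pairEnergy s β p i j)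

lemma summable_ite_pairEnergy {s β : ℝ} (hs : (d : ℝ) + 1 < s) (hβ : 0 ≤ β)
    (p : Config d × Config d) (i : Site d) (S : Finset (Site d)) :
    Summable fun j => (if j ∈ S then 0 else pairEnergy s β p i j) := by
  refine ((summable_longRange hs i).mul_left (4 * β)).of_nonneg_of_le (fun j => ?_) fun j => ?_
  · split_ifs
    · exact le_rfl
    · exact pairEnergy_nonneg hβ p i j
  · split_ifs
    · exact mul_nonneg (by positivity) (longRange_nonneg _ _ _)
    · exact pairEnergy_le hβ p i j

lemma escEnergy_nonneg {s β : ℝ} (hβ : 0 ≤ β) (Λ T : Finset (Site d))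
    (p : Config d × Config d) : 0 ≤ escEnergy s β Λ T p :=
  Finset.sum_nonneg fun i _ => tsum_nonneg fun j => by
    split_ifs
    · exact le_rfl
    · exact pairEnergy_nonneg hβ p i j

lemma continuous_escEnergy {s β : ℝ} (hs : (d : ℝ) + 1 < s) (hβ : 0 ≤ β) (Λ T : Finset (Site d)) :
    Continuous (escEnergy s β Λ T) := by
  refine continuous_finsetSum _ fun i _ => ?_
  refine continuous_tsum (u := fun j => 4 * β * longRange s i j) (fun j => ?_)
    ((summable_longRange hs i).mul_left _) fun j p => ?_
  · split_ifs
    · exact continuous_const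
    · exact continuous_pairEnergy s β i j
  · split_ifs
    · simpa using mul_nonneg (by positivity : 0 ≤ 4 * β) (longRange_nonneg s i j)
    · rw [Real.norm_of_nonneg (pairEnergy_nonneg hβ p i j)]
      exact pairEnergy_le hβ p i j

/-- Reversing both configurations on a closed set of differing sites changes the weight of the
bonds by the Boltzmann factor of the reversal. -/
lemma bondProb_flipPair {s J β : ℝ} (hs : (d : ℝ) + 1 < s) (hβ : 0 ≤ β)
    {Λ T : Finset (Site d)} {G : Finset (Sym2 (Site d))} {p : Config d × Config d}
    (hT : T ⊆ diffSet Λ p) (hG : G ⊆ Λ.sym2)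
    (hcl : ∀ i ∈ T, ∀ j ∈ diffSet Λ p, (IsNeighbor i j ∨ s(i, j) ∈ G) → j ∈ T)
    (hiso : Isolated Λ T p) :
    bondProb s β (flipPair T p) Λ.sym2 G * Real.exp (-escEnergy s β Λ T (flipPair T p)) =
      bondProb s β p Λ.sym2 G * Real.exp (-escEnergy s β Λ T p) *
        Real.exp (β * (flipEnergy s J T p.1 + flipEnergy s J T p.2)) := by
  classical
  have hTΛ : T ⊆ Λ := fun i hi => (mem_diffSet.mp (hT hi)).1
  have hTd : ∀ i ∈ T, diffAt p i := fun i hi => (mem_diffSet.mp (hT hi)).2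
  -- The change of a bond exponent. It vanishes unless the pair joins `T` to a differing site
  -- outside `T`.
  let δ : Site d → Site d → ℝ := fun i j => pairEnergy s β p i j - pairEnergy s β (flipPair T p) i j
  let δs : Sym2 (Site d) → ℝ := fun e => bondEnergy s β p e - bondEnergy s β (flipPair T p) e
  have hδs : ∀ i j, δs s(i, j) = δ i j := fun i j => rfl
  have hδ0 : ∀ i j, (i ∈ T ↔ j ∈ T) → δ i j = 0 := fun i j h => by
    simp only [δ, pairEnergy_flipPair_of_iff s β p h, sub_self]
  have hδ1 : ∀ i j, ¬diffAt p j → δ i j = 0 := fun i j h => by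
    simp only [δ, pairEnergy_of_not_diffAt s β h,
      pairEnergy_of_not_diffAt s β (fun hc => h ((diffAt_flipPair T p j).mp hc)), sub_self]
  have hδG' : ∀ i j, i ∈ T → j ∈ Λ → s(i, j) ∈ G → δ i j = 0 := by
    intro i j hi hj hij
    by_cases hd' : diffAt p j
    · exact hδ0 i j (by simp [hi, hcl i hi j (mem_diffSet.mpr ⟨hj, hd'⟩) (Or.inr hij)])
    · exact hδ1 i j hd'
  have hδc : ∀ i j, δ i j = δ j i := fun i j => by
    simp only [δ]; rw [pairEnergy_comm s β p, pairEnergy_comm s β (flipPair T p)]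
  -- Open bonds keep their weight because `T` is closed under them. Only closed bonds change, and
  -- their weights are pure exponentials.
  have hδG : ∀ e ∈ G, δs e = 0 := by
    intro e he
    induction e with | _ i j =>
    have hmem := Finset.mk_mem_sym2_iff.mp (hG he)
    rw [hδs]
    by_cases hi : i ∈ T
    · exact hδG' i j hi hmem.2 he
    · by_cases hj : j ∈ T
      · rw [hδc]; exact hδG' j i hj hmem.1 (by rwa [Sym2.eq_swap])
      · exact hδ0 i j (by simp [hi, hj])
  have h1 : bondProb s β (flipPair T p) Λ.sym2 G =
      bondProb s β p Λ.sym2 G * Real.exp (∑ e ∈ Λ.sym2, δs e) := by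
    unfold bondProb
    rw [mul_assoc]
    congr 1
    · refine Finset.prod_congr rfl fun e he => ?_
      have := hδG e he
      simp only [δs] at this
      rw [sub_eq_zero.mp this]
    · rw [← Real.exp_sum, ← Real.exp_sum, ← Real.exp_add, ← Finset.sum_sdiff hG,
        Finset.sum_eq_zero hδG, add_zero, ← Finset.sum_add_distrib]
      congr 1
      refine Finset.sum_congr rfl fun e _ => ?_
      simp only [δs]; ring
  have h2 : ∑ e ∈ Λ.sym2, δs e = ∑ i ∈ T, ∑ j ∈ Λ \ T, δ i j := by
    have hprod : ∑ i ∈ T, ∑ j ∈ Λ \ T, δ i j = ∑ q ∈ T ×ˢ (Λ \ T), δs s(q.1, q.2) :=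
      (Finset.sum_product' _ _ _).symm
    rw [hprod]
    have hinj : Set.InjOn (fun q : Site d × Site d => s(q.1, q.2))
        ((T ×ˢ (Λ \ T) : Finset (Site d × Site d)) : Set (Site d × Site d)) := by
      rintro ⟨i, j⟩ hq ⟨i', j'⟩ hq' h
      simp only [Finset.coe_product, Set.mem_prod, Finset.mem_coe, Finset.mem_sdiff] at hq hq'
      rcases Sym2.eq_iff.mp h with ⟨rfl, rfl⟩ | ⟨rfl, rfl⟩
      · rfl
      · exact absurd hq.1 hq'.2.2
    rw [← Finset.sum_image (f := δs) (s := T ×ˢ (Λ \ T)) hinj]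
    refine (Finset.sum_subset ?_ ?_).symm
    · intro e he
      obtain ⟨⟨i, j⟩, hq, rfl⟩ := Finset.mem_image.mp he
      simp only [Finset.mem_product, Finset.mem_sdiff] at hq
      exact Finset.mk_mem_sym2_iff.mpr ⟨hTΛ hq.1, hq.2.1⟩
    · intro e he hne
      induction e with | _ i j =>
      have hmem := Finset.mk_mem_sym2_iff.mp he
      rw [hδs]
      refine hδ0 i j ?_
      by_contra hc
      refine hne (Finset.mem_image.mpr ?_)
      by_cases hi : i ∈ T
      · exact ⟨(i, j), by simp [hi, hmem.2]; tauto, rfl⟩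
      · exact ⟨(j, i), by simp [hi, hmem.1]; tauto, Sym2.eq_swap⟩
  have h3 : -escEnergy s β Λ T (flipPair T p) = -escEnergy s β Λ T p +
      ∑ i ∈ T, ∑' j, (if j ∈ Λ then 0 else δ i j) := by
    unfold escEnergy
    rw [neg_add_eq_sub, eq_sub_iff_add_eq, neg_add_eq_sub, ← Finset.sum_sub_distrib]
    refine Finset.sum_congr rfl fun i _ => ?_
    rw [← Summable.tsum_sub (summable_ite_pairEnergy hs hβ _ _ _)
      (summable_ite_pairEnergy hs hβ _ _ _)]
    exact tsum_congr fun j => by split_ifs <;> simp [δ]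
  have hδsum : ∀ i S, Summable fun j => (if j ∈ S then 0 else δ i j) := fun i S =>
    ((summable_ite_pairEnergy hs hβ p i S).sub
      (summable_ite_pairEnergy hs hβ (flipPair T p) i S)).congr fun j => by
        split_ifs <;> simp [δ]
  have h4 : ∑ i ∈ T, ∑ j ∈ Λ \ T, δ i j + ∑ i ∈ T, ∑' j, (if j ∈ Λ then 0 else δ i j) =
      β * (flipEnergy s J T p.1 + flipEnergy s J T p.2) := by
    unfold flipEnergy
    rw [← mul_add, ← Finset.sum_add_distrib, ← Finset.sum_add_distrib, ← mul_assoc, Finset.mul_sum]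
    refine Finset.sum_congr rfl fun i hi => ?_
    have h5 : ∑ j ∈ Λ \ T, δ i j = ∑' j, (if j ∈ Λ \ T then δ i j else 0) := by
      rw [tsum_eq_sum (s := Λ \ T) fun j hj => if_neg hj]
      exact Finset.sum_congr rfl fun j hj => (if_pos hj).symm
    have hsc : ∀ σ : Config d, Summable fun j =>
        (if j ∈ T then 0 else coupling s J i j * spin σ i * spin σ j) := fun σ => by
      refine Summable.of_abs ((summable_abs_coupling hs J i).of_nonneg_of_le
        (fun _ => abs_nonneg _) fun j => ?_)
      split_ifs
      · simp
      · rw [abs_coupling_spin]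
    rw [h5, ← Summable.tsum_add (summable_of_ne_finset_zero (s := Λ \ T) fun j hj => if_neg hj)
      (hδsum i Λ), ← Summable.tsum_add (hsc _) (hsc _), ← tsum_mul_left]
    refine tsum_congr fun j => ?_
    by_cases hj : j ∈ T
    · simp [hj, hTΛ hj]
    have hL : (if j ∈ Λ \ T then δ i j else 0) + (if j ∈ Λ then 0 else δ i j) = δ i j := by
      by_cases hjΛ : j ∈ Λ <;> simp [hj, hjΛ]
    rw [hL, if_neg hj, if_neg hj, spin_snd_of_diffAt (hTd i hi)]
    -- If the configurations differ at `j`, then `i` and `j` are not neighbours, only `K` remains,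
    -- and both replicas contribute equally; both sides are `-4βK σ_i σ_j`. If they agree at `j`,
    -- the two contributions cancel because the spins at `i` are opposite.
    by_cases hdj : diffAt p j
    · have hn : ¬IsNeighbor i j := by
        intro hn
        by_cases hjΛ : j ∈ Λ
        · exact hj (hcl i hi j (mem_diffSet.mpr ⟨hjΛ, hdj⟩) (Or.inl hn))
        · exact hiso i hi j (Finset.mem_sdiff.mpr ⟨mem_nbrs.mpr hn, hjΛ⟩) hdj
      rw [spin_snd_of_diffAt hdj, coupling_of_not_isNeighbor s J hn]
      simp only [δ, pairEnergy, diffAt_flipPair, hTd i hi, hdj, and_self, if_true]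
      simp only [flipPair, spin_flipSet, hi, hj, if_true, if_false]
      ring
    · rw [hδ1 i j hdj, spin_snd_of_not_diffAt hdj]
      ring
  rw [h1, h2, h3, ← h4, Real.exp_add, Real.exp_add]
  ring

/-- The flip identity for a product of two flip invariant measures. -/
lemma lintegral_flipPair {s J β : ℝ} (hs : (d : ℝ) + 1 < s) {μ ν : Measure (Config d)}
    [SFinite μ] [SFinite ν] (hμ : FlipInvariant s J β μ) (hν : FlipInvariant s J β ν)
    (T : Finset (Site d)) (g : Config d × Config d → ENNReal) (hg : Measurable g) :
    ∫⁻ p, g (flipPair T p) ∂(μ.prod ν) = ∫⁻ p, g p * ENNReal.ofReal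
      (Real.exp (-(β * (flipEnergy s J T p.1 + flipEnergy s J T p.2)))) ∂(μ.prod ν) := by
  have he : Measurable fun σ : Config d => ENNReal.ofReal (Real.exp (-β * flipEnergy s J T σ)) :=
    ((measurable_flipEnergy hs J T).const_mul _).exp.ennreal_ofReal
  have hfp : Measurable (flipPair T : Config d × Config d → _) :=
    ((measurable_flipSet T).comp measurable_fst).prodMk ((measurable_flipSet T).comp measurable_snd)
  have hsplit : ∀ p : Config d × Config d, ENNReal.ofReal
      (Real.exp (-(β * (flipEnergy s J T p.1 + flipEnergy s J T p.2)))) =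
      ENNReal.ofReal (Real.exp (-β * flipEnergy s J T p.2)) *
        ENNReal.ofReal (Real.exp (-β * flipEnergy s J T p.1)) := fun p => by
    rw [← ENNReal.ofReal_mul (Real.exp_nonneg _), ← Real.exp_add]
    congr 2; ring
  have hmeas2 : Measurable fun p : Config d × Config d =>
      g p * ENNReal.ofReal (Real.exp (-β * flipEnergy s J T p.2)) := hg.mul (he.comp measurable_snd)
  simp only [hsplit, ← mul_assoc]
  rw [lintegral_prod (fun p => g (flipPair T p)) (hg.comp hfp).aemeasurable,
    lintegral_prod (fun p : Config d × Config d =>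
      g p * ENNReal.ofReal (Real.exp (-β * flipEnergy s J T p.2)) *
        ENNReal.ofReal (Real.exp (-β * flipEnergy s J T p.1)))
      (hmeas2.mul (he.comp measurable_fst)).aemeasurable]
  have h1 : ∀ σ, ∫⁻ σ', g (flipPair T (σ, σ')) ∂ν =
      ∫⁻ σ', g (flipSet T σ, σ') * ENNReal.ofReal (Real.exp (-β * flipEnergy s J T σ')) ∂ν :=
    fun σ => hν T (fun σ' => g (flipSet T σ, σ')) (hg.comp (measurable_const.prodMk measurable_id))
  rw [lintegral_congr h1]
  have h2 := hμ T (fun σ => ∫⁻ σ', g (σ, σ') *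
    ENNReal.ofReal (Real.exp (-β * flipEnergy s J T σ')) ∂ν) hmeas2.lintegral_prod_right'
  rw [h2]
  refine lintegral_congr fun σ => ?_
  exact (lintegral_mul_const (f := fun σ' => g (σ, σ') *
    ENNReal.ofReal (Real.exp (-β * flipEnergy s J T σ'))) _
    (hmeas2.comp (measurable_const.prodMk measurable_id))).symm

open Classical in
/-- The probability that `D` is the set of differing sites in `Λ`, that `G` is the set of open bonds,
and that the resulting cluster of `B` is not connected to the complement of `Λ`. -/
def fkWeight (s β : ℝ) (Λ B D : Finset (Site d)) (G : Finset (Sym2 (Site d)))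
    (p : Config d × Config d) : ENNReal :=
  if diffSet Λ p = D ∧ Isolated Λ (cluster B D G) p then
    ENNReal.ofReal (bondProb s β p Λ.sym2 G * Real.exp (-escEnergy s β Λ (cluster B D G) p))
  else 0

lemma measurableSet_diffAt (i : Site d) : MeasurableSet {p : Config d × Config d | diffAt p i} := by
  have h : Measurable fun p : Config d × Config d => (p.1 i, p.2 i) := by fun_prop
  exact h (MeasurableSet.of_discrete (s := {q : ℤˣ × ℤˣ | q.1 ≠ q.2}))

lemma measurableSet_diffSet_eq (Λ D : Finset (Site d)) :
    MeasurableSet {p : Config d × Config d | diffSet Λ p = D} := by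
  by_cases hD : D ⊆ Λ
  · have : {p : Config d × Config d | diffSet Λ p = D} =
        (⋂ i ∈ D, {p | diffAt p i}) ∩ ⋂ i ∈ Λ \ D, {p | diffAt p i}ᶜ := by
      ext p
      simp only [Set.mem_ofPred_eq, Set.mem_inter_iff, Set.mem_iInter, Set.mem_compl_iff,
        Finset.ext_iff, mem_diffSet, Finset.mem_sdiff]
      constructor
      · exact fun h => ⟨fun i hi => ((h i).mpr hi).2, fun i hi hc => hi.2 ((h i).mp ⟨hi.1, hc⟩)⟩
      · rintro ⟨h1, h2⟩ i
        refine ⟨fun h => ?_, fun h => ⟨hD h, h1 i h⟩⟩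
        by_contra hc
        exact h2 i ⟨h.1, hc⟩ h.2
    rw [this]
    exact (Finset.measurableSet_biInter _ fun i _ => measurableSet_diffAt i).inter
      (Finset.measurableSet_biInter _ fun i _ => (measurableSet_diffAt i).compl)
  · convert MeasurableSet.empty
    ext p
    simp only [Set.mem_ofPred_eq, Set.mem_empty_iff_false, iff_false]
    rintro rfl
    exact hD fun i hi => (mem_diffSet.mp hi).1

lemma measurable_bondProb (s β : ℝ) (𝓑 G : Finset (Sym2 (Site d))) :
    Measurable fun p : Config d × Config d => bondProb s β p 𝓑 G := by
  have h : ∀ e : Sym2 (Site d), Measurable fun p : Config d × Config d => bondEnergy s β p e := by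
    intro e
    induction e with | _ i j => exact (continuous_pairEnergy s β i j).measurable
  unfold bondProb
  exact (Finset.measurable_fun_prod _ fun e _ => measurable_const.sub (h e).neg.exp).mul
    (Finset.measurable_fun_prod _ fun e _ => (h e).neg.exp)

lemma measurable_fkWeight {s β : ℝ} (hs : (d : ℝ) + 1 < s) (hβ : 0 ≤ β) (Λ B D : Finset (Site d))
    (G : Finset (Sym2 (Site d))) : Measurable (fkWeight s β Λ B D G) := by
  classical
  refine Measurable.ite ((measurableSet_diffSet_eq Λ D).inter ?_) ?_ measurable_const
  · have : {p : Config d × Config d | Isolated Λ (cluster B D G) p} =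
        ⋂ i ∈ cluster B D G, ⋂ j ∈ nbrs i \ Λ, {p | diffAt p j}ᶜ := by
      ext p
      simp only [Isolated, Set.mem_ofPred_eq, Set.mem_iInter, Set.mem_compl_iff]
    change MeasurableSet {p : Config d × Config d | Isolated Λ (cluster B D G) p}
    rw [this]
    exact Finset.measurableSet_biInter _ fun i _ =>
      Finset.measurableSet_biInter _ fun j _ => (measurableSet_diffAt j).compl
  · exact ((measurable_bondProb s β _ G).mul
      (continuous_escEnergy hs hβ _ _).measurable.neg.exp).ennreal_ofReal

/-- On the event that the cluster of `B` is isolated, the two configurations are exchangeable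
on `B`. -/
lemma lintegral_mul_fkWeight {s J β : ℝ} (hs : (d : ℝ) + 1 < s) (hβ : 0 ≤ β)
    {μ ν : Measure (Config d)} [SFinite μ] [SFinite ν] (hμ : FlipInvariant s J β μ)
    (hν : FlipInvariant s J β ν) {Λ B D : Finset (Site d)} (hB : B ⊆ Λ)
    {G : Finset (Sym2 (Site d))} (hG : G ⊆ Λ.sym2) (f : Config d → ENNReal) (hf : Measurable f)
    (hfB : ∀ σ σ' : Config d, (∀ i ∈ B, σ i = σ' i) → f σ = f σ') :
    ∫⁻ p, f p.1 * fkWeight s β Λ B D G p ∂(μ.prod ν) =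
      ∫⁻ p, f p.2 * fkWeight s β Λ B D G p ∂(μ.prod ν) := by
  set T := cluster B D G with hT
  have hfp : Measurable (flipPair T : Config d × Config d → _) :=
    ((measurable_flipSet T).comp measurable_fst).prodMk ((measurable_flipSet T).comp measurable_snd)
  have h := lintegral_flipPair hs hμ hν T
    (fun p => f (flipPair T p).1 * fkWeight s β Λ B D G (flipPair T p))
    (((hf.comp measurable_fst).mul (measurable_fkWeight hs hβ Λ B D G)).comp hfp)
  simp only [flipPair_flipPair] at h
  rw [h]
  refine lintegral_congr fun p => ?_
  have hiso : Isolated Λ T (flipPair T p) ↔ Isolated Λ T p := by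
    simp only [Isolated, diffAt_flipPair]
  unfold fkWeight
  rw [diffSet_flipPair, ← hT, hiso]
  by_cases hc : diffSet Λ p = D ∧ Isolated Λ T p
  · rw [if_pos hc, if_pos hc]
    -- Every differing site of `B` lies in its cluster, so the flip turns the first configuration
    -- into the second on `B`.
    have h1 : f (flipPair T p).1 = f p.2 := by
      refine hfB _ _ fun i hi => ?_
      by_cases hd' : diffAt p i
      · have hiD : i ∈ D := hc.1 ▸ mem_diffSet.mpr ⟨hB hi, hd'⟩
        have hiT : i ∈ T := mem_cluster.mpr ⟨hiD, i, hi, hiD, Relation.ReflTransGen.refl⟩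
        change flipSet T p.1 i = p.2 i
        rw [flipSet_of_mem hiT, neg_fst_of_diffAt hd']
      · have hiT : i ∉ T := fun hiT => hd' <| by
          have := (mem_cluster.mp hiT).1
          rw [← hc.1] at this
          exact (mem_diffSet.mp this).2
        change flipSet T p.1 i = p.2 i
        rw [flipSet_of_notMem hiT]
        exact not_not.mp hd'
    have h2 := bondProb_flipPair (J := J) hs hβ (T := T) (G := G) (p := p) (Λ := Λ)
      (fun i hi => hc.1 ▸ (mem_cluster.mp hi).1) hG
      (fun i hi j hj hij => cluster_closed hi (hc.1 ▸ hj) hij) hc.2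
    rw [h1, mul_assoc, h2, ← ENNReal.ofReal_mul (by
      exact mul_nonneg (mul_nonneg (bondProb_nonneg hβ _ _ _) (Real.exp_nonneg _))
        (Real.exp_nonneg _)), mul_assoc (bondProb s β p _ _ * _), ← Real.exp_add, add_neg_cancel,
      Real.exp_zero, mul_one]
  · rw [if_neg hc, if_neg hc]
    simp

end RandomBonds

/-! ### Escape along chains and uniqueness of the enclosed state. -/

section Uniqueness

variable {d : ℕ}

open Classical in
/-- A bound for the probability that two sites are linked. -/
def linkBound (s β : ℝ) (i j : Site d) : ENNReal :=
  if IsNeighbor i j then 1 else ENNReal.ofReal (4 * β * longRange s i j)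

/-- One of the two configurations of a pair. -/
def pick (c : Bool) (p : Config d × Config d) : Config d := if c then p.2 else p.1

lemma le_exp_neg_add_self (w : ℝ) (hw : 0 ≤ w) :
    1 ≤ ENNReal.ofReal (Real.exp (-w)) + ENNReal.ofReal w := by
  rw [← ENNReal.ofReal_add (Real.exp_nonneg _) hw, ← ENNReal.ofReal_one]
  exact ENNReal.ofReal_le_ofReal (by linarith [Real.add_one_le_exp (-w)])

-- A union bound for escape from `Λ`. Either a neighbouring exit exists, and `linkBound` equals 1
-- there, or only bonds can escape and `1 ≤ exp (-w) + w` applies.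
open Classical in
lemma one_le_isolated_add_escape {s β : ℝ} (hs : (d : ℝ) + 1 < s) (hβ : 0 ≤ β)
    (Λ T : Finset (Site d)) (p : Config d × Config d) :
    1 ≤ (if Isolated Λ T p then ENNReal.ofReal (Real.exp (-escEnergy s β Λ T p)) else 0) +
      ∑ i ∈ T, ∑' j, (if j ∈ Λ then 0 else linkBound s β i j) := by
  by_cases h : Isolated Λ T p
  · rw [if_pos h]
    refine (le_exp_neg_add_self _ (escEnergy_nonneg (s := s) hβ Λ T p)).trans ?_
    gcongr
    have h0 : ∀ i j, 0 ≤ (if j ∈ Λ then 0 else pairEnergy s β p i j) := fun i j => by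
      split_ifs
      · exact le_rfl
      · exact pairEnergy_nonneg hβ p i j
    unfold escEnergy
    rw [ENNReal.ofReal_sum_of_nonneg fun i _ => tsum_nonneg (h0 i)]
    refine Finset.sum_le_sum fun i hi => ?_
    rw [ENNReal.ofReal_tsum_of_nonneg (h0 i) (summable_ite_pairEnergy hs hβ p i Λ)]
    refine ENNReal.tsum_le_tsum fun j => ?_
    by_cases hj : j ∈ Λ
    · simp [hj]
    rw [if_neg hj, if_neg hj, linkBound]
    by_cases hij : IsNeighbor i j
    · rw [pairEnergy_of_not_diffAt s β (h i hi j (Finset.mem_sdiff.mpr ⟨mem_nbrs.mpr hij, hj⟩))]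
      simp
    · rw [if_neg hij]
      exact ENNReal.ofReal_le_ofReal (pairEnergy_le hβ p i j)
  · rw [if_neg h, zero_add]
    unfold Isolated at h
    push Not at h
    obtain ⟨i, hi, j, hj, -⟩ := h
    obtain ⟨hij, hj⟩ := Finset.mem_sdiff.mp hj
    calc (1 : ENNReal) = if j ∈ Λ then 0 else linkBound s β i j := by
          rw [if_neg hj, linkBound, if_pos (mem_nbrs.mp hij)]
      _ ≤ ∑' j, (if j ∈ Λ then 0 else linkBound s β i j) := ENNReal.le_tsum j
      _ ≤ _ := Finset.single_le_sum
        (f := fun i => ∑' j, (if j ∈ Λ then 0 else linkBound s β i j)) (fun _ _ => zero_le) hi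

lemma sum_ofReal_bondProb {β : ℝ} (hβ : 0 ≤ β) (s : ℝ) (p : Config d × Config d)
    (𝓑 : Finset (Sym2 (Site d))) :
    ∑ G ∈ 𝓑.powerset, ENNReal.ofReal (bondProb s β p 𝓑 G) = 1 := by
  rw [← ENNReal.ofReal_sum_of_nonneg fun G _ => bondProb_nonneg hβ p 𝓑 G, sum_bondProb,
    ENNReal.ofReal_one]

lemma sum_fkWeight_diffSet (s β : ℝ) (Λ B : Finset (Site d)) (G : Finset (Sym2 (Site d)))
    (p : Config d × Config d) : ∑ D ∈ Λ.powerset, fkWeight s β Λ B D G p =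
      fkWeight s β Λ B (diffSet Λ p) G p := by
  refine Finset.sum_eq_single _ (fun D _ hD => if_neg fun h => hD h.1.symm) fun h => ?_
  exact absurd (Finset.mem_powerset.mpr fun i hi => (mem_diffSet.mp hi).1) h

lemma fkWeight_diffSet_le {β : ℝ} (hβ : 0 ≤ β) (s : ℝ) (Λ B : Finset (Site d))
    (G : Finset (Sym2 (Site d))) (p : Config d × Config d) :
    fkWeight s β Λ B (diffSet Λ p) G p ≤ ENNReal.ofReal (bondProb s β p Λ.sym2 G) := by
  unfold fkWeight
  split_ifs
  · refine ENNReal.ofReal_le_ofReal (mul_le_of_le_one_right (bondProb_nonneg hβ _ _ _) ?_)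
    have := escEnergy_nonneg (s := s) hβ Λ (cluster B (diffSet Λ p) G) p
    exact Real.exp_le_one_iff.mpr (by linarith)
  · exact zero_le

lemma sum_fkWeight_le_one {β : ℝ} (hβ : 0 ≤ β) (s : ℝ) (Λ B : Finset (Site d))
    (p : Config d × Config d) :
    ∑ G ∈ Λ.sym2.powerset, ∑ D ∈ Λ.powerset, fkWeight s β Λ B D G p ≤ 1 := by
  rw [← sum_ofReal_bondProb hβ s p Λ.sym2]
  refine Finset.sum_le_sum fun G _ => ?_
  rw [sum_fkWeight_diffSet]
  exact fkWeight_diffSet_le hβ s Λ B G p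

-- The isolated clusters carry total weight one, up to the expected number of exits from `Λ`.
open Classical in
lemma one_le_sum_fkWeight_add {s β : ℝ} (hs : (d : ℝ) + 1 < s) (hβ : 0 ≤ β)
    (Λ B : Finset (Site d)) (p : Config d × Config d) :
    1 ≤ ∑ G ∈ Λ.sym2.powerset, ∑ D ∈ Λ.powerset, fkWeight s β Λ B D G p +
      ∑ G ∈ Λ.sym2.powerset, ENNReal.ofReal (bondProb s β p Λ.sym2 G) *
        ∑ i ∈ cluster B (diffSet Λ p) G, ∑' j, (if j ∈ Λ then 0 else linkBound s β i j) := by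
  rw [← sum_ofReal_bondProb hβ s p Λ.sym2, ← Finset.sum_add_distrib]
  refine Finset.sum_le_sum fun G _ => ?_
  rw [sum_fkWeight_diffSet]
  have h := mul_le_mul_right (one_le_isolated_add_escape hs hβ Λ (cluster B (diffSet Λ p) G) p)
    (ENNReal.ofReal (bondProb s β p Λ.sym2 G))
  rw [mul_one, mul_add] at h
  refine h.trans (le_of_eq ?_)
  congr 1
  unfold fkWeight
  by_cases hi : Isolated Λ (cluster B (diffSet Λ p) G) p
  · rw [if_pos hi, if_pos ⟨rfl, hi⟩, ENNReal.ofReal_mul (bondProb_nonneg hβ _ _ _)]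
  · rw [if_neg hi, if_neg fun h => hi h.2, mul_zero]

/-- The contours of a chain are distinct and present in the pair of configurations. -/
def ChainPresent (p : Config d × Config d) (l : List (Item d)) : Prop :=
  (l.map Prod.fst).Nodup ∧ ∀ N ∈ l.map Prod.fst, IsContour (pick N.1 p) N.2

/-- The contour parameter is 1 because the contours are given at this stage; their cost appears only
after integrating over the configurations. The added step is the jump from `i` out to `j`. -/
lemma IsRoute.chainWeight_eq {D : Finset (Site d)} {G : Finset (Sym2 (Site d))}
    {node : Site d → Node d} {k : Site d → Site d → ENNReal}
    (hnode : ∀ v ∈ D, v ∈ (node v).2 ∧ EdgeConnected (edgeBoundary (node v).2)) {i : Site d}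
    (hi : i ∈ D) (j : Site d) {a : Site d} (ha : a ∈ D) {l : List (Item d)}
    (h : IsRoute (linkRel D G) node i a l) : chainWeight 1 k a (l ++ [(node i, i, j)]) =
      (l.map fun it => k it.2.1 it.2.2).prod * k i j := by
  induction l generalizing a with
  | nil =>
    simp only [IsRoute] at h
    have h1 : a ∈ (node i).2 := h ▸ (hnode a ha).1
    simp [chainWeight, itemWeight, h1, hnode i hi]
  | cons it l ih =>
    obtain ⟨h1, h2, h3, h4⟩ := h
    have h5 := hnode a ha
    have h6 := hnode it.2.1 h3.1
    rw [h1] at h5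
    rw [h2] at h6
    simp only [List.cons_append, chainWeight, ih h3.2.1 h4, List.map_cons, List.prod_cons]
    rw [itemWeight, if_pos ⟨h5.1, h6.1, h6.2⟩, one_pow, one_mul, mul_assoc]

/-- The probability that all links of a list are present. -/
lemma sum_bondProb_links_le {s β : ℝ} (hβ : 0 ≤ β) (p : Config d × Config d)
    {Λ : Finset (Site d)} {l : List (Item d)} (hnd : (l.map Item.bond).Nodup)
    (hl : ∀ it ∈ l, it.2.1 ∈ Λ ∧ it.2.2 ∈ Λ) (Q : Finset (Sym2 (Site d)) → Prop) [DecidablePred Q]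
    (hQ : ∀ G, Q G → ∀ it ∈ l, IsNeighbor it.2.1 it.2.2 ∨ Item.bond it ∈ G) :
    ∑ G ∈ Λ.sym2.powerset, (if Q G then ENNReal.ofReal (bondProb s β p Λ.sym2 G) else 0) ≤
      (l.map fun it => linkBound s β it.2.1 it.2.2).prod := by
  classical
  -- Neighbouring sites are linked without a bond and have `linkBound` 1, so only the other steps
  -- require an open bond.
  let l' := l.filter fun it => ¬IsNeighbor it.2.1 it.2.2
  let E : Finset (Sym2 (Site d)) := (l'.map Item.bond).toFinset
  have hE : E ⊆ Λ.sym2 := by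
    intro e he
    obtain ⟨it, hit, rfl⟩ := List.mem_map.mp (List.mem_toFinset.mp he)
    exact Finset.mk_mem_sym2_iff.mpr (hl it (List.mem_filter.mp hit).1)
  have h1 : ∑ G ∈ Λ.sym2.powerset, (if Q G then ENNReal.ofReal (bondProb s β p Λ.sym2 G) else 0) ≤
      ENNReal.ofReal (∏ e ∈ E, (1 - Real.exp (-bondEnergy s β p e))) := by
    rw [← sum_bondProb_superset s β p hE, ENNReal.ofReal_sum_of_nonneg fun G _ => by
      split_ifs
      · exact bondProb_nonneg hβ _ _ _
      · exact le_rfl]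
    refine Finset.sum_le_sum fun G _ => ?_
    by_cases hG : Q G
    · have hEG : E ⊆ G := by
        intro e he
        obtain ⟨it, hit, rfl⟩ := List.mem_map.mp (List.mem_toFinset.mp he)
        obtain ⟨hit, hn⟩ := List.mem_filter.mp hit
        exact (hQ G hG it hit).resolve_left (by simpa using hn)
      rw [if_pos hG, if_pos hEG]
    · rw [if_neg hG]; exact zero_le
  refine h1.trans ?_
  have hnd' : (l'.map Item.bond).Nodup := hnd.sublist (List.filter_sublist.map _)
  rw [ENNReal.ofReal_prod_of_nonneg fun e _ => one_sub_exp_nonneg hβ p e,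
    List.prod_toFinset _ hnd', List.map_map]
  have h2 : (l'.map ((fun e => ENNReal.ofReal (1 - Real.exp (-bondEnergy s β p e))) ∘ Item.bond)).prod
      ≤ (l'.map fun it => linkBound s β it.2.1 it.2.2).prod := by
    refine List.prod_le_prod' fun it hit => ?_
    have hn : ¬IsNeighbor it.2.1 it.2.2 := by simpa using (List.mem_filter.mp hit).2
    rw [linkBound, if_neg hn]
    refine ENNReal.ofReal_le_ofReal (le_trans ?_ (pairEnergy_le hβ p it.2.1 it.2.2))
    have := Real.add_one_le_exp (-pairEnergy s β p it.2.1 it.2.2)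
    change 1 - Real.exp (-pairEnergy s β p it.2.1 it.2.2) ≤ _
    linarith
  refine h2.trans (le_of_eq ?_)
  clear_value E
  simp only [l']
  clear h1 h2 hnd hnd' hQ hl hE
  induction l with
  | nil => simp
  | cons it l ih =>
    by_cases hn : IsNeighbor it.2.1 it.2.2
    · rw [List.filter_cons_of_neg (by simpa using hn), ih, List.map_cons, List.prod_cons, linkBound,
        if_pos hn, one_mul]
    · rw [List.filter_cons_of_pos (by simpa using hn), List.map_cons, List.prod_cons, ih,
        List.map_cons, List.prod_cons]

open Classical in
/-- The cluster of `B` reaches the complement of `Λ` only through chains of contours. -/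
lemma sum_escape_le {s β : ℝ} (hβ : 0 ≤ β) {p : Config d × Config d}
    (hp : ∀ c v, pick c p v = -1 → ∃ A, v ∈ A ∧ IsContour (pick c p) A) (Λ B : Finset (Site d)) :
    ∑ G ∈ Λ.sym2.powerset, ENNReal.ofReal (bondProb s β p Λ.sym2 G) *
        ∑ i ∈ cluster B (diffSet Λ p) G, ∑' j, (if j ∈ Λ then 0 else linkBound s β i j) ≤
      ∑ a ∈ B, ∑' l, (if chainEnd a l ∉ Λ ∧ ChainPresent p l then
        chainWeight 1 (linkBound s β) a l else 0) := by
  set D := diffSet Λ p with hD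
  -- Where two spins differ one of them is minus, hence enclosed by a contour of its configuration.
  -- The default outside `D` is irrelevant.
  have hex : ∀ v, ∃ N : Node d, v ∈ D → v ∈ N.2 ∧ IsContour (pick N.1 p) N.2 := by
    intro v
    by_cases hv : v ∈ D
    · have hne : p.1 v ≠ p.2 v := (mem_diffSet.mp hv).2
      obtain ⟨c, hc⟩ : ∃ c, pick c p v = -1 := by
        rcases Int.units_eq_one_or (p.1 v) with h1 | h1
        · rcases Int.units_eq_one_or (p.2 v) with h2 | h2
          · exact absurd (h1.trans h2.symm) hne
          · exact ⟨true, h2⟩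
        · exact ⟨false, h1⟩
      obtain ⟨A, hA⟩ := hp c v hc
      exact ⟨(c, A), fun _ => hA⟩
    · exact ⟨(true, ∅), fun h => absurd h hv⟩
  choose node hnode using hex
  have hnode' : ∀ v ∈ D, v ∈ (node v).2 ∧ EdgeConnected (edgeBoundary (node v).2) :=
    fun v hv => ⟨(hnode v hv).1, (hnode v hv).2.connected⟩
  let Q : Finset (Sym2 (Site d)) → Site d → Site d → List (Item d) → Prop := fun G a i l =>
    a ∈ D ∧ i ∈ D ∧ IsRoute (linkRel D G) node i a l ∧ (l.map Prod.fst ++ [node i]).Nodup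
  let out : Site d → Site d → ENNReal := fun i j => if j ∈ Λ then 0 else linkBound s β i j
  let bp : Finset (Sym2 (Site d)) → ENNReal := fun G => ENNReal.ofReal (bondProb s β p Λ.sym2 G)
  have h1 : ∀ G, bp G * ∑ i ∈ cluster B D G, ∑' j, out i j ≤
      ∑ a ∈ B, ∑' l, ∑' i, ∑' j, (if Q G a i l then bp G else 0) * out i j := by
    intro G
    rw [Finset.mul_sum]
    have h2 : ∀ i ∈ cluster B D G, bp G * ∑' j, out i j ≤
        ∑ a ∈ B, ∑' l, ∑' j, (if Q G a i l then bp G else 0) * out i j := by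
      intro i hi
      obtain ⟨hiD, a, ha, haD, hai⟩ := mem_cluster.mp hi
      obtain ⟨l, hl, hlnd⟩ := exists_isRoute (linkRel_symm D G) node hai
      refine le_trans ?_ (Finset.single_le_sum (f := fun a => ∑' l, ∑' j,
        (if Q G a i l then bp G else 0) * out i j) (fun _ _ => zero_le) ha)
      refine le_trans ?_ (ENNReal.le_tsum l)
      rw [ENNReal.tsum_mul_left, if_pos (show Q G a i l from ⟨haD, hiD, hl, hlnd⟩)]
    refine (Finset.sum_le_sum h2).trans ?_
    rw [Finset.sum_comm]
    refine Finset.sum_le_sum fun a _ => ?_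
    calc ∑ i ∈ cluster B D G, ∑' l, ∑' j, (if Q G a i l then bp G else 0) * out i j
        ≤ ∑' i, ∑' l, ∑' j, (if Q G a i l then bp G else 0) * out i j := ENNReal.sum_le_tsum _
      _ = _ := ENNReal.tsum_comm
  refine (Finset.sum_le_sum fun G _ => h1 G).trans ?_
  rw [Finset.sum_comm]
  refine Finset.sum_le_sum fun a _ => ?_
  let F : List (Item d) → ENNReal := fun l => if chainEnd a l ∉ Λ ∧ ChainPresent p l then
        chainWeight 1 (linkBound s β) a l else 0
  -- Appending the jump out of `Λ` is injective, so routes with their exits are bounded by the sum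
  -- over all chains.
  let ι : List (Item d) × Site d × Site d → List (Item d) := fun q =>
    q.1 ++ [(node q.2.1, q.2.1, q.2.2)]
  have hι : Function.Injective ι := by
    rintro ⟨l, i, j⟩ ⟨l', i', j'⟩ h
    obtain ⟨h1, h2⟩ := List.append_inj' h rfl
    simp only [List.cons.injEq, Prod.mk.injEq, and_true] at h2
    exact Prod.ext h1 (Prod.ext h2.2.1 h2.2.2)
  refine le_trans ?_ (ENNReal.tsum_comp_le_tsum_of_injective hι F)
  rw [ENNReal.tsum_prod', ← Summable.tsum_finsetSum fun _ _ => ENNReal.summable]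
  refine ENNReal.tsum_le_tsum fun l => ?_
  rw [ENNReal.tsum_prod', ← Summable.tsum_finsetSum fun _ _ => ENNReal.summable]
  refine ENNReal.tsum_le_tsum fun i => ?_
  rw [← Summable.tsum_finsetSum fun _ _ => ENNReal.summable]
  refine ENNReal.tsum_le_tsum fun j => ?_
  rw [← Finset.sum_mul]
  by_cases hj : j ∈ Λ
  · simp [out, hj]
  by_cases hQ : ∃ G, Q G a i l
  · obtain ⟨G, haD, hiD, hl, hnd⟩ := hQ
    have hlD : ∀ it ∈ l, it.2.1 ∈ D := fun it hit => (hl.rel it hit).1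
    have hpres : ChainPresent p (ι (l, i, j)) := by
      refine ⟨by simpa [ι] using hnd, fun N hN => ?_⟩
      simp only [ι, List.map_append, List.map_cons, List.map_nil, List.mem_append,
        List.mem_singleton] at hN
      rcases hN with hN | rfl
      · obtain ⟨it, hit, rfl⟩ := List.mem_map.mp hN
        rw [← hl.node_eq it hit]
        exact (hnode _ (hlD it hit)).2
      · exact (hnode _ hiD).2
    have hF : F (ι (l, i, j)) = (l.map fun it => linkBound s β it.2.1 it.2.2).prod *
        linkBound s β i j := by
      have h2 : chainEnd a (ι (l, i, j)) ∉ Λ := by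
        simp only [ι]; rw [chainEnd_append]; exact hj
      simp only [F]
      rw [if_pos ⟨h2, hpres⟩]
      exact hl.chainWeight_eq hnode' hiD j haD
    rw [hF]
    simp only [out]
    rw [if_neg hj]
    gcongr
    refine sum_bondProb_links_le hβ p (hl.nodup_bonds hnd) (fun it hit => ?_) (fun G => Q G a i l)
      fun G hG it hit => (hG.2.2.1.rel it hit).2.2
    have h3 := hl.rel it hit
    exact ⟨(mem_diffSet.mp h3.1).1, (mem_diffSet.mp h3.2.1).1⟩
  · have : ∀ G, ¬Q G a i l := fun G h => hQ ⟨G, h⟩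
    simp [this]

lemma measurableSet_pick_isContour (N : Node d) :
    MeasurableSet {p : Config d × Config d | IsContour (pick N.1 p) N.2} := by
  obtain ⟨c, A⟩ := N
  cases c
  · exact measurable_fst (measurableSet_isContour A)
  · exact measurable_snd (measurableSet_isContour A)

/-- The Peierls estimate for contours of two independent configurations. -/
lemma prod_measure_contours_le (hd : 0 < d) {s : ℝ} (hs : (d : ℝ) + 1 < s) {J β : ℝ} (hJ : 0 ≤ J)
    (hβ : 0 ≤ β) {μ ν : Measure (Config d)} [IsProbabilityMeasure μ] [IsProbabilityMeasure ν]
    (hμ : FlipInvariant s J β μ) (hν : FlipInvariant s J β ν) (𝓝s : Finset (Node d)) :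
    μ.prod ν {p | ∀ N ∈ 𝓝s, IsContour (pick N.1 p) N.2} ≤
      ∏ N ∈ 𝓝s, peierlsWeight d s J β ^ (edgeBoundary N.2).card := by
  classical
  let 𝓐 : Bool → Finset (Finset (Site d)) := fun c => (𝓝s.filter fun N => N.1 = c).image Prod.snd
  have h1 : {p : Config d × Config d | ∀ N ∈ 𝓝s, IsContour (pick N.1 p) N.2} =
      {σ | ∀ A ∈ 𝓐 false, IsContour σ A} ×ˢ {σ | ∀ A ∈ 𝓐 true, IsContour σ A} := by
    ext p
    simp only [Set.mem_ofPred_eq, Set.mem_prod, 𝓐, Finset.mem_image, Finset.mem_filter]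
    constructor
    · intro h
      constructor
      · rintro A ⟨⟨c, A'⟩, ⟨hN, rfl⟩, rfl⟩
        exact h _ hN
      · rintro A ⟨⟨c, A'⟩, ⟨hN, rfl⟩, rfl⟩
        exact h _ hN
    · rintro ⟨h0, h1⟩ ⟨c, A⟩ hN
      cases c
      · exact h0 A ⟨_, ⟨hN, rfl⟩, rfl⟩
      · exact h1 A ⟨_, ⟨hN, rfl⟩, rfl⟩
  have h2 : ∀ c, ∏ A ∈ 𝓐 c, peierlsWeight d s J β ^ (edgeBoundary A).card =
      ∏ N ∈ 𝓝s.filter (fun N => N.1 = c), peierlsWeight d s J β ^ (edgeBoundary N.2).card := by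
    intro c
    refine Finset.prod_image fun N hN N' hN' h => ?_
    exact Prod.ext ((Finset.mem_filter.mp hN).2.trans (Finset.mem_filter.mp hN').2.symm) h
  rw [h1, Measure.prod_prod]
  refine (mul_le_mul' (measure_contours_le hd hs hJ hβ hμ _)
    (measure_contours_le hd hs hJ hβ hν _)).trans (le_of_eq ?_)
  rw [h2, h2, ← Finset.prod_filter_mul_prod_filter_not 𝓝s fun N => N.1 = false]
  congr 2
  ext N
  simp

lemma chainWeight_mul_prod_le (x : ENNReal) (k : Site d → Site d → ENNReal) (a : Site d)
    (l : List (Item d)) : chainWeight 1 k a l *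
      (l.map fun it => x ^ (edgeBoundary it.1.2).card).prod = chainWeight x k a l := by
  induction l generalizing a with
  | nil => simp [chainWeight]
  | cons it l ih =>
    rw [chainWeight, chainWeight, List.map_cons, List.prod_cons, mul_mul_mul_comm, ih]
    congr 1
    unfold itemWeight
    split_ifs
    · rw [one_pow, one_mul, mul_comm]
    · rw [zero_mul]

lemma measurableSet_chainPresent (l : List (Item d)) :
    MeasurableSet {p : Config d × Config d | ChainPresent p l} := by
  have : {p : Config d × Config d | ChainPresent p l} = {_p | (l.map Prod.fst).Nodup} ∩
      ⋂ N ∈ (l.map Prod.fst).toFinset, {p | IsContour (pick N.1 p) N.2} := by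
    ext p
    simp only [ChainPresent, Set.mem_ofPred_eq, Set.mem_inter_iff, Set.mem_iInter,
      List.mem_toFinset]
  rw [this]
  exact (MeasurableSet.const _).inter
    (Finset.measurableSet_biInter _ fun N _ => measurableSet_pick_isContour N)

-- `ChainPresent` demands distinct contours, so the Peierls estimate multiplies over the steps and
-- supplies the factors `x ^ |∂A|` missing from the weight with parameter 1.
open Classical in
lemma lintegral_chain_le (hd : 0 < d) {s : ℝ} (hs : (d : ℝ) + 1 < s) {J β : ℝ} (hJ : 0 ≤ J)
    (hβ : 0 ≤ β) {μ ν : Measure (Config d)} [IsProbabilityMeasure μ] [IsProbabilityMeasure ν]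
    (hμ : FlipInvariant s J β μ) (hν : FlipInvariant s J β ν) (Λ : Finset (Site d))
    (k : Site d → Site d → ENNReal) (a : Site d) (l : List (Item d)) :
    ∫⁻ p, (if chainEnd a l ∉ Λ ∧ ChainPresent p l then chainWeight 1 k a l else 0) ∂(μ.prod ν) ≤
      if chainEnd a l ∉ Λ then chainWeight (peierlsWeight d s J β) k a l else 0 := by
  by_cases hΛ : chainEnd a l ∈ Λ
  · simp [hΛ]
  have h1 : ∀ p : Config d × Config d, (if chainEnd a l ∉ Λ ∧ ChainPresent p l then
      chainWeight 1 k a l else 0) =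
      {p | ChainPresent p l}.indicator (fun _ => chainWeight 1 k a l) p := by
    intro p
    by_cases h : ChainPresent p l
    · rw [if_pos ⟨hΛ, h⟩, Set.indicator_of_mem (show p ∈ {p | ChainPresent p l} from h)]
    · rw [if_neg fun hc => h hc.2,
        Set.indicator_of_notMem (show p ∉ {p | ChainPresent p l} from h)]
  rw [lintegral_congr h1, lintegral_indicator_const (measurableSet_chainPresent l), if_pos hΛ]
  by_cases hnd : (l.map Prod.fst).Nodup
  · rw [← chainWeight_mul_prod_le (peierlsWeight d s J β)]
    gcongr
    have h2 := prod_measure_contours_le hd hs hJ hβ hμ hν (l.map Prod.fst).toFinset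
    rw [List.prod_toFinset _ hnd, List.map_map] at h2
    refine le_trans (measure_mono ?_) h2
    intro p hp N hN
    exact hp.2 N (List.mem_toFinset.mp hN)
  · have : {p : Config d × Config d | ChainPresent p l} = ∅ := by
      ext p
      simp only [Set.mem_ofPred_eq, Set.mem_empty_iff_false, iff_false]
      exact fun h => hnd h.1
    simp [this]

lemma ae_prod_exists_contour {μ ν : Measure (Config d)} [IsProbabilityMeasure μ]
    [IsProbabilityMeasure ν] (hμ : Enclosed μ) (hν : Enclosed ν) :
    ∀ᵐ p ∂(μ.prod ν), ∀ c v, pick c p v = -1 → ∃ A, v ∈ A ∧ IsContour (pick c p) A := by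
  rw [ae_all_iff]
  intro c
  rw [ae_all_iff]
  intro v
  cases c
  · exact Measure.quasiMeasurePreserving_fst.ae (hμ v)
  · exact Measure.quasiMeasurePreserving_snd.ae (hν v)

/-- Two flip invariant measures with enclosed minus spins give local functions nearly the same
integral. -/
lemma lintegral_le_of_enclosed (hd : 0 < d) {s : ℝ} (hs : (d : ℝ) + 1 < s) {J β : ℝ} (hJ : 0 ≤ J)
    (hβ : 0 ≤ β) {μ ν : Measure (Config d)} [IsProbabilityMeasure μ] [IsProbabilityMeasure ν]
    (hμ : FlipInvariant s J β μ) (hν : FlipInvariant s J β ν) (hμe : Enclosed μ) (hνe : Enclosed ν)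
    (hsmall : ∀ a : Site d, ∑' it, itemWeight (peierlsWeight d s J β) (linkBound s β) a it ≤ 1 / 2)
    (B : Finset (Site d)) (f : Config d → ENNReal) (hf : Measurable f) (hf1 : ∀ σ, f σ ≤ 1)
    (hfB : ∀ σ σ' : Config d, (∀ i ∈ B, σ i = σ' i) → f σ = f σ') :
    ∫⁻ σ, f σ ∂μ ≤ ∫⁻ σ, f σ ∂ν := by
  classical
  refine ENNReal.le_of_forall_pos_le_add fun ε hε _ => ?_
  obtain ⟨L, hBL, hL⟩ := exists_box_tsum_chainWeight_lt (peierlsWeight d s J β) (linkBound s β)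
    hsmall B (ε := ε) (by exact_mod_cast hε)
  set Λ := box d L
  let H : Config d × Config d → ENNReal := fun p => ∑ a ∈ B, ∑' l,
    (if chainEnd a l ∉ Λ ∧ ChainPresent p l then chainWeight 1 (linkBound s β) a l else 0)
  let W : Config d × Config d → ENNReal := fun p =>
    ∑ G ∈ Λ.sym2.powerset, ∑ D ∈ Λ.powerset, fkWeight s β Λ B D G p
  have hterm : ∀ a l, Measurable fun p : Config d × Config d =>
      (if chainEnd a l ∉ Λ ∧ ChainPresent p l then chainWeight 1 (linkBound s β) a l else 0) :=
    fun a l => Measurable.ite ((MeasurableSet.const _).inter (measurableSet_chainPresent l))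
      measurable_const measurable_const
  have hH : ∫⁻ p, H p ∂(μ.prod ν) ≤ ε := by
    refine le_trans ?_ hL.le
    simp only [H]
    rw [lintegral_finsetSum _ fun a _ => Measurable.tsum fun l => hterm a l]
    refine Finset.sum_le_sum fun a _ => ?_
    rw [lintegral_tsum fun l => (hterm a l).aemeasurable]
    exact ENNReal.tsum_le_tsum fun l => lintegral_chain_le hd hs hJ hβ hμ hν Λ _ a l
  have hWm : ∀ G D, Measurable (fkWeight s β Λ B D G) := fun G D => measurable_fkWeight hs hβ Λ B D G
  -- Exchangeability holds for each set of differing sites and each set of open bonds separately,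
  -- since then the flipped cluster is deterministic.
  have hswap : ∫⁻ p, f p.1 * W p ∂(μ.prod ν) = ∫⁻ p, f p.2 * W p ∂(μ.prod ν) := by
    have hexp : ∀ π : Config d × Config d → Config d, Measurable π →
        ∫⁻ p, f (π p) * W p ∂(μ.prod ν) = ∑ G ∈ Λ.sym2.powerset, ∑ D ∈ Λ.powerset,
          ∫⁻ p, f (π p) * fkWeight s β Λ B D G p ∂(μ.prod ν) := by
      intro π hπ
      have hm : ∀ G D, Measurable fun p => f (π p) * fkWeight s β Λ B D G p :=
        fun G D => (hf.comp hπ).mul (hWm G D)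
      simp only [W, Finset.mul_sum]
      rw [lintegral_finsetSum _ fun G _ => Finset.measurable_fun_sum _ fun D _ => hm G D]
      refine Finset.sum_congr rfl fun G _ => ?_
      rw [lintegral_finsetSum _ fun D _ => hm G D]
    rw [hexp _ measurable_fst, hexp _ measurable_snd]
    refine Finset.sum_congr rfl fun G hG => Finset.sum_congr rfl fun D _ => ?_
    exact lintegral_mul_fkWeight hs hβ hμ hν hBL (Finset.mem_powerset.mp hG) f hf hfB
  have hWmeas : Measurable W := Finset.measurable_fun_sum _ fun G _ =>
    Finset.measurable_fun_sum _ fun D _ => hWm G D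
  calc ∫⁻ σ, f σ ∂μ = ∫⁻ p, f p.1 ∂(μ.prod ν) := (measurePreserving_fst.lintegral_comp hf).symm
    _ ≤ ∫⁻ p, (f p.1 * W p + H p) ∂(μ.prod ν) := by
        refine lintegral_mono_ae ?_
        filter_upwards [ae_prod_exists_contour hμe hνe] with p hp
        have h1 := (one_le_sum_fkWeight_add hs hβ Λ B p).trans
          (add_le_add le_rfl (sum_escape_le hβ hp Λ B))
        calc f p.1 = f p.1 * 1 := (mul_one _).symm
          _ ≤ f p.1 * (W p + H p) := by gcongr
          _ = f p.1 * W p + f p.1 * H p := mul_add _ _ _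
          _ ≤ f p.1 * W p + H p := by
              gcongr
              exact mul_le_of_le_one_left' (hf1 _)
    _ = ∫⁻ p, f p.2 * W p ∂(μ.prod ν) + ∫⁻ p, H p ∂(μ.prod ν) := by
        rw [← hswap]
        exact lintegral_add_left ((hf.comp measurable_fst).mul hWmeas) H
    _ ≤ ∫⁻ σ, f σ ∂ν + ε := by
        gcongr
        calc ∫⁻ p, f p.2 * W p ∂(μ.prod ν) ≤ ∫⁻ p, f p.2 ∂(μ.prod ν) :=
              lintegral_mono fun p => mul_le_of_le_one_right' (sum_fkWeight_le_one hβ s Λ B p)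
          _ = ∫⁻ σ, f σ ∂ν := measurePreserving_snd.lintegral_comp hf

/-- Uniqueness of the flip invariant measure whose minus spins are enclosed by contours. -/
theorem eq_of_enclosed (hd : 0 < d) {s : ℝ} (hs : (d : ℝ) + 1 < s) {J β : ℝ} (hJ : 0 ≤ J)
    (hβ : 0 ≤ β) {μ ν : Measure (Config d)} [IsProbabilityMeasure μ] [IsProbabilityMeasure ν]
    (hμ : FlipInvariant s J β μ) (hν : FlipInvariant s J β ν) (hμe : Enclosed μ) (hνe : Enclosed ν)
    (hsmall : ∀ a : Site d, ∑' it, itemWeight (peierlsWeight d s J β) (linkBound s β) a it ≤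
      1 / 2) : μ = ν := by
  refine ext_of_generate_finite (measurableCylinders fun _ : Site d => ℤˣ)
    generateFrom_measurableCylinders.symm isPiSystem_measurableCylinders ?_ (by simp)
  intro S hS
  obtain ⟨B, S', hS', rfl⟩ := (mem_measurableCylinders _).mp hS
  have hm : MeasurableSet (cylinder (α := fun _ : Site d => ℤˣ) B S') := hS'.cylinder
  have hfB : ∀ σ σ' : Config d, (∀ i ∈ B, σ i = σ' i) →
      (cylinder B S').indicator (1 : Config d → ENNReal) σ =
      (cylinder B S').indicator (1 : Config d → ENNReal) σ' := by
    intro σ σ' h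
    have h1 : B.restrict σ = B.restrict σ' := funext fun i => h i i.2
    have h2 : σ ∈ cylinder B S' ↔ σ' ∈ cylinder B S' := by
      rw [mem_cylinder, mem_cylinder, h1]
    by_cases h3 : σ ∈ cylinder B S'
    · rw [Set.indicator_of_mem h3, Set.indicator_of_mem (h2.mp h3)]; rfl
    · rw [Set.indicator_of_notMem h3, Set.indicator_of_notMem fun hc => h3 (h2.mpr hc)]
  have hle : ∀ σ : Config d, (cylinder B S').indicator (1 : Config d → ENNReal) σ ≤ 1 :=
    fun σ => Set.indicator_le_self' (fun _ _ => zero_le_one) σ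
  rw [← lintegral_indicator_one hm, ← lintegral_indicator_one hm]
  exact le_antisymm
    (lintegral_le_of_enclosed hd hs hJ hβ hμ hν hμe hνe hsmall B _ (measurable_one.indicator hm)
      hle hfB)
    (lintegral_le_of_enclosed hd hs hJ hβ hν hμ hνe hμe hsmall B _ (measurable_one.indicator hm)
      hle hfB)

end Uniqueness

/-! ### Finite-volume plus measures. -/

section FiniteVolume

variable {d : ℕ}

/-- The Gibbs measure in `Λ` with boundary condition `η`. -/
def finiteGibbs (s J β : ℝ) (Λ : Finset (Site d)) (η : Config d) : Measure (Config d) :=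
  ∑ τ : Λ → ℤˣ, ENNReal.ofReal (gibbsKernel s J β Λ τ η) • Measure.dirac (glue Λ τ η)

lemma lintegral_finiteGibbs (s J β : ℝ) (Λ : Finset (Site d)) (η : Config d)
    {g : Config d → ENNReal} (hg : Measurable g) : ∫⁻ σ, g σ ∂(finiteGibbs s J β Λ η) =
      ∑ τ : Λ → ℤˣ, ENNReal.ofReal (gibbsKernel s J β Λ τ η) * g (glue Λ τ η) := by
  unfold finiteGibbs
  rw [lintegral_finsetSum_measure]
  refine Finset.sum_congr rfl fun τ _ => ?_
  rw [lintegral_smul_measure, lintegral_dirac' _ hg, smul_eq_mul]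

lemma integral_finiteGibbs (s J β : ℝ) (Λ : Finset (Site d)) (η : Config d)
    (g : Config d → ℝ) (hg : StronglyMeasurable g) : ∫ σ, g σ ∂(finiteGibbs s J β Λ η) =
      ∑ τ : Λ → ℤˣ, gibbsKernel s J β Λ τ η * g (glue Λ τ η) := by
  unfold finiteGibbs
  rw [integral_finsetSum_measure fun τ _ => ?_]
  · refine Finset.sum_congr rfl fun τ _ => ?_
    rw [integral_smul_measure, integral_dirac' _ _ hg, smul_eq_mul,
      ENNReal.toReal_ofReal (gibbsKernel_pos _ _ _ _ _ _).le]
  · refine Integrable.smul_measure ?_ ENNReal.ofReal_ne_top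
    exact ⟨hg.aestronglyMeasurable, by
      simp [HasFiniteIntegral, lintegral_dirac' _ hg.measurable.enorm]⟩

instance instIsProbabilityMeasureFiniteGibbs (s J β : ℝ) (Λ : Finset (Site d)) (η : Config d) :
    IsProbabilityMeasure (finiteGibbs s J β Λ η) := ⟨by
  rw [← lintegral_one, lintegral_finiteGibbs _ _ _ _ _ measurable_const]
  simp only [mul_one]
  rw [← ENNReal.ofReal_sum_of_nonneg fun τ _ => (gibbsKernel_pos _ _ _ _ _ _).le, sum_gibbsKernel,
    ENNReal.ofReal_one]⟩

lemma ae_finiteGibbs_eq (s J β : ℝ) (Λ : Finset (Site d)) (η : Config d) :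
    ∀ᵐ σ ∂(finiteGibbs s J β Λ η), ∀ i, i ∉ Λ → σ i = η i := by
  rw [ae_all_iff]
  intro i
  by_cases hi : i ∈ Λ
  · simp [hi]
  have hm : MeasurableSet {σ : Config d | σ i ≠ η i} := by
    have h1 : Measurable fun σ : Config d => σ i := measurable_pi_apply i
    exact h1 (MeasurableSet.of_discrete (s := {u : ℤˣ | u ≠ η i}))
  have h : finiteGibbs s J β Λ η {σ : Config d | σ i ≠ η i} = 0 := by
    rw [← lintegral_indicator_one hm, lintegral_finiteGibbs _ _ _ _ _ (measurable_one.indicator hm)]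
    refine Finset.sum_eq_zero fun τ _ => ?_
    rw [Set.indicator_of_notMem, mul_zero]
    simp [glue_of_notMem hi]
  rw [ae_iff]
  refine measure_mono_null (fun σ hσ => ?_) h
  intro hc
  exact hσ fun _ => hc

/-- Flipping `T` permutes the atoms of the measure. This requires `T ⊆ Λ`, so full flip invariance
appears only in the limit. -/
lemma finiteGibbs_flipIdentity {s : ℝ} (hs : (d : ℝ) + 1 < s) (J β : ℝ) {T Λ : Finset (Site d)}
    (hT : T ⊆ Λ) (η : Config d) : FlipIdentity s J β (finiteGibbs s J β Λ η) T := by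
  intro g hg
  have he : Measurable fun σ : Config d => ENNReal.ofReal (Real.exp (-β * flipEnergy s J T σ)) :=
    ((measurable_flipEnergy hs J T).const_mul _).exp.ennreal_ofReal
  have hgf : Measurable fun σ => g (flipSet T σ) := hg.comp (measurable_flipSet T)
  have hge : Measurable fun σ => g σ *
      ENNReal.ofReal (Real.exp (-β * flipEnergy s J T σ)) := hg.mul he
  rw [lintegral_finiteGibbs _ _ _ _ _ hgf, lintegral_finiteGibbs _ _ _ _ _ hge]
  let r : (Λ → ℤˣ) → Λ → ℤˣ := fun τ i => flipSet T (glue Λ τ η) i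
  have hr : ∀ τ, glue Λ (r τ) η = flipSet T (glue Λ τ η) := by
    intro τ
    funext i
    by_cases hi : i ∈ Λ
    · rw [glue_of_mem hi]
    · rw [glue_of_notMem hi, flipSet_of_notMem fun h => hi (hT h), glue_of_notMem hi]
  have hrr : Function.Involutive r := by
    intro τ
    funext i
    change flipSet T (glue Λ (r τ) η) i = τ i
    rw [hr, flipSet_flipSet, glue_of_mem i.2]
  rw [← Equiv.sum_comp (hrr.toPerm r)]
  refine Finset.sum_congr rfl fun τ _ => ?_
  simp only [Function.Involutive.coe_toPerm]
  rw [hr, flipSet_flipSet, gibbsKernel, hr, boltzmann_flipSet hs J β hT, mul_div_right_comm,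
    ← gibbsKernel, ENNReal.ofReal_mul (gibbsKernel_pos _ _ _ _ _ _).le]
  ring

/-- The event that the spin at `v` is minus and that no contour in `𝓕` surrounds `v`. -/
def unenclosed (v : Site d) (𝓕 : Finset (Finset (Site d))) : Set (Config d) :=
  {σ | σ v = -1} ∩ ⋂ A ∈ 𝓕.filter (v ∈ ·), {σ | IsContour σ A}ᶜ

lemma isClopen_unenclosed (v : Site d) (𝓕 : Finset (Finset (Site d))) :
    IsClopen (unenclosed v 𝓕) :=
  ((isClopen_discrete {(-1 : ℤˣ)}).preimage (continuous_apply v)).inter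
    (isClopen_biInter_finset fun A _ => (isClopen_isContour A).compl)

open Classical in
/-- The part of `contourSum` that comes from sets outside `𝓕`. -/
def contourTail (x : ENNReal) (v : Site d) (𝓕 : Finset (Finset (Site d))) : ENNReal :=
  ∑' A : Finset (Site d), if A ∉ 𝓕 ∧ v ∈ A ∧ EdgeConnected (edgeBoundary A) then
    (A.card : ENNReal) * x ^ (edgeBoundary A).card else 0

lemma contourTail_empty (x : ENNReal) (v : Site d) : contourTail x v ∅ = contourSum x v := by
  classical
  exact tsum_congr fun A => by simp only [Finset.notMem_empty, not_false_eq_true, true_and]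

lemma tendsto_contourTail {x : ENNReal} {v : Site d} (h : contourSum x v ≠ ⊤) :
    Tendsto (contourTail x v) atTop (𝓝 0) := by
  classical
  refine (ENNReal.tendsto_tsum_compl_atTop_zero h).congr fun 𝓕 => ?_
  refine (tsum_subtype {A | A ∉ 𝓕} fun A : Finset (Site d) =>
    if v ∈ A ∧ EdgeConnected (edgeBoundary A) then
      (A.card : ENNReal) * x ^ (edgeBoundary A).card else 0).trans ?_
  refine tsum_congr fun A => ?_
  by_cases hA : A ∈ 𝓕
  · rw [Set.indicator_of_notMem (by simpa using hA), if_neg fun h => h.1 hA]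
  · rw [Set.indicator_of_mem (by simpa using hA)]
    simp [hA]

/-- The bound is uniform in `L`. Empty `𝓕` controls the probability of a minus spin; growing `𝓕`
shows that in the limit no minus spin loses its contour to infinity. -/
lemma finiteGibbs_unenclosed_le (hd : 2 ≤ d) {s : ℝ} (hs : (d : ℝ) + 1 < s) {J β : ℝ} (hJ : 0 ≤ J)
    (hβ : 0 ≤ β) (L : ℕ) (v : Site d) (𝓕 : Finset (Finset (Site d))) :
    finiteGibbs s J β (box d L) (fun _ => 1) (unenclosed v 𝓕) ≤
      contourTail (peierlsWeight d s J β) v 𝓕 := by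
  classical
  set μ := finiteGibbs s J β (box d L) (fun _ : Site d => (1 : ℤˣ))
  let 𝓢 := (box d L).powerset.filter fun A => A ∉ 𝓕 ∧ v ∈ A ∧ EdgeConnected (edgeBoundary A)
  have h1 : unenclosed v 𝓕 ≤ᵐ[μ] ⋃ A ∈ 𝓢, {σ : Config d | IsContour σ A} := by
    filter_upwards [ae_finiteGibbs_eq s J β (box d L) fun _ => 1] with σ hσ hE
    obtain ⟨A, hAL, hvA, hA⟩ := exists_contour_of_minus hd hσ hE.1
    have hE2 := hE.2
    simp only [Set.mem_iInter, Finset.mem_filter] at hE2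
    refine Set.mem_biUnion (x := A) ?_ hA
    simp only [𝓢, Finset.coe_filter, Finset.mem_powerset, Set.mem_ofPred_eq]
    exact ⟨hAL, fun hc => hE2 A ⟨hc, hvA⟩ hA, hvA, hA.connected⟩
  refine (measure_mono_ae h1).trans ((measure_biUnion_finset_le _ _).trans ?_)
  refine le_trans (Finset.sum_le_sum fun A hA => ?_) (ENNReal.sum_le_tsum 𝓢)
  obtain ⟨hAL, hA⟩ := Finset.mem_filter.mp hA
  rw [if_pos hA]
  refine (measure_le_peierlsWeight_pow hs hJ hβ (finiteGibbs_flipIdentity hs J β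
    (Finset.mem_powerset.mp hAL) _) (measurableSet_isContour A)
    fun σ hσ e he => hσ.subset e he).trans ?_
  -- The factor `|A|`, needed only for chains, is at least one because `v ∈ A`.
  refine le_mul_of_one_le_left' ?_
  exact_mod_cast Finset.card_pos.mpr ⟨v, hA.2.1⟩

end FiniteVolume

/-! ### The infinite-volume plus state. -/

section InfiniteVolume

variable {d : ℕ}

lemma integral_spin_eq (μ : Measure (Config d)) [IsProbabilityMeasure μ] (v : Site d) :
    ∫ σ, spin σ v ∂μ = 1 - 2 * μ.real (unenclosed v ∅) := by
  have hm : MeasurableSet (unenclosed v ∅) := (isClopen_unenclosed v ∅).2.measurableSet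
  have h : ∀ σ : Config d, spin σ v = 1 - 2 * (unenclosed v ∅).indicator (fun _ => (1 : ℝ)) σ := by
    intro σ
    unfold spin
    rcases Int.units_eq_one_or (σ v) with h | h
    · rw [Set.indicator_of_notMem (by simp [unenclosed, h])]
      simp [h]
    · rw [Set.indicator_of_mem (by simp [unenclosed, h])]
      simp [h]
      norm_num
  have hint : Integrable ((unenclosed v ∅).indicator (fun _ => (1 : ℝ))) μ :=
    (integrable_const _).indicator hm
  rw [integral_congr_ae (Eventually.of_forall h), integral_sub (integrable_const _)
    (hint.const_mul 2), integral_const_mul, integral_indicator_const _ hm]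
  simp

lemma le_integral_spin {μ : Measure (Config d)} [IsProbabilityMeasure μ] {v : Site d}
    (h : μ (unenclosed v ∅) ≤ ENNReal.ofReal (1 / 4)) : 1 / 2 ≤ ∫ σ, spin σ v ∂μ := by
  rw [integral_spin_eq]
  have : μ.real (unenclosed v ∅) ≤ 1 / 4 :=
    ENNReal.toReal_le_of_le_ofReal (by norm_num) h
  linarith

/-- The flip and its density are continuous on a compact space, so the identity for each `T` passes
to weak limits. -/
lemma flipInvariant_of_tendsto {s : ℝ} (hs : (d : ℝ) + 1 < s) {J β : ℝ} {ι : Type*} {F : Filter ι}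
    [F.NeBot] {μs : ι → ProbabilityMeasure (Config d)} {μ : ProbabilityMeasure (Config d)}
    (hμ : Tendsto μs F (𝓝 μ))
    (h : ∀ T, ∀ᶠ n in F, FlipIdentity s J β (μs n : Measure (Config d)) T) :
    FlipInvariant s J β (μ : Measure (Config d)) := by
  intro T
  have hcE := continuous_flipEnergy hs J T
  let w : Config d → ℝ≥0 := fun σ => Real.toNNReal (Real.exp (-β * flipEnergy s J T σ))
  have hw : Continuous w := continuous_real_toNNReal.comp
    (Real.continuous_exp.comp (continuous_const.mul hcE))
  have hwm : Measurable fun σ => (w σ : ENNReal) := hw.measurable.coe_nnreal_ennreal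
  have key : (μ : Measure (Config d)).map (flipSet T) =
      (μ : Measure (Config d)).withDensity fun σ => (w σ : ENNReal) := by
    have : IsProbabilityMeasure ((μ : Measure (Config d)).map (flipSet T)) :=
      Measure.isProbabilityMeasure_map (measurable_flipSet T).aemeasurable
    refine ext_of_forall_lintegral_eq_of_IsFiniteMeasure fun f => ?_
    have hfm : Measurable fun σ => (f σ : ENNReal) := f.continuous.measurable.coe_nnreal_ennreal
    rw [lintegral_map hfm (measurable_flipSet T),
      lintegral_withDensity_eq_lintegral_mul _ hwm hfm]
    let f1 : BoundedContinuousFunction (Config d) ℝ≥0 :=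
      BoundedContinuousFunction.mkOfCompact ⟨fun σ => f (flipSet T σ),
        f.continuous.comp (continuous_flipSet T)⟩
    let f2 : BoundedContinuousFunction (Config d) ℝ≥0 :=
      BoundedContinuousFunction.mkOfCompact ⟨fun σ => w σ * f σ, hw.mul f.continuous⟩
    have h1 := (ProbabilityMeasure.tendsto_iff_forall_lintegral_tendsto.mp hμ) f1
    have h2 := (ProbabilityMeasure.tendsto_iff_forall_lintegral_tendsto.mp hμ) f2
    have h3 : ∀ σ, (f1 σ : ENNReal) = f (flipSet T σ) := fun _ => rfl
    have h4 : ∀ σ, (f2 σ : ENNReal) = ((fun σ => (w σ : ENNReal)) * fun σ => (f σ : ENNReal)) σ :=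
      fun σ => by
        change ((w σ * f σ : ℝ≥0) : ENNReal) = _
        rw [ENNReal.coe_mul]; rfl
    simp only [h3] at h1
    simp only [h4] at h2
    refine tendsto_nhds_unique_of_eventuallyEq h1 h2 ?_
    filter_upwards [h T] with n hn
    rw [hn _ hfm]
    refine lintegral_congr fun σ => ?_
    exact mul_comm _ _
  intro g hg
  rw [← lintegral_map hg (measurable_flipSet T), key,
    lintegral_withDensity_eq_lintegral_mul _ hwm hg]
  refine lintegral_congr fun σ => ?_
  exact mul_comm _ _

/-- Existence of an infinite volume state dominated by plus spins. -/
theorem exists_plus_state (hd : 2 ≤ d) {s : ℝ} (hs : (d : ℝ) + 1 < s) {J β : ℝ} (hJ : 0 ≤ J)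
    (hβ : 0 ≤ β) (hsmall : ∀ v : Site d, contourSum (peierlsWeight d s J β) v ≤
      ENNReal.ofReal (1 / 4)) :
    ∃ μ : Measure (Config d), IsProbabilityMeasure μ ∧ FlipInvariant s J β μ ∧ Enclosed μ ∧
      ∀ v, 1 / 2 ≤ ∫ σ, spin σ v ∂μ := by
  let μs : ℕ → ProbabilityMeasure (Config d) := fun L =>
    ⟨finiteGibbs s J β (box d L) fun _ => 1, inferInstance⟩
  let 𝓤 : Ultrafilter ℕ := Ultrafilter.of atTop
  have h𝓤 : (𝓤 : Filter ℕ) ≤ atTop := Ultrafilter.of_le atTop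
  obtain ⟨μ, hμ⟩ : ∃ μ : ProbabilityMeasure (Config d), Tendsto μs 𝓤 (𝓝 μ) := by
    obtain ⟨μ, -, hμ⟩ := isCompact_univ.ultrafilter_le_nhds' (𝓤.map μs) univ_mem
    exact ⟨μ, hμ⟩
  have hle : ∀ v 𝓕, (μ : Measure (Config d)) (unenclosed v 𝓕) ≤
      contourTail (peierlsWeight d s J β) v 𝓕 := by
    intro v 𝓕
    -- The event is clopen, so its frontier is empty and its probability converges.
    have h1 := ProbabilityMeasure.tendsto_measure_of_null_frontier_of_tendsto' hμ
      (E := unenclosed v 𝓕) (by rw [(isClopen_unenclosed v 𝓕).frontier_eq]; simp)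
    exact le_of_tendsto h1 (Eventually.of_forall fun L =>
      finiteGibbs_unenclosed_le hd hs hJ hβ L v 𝓕)
  refine ⟨μ, inferInstance, ?_, fun v => ?_, fun v => ?_⟩
  · refine flipInvariant_of_tendsto hs hμ fun T => h𝓤 ?_
    obtain ⟨L, hL⟩ := exists_box_superset T
    filter_upwards [eventually_ge_atTop L] with n hn
    refine finiteGibbs_flipIdentity hs J β (hL.trans ?_) _
    refine Finset.Icc_subset_Icc ?_ ?_
    · intro i; simpa using hn
    · intro i; simpa using hn
  · have htop : contourSum (peierlsWeight d s J β) v ≠ ⊤ :=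
      ne_top_of_le_ne_top ENNReal.ofReal_ne_top (hsmall v)
    rw [ae_iff]
    -- An unenclosed minus spin lies in `unenclosed v 𝓕` for every `𝓕`, and the tails tend to zero.
    refine le_antisymm (ge_of_tendsto' (tendsto_contourTail htop) fun 𝓕 =>
      (measure_mono ?_).trans (hle v 𝓕)) zero_le
    intro σ hσ
    simp only [Set.mem_ofPred_eq, not_forall, not_exists, not_and] at hσ
    obtain ⟨h1, h2⟩ := hσ
    refine ⟨h1, ?_⟩
    simp only [Set.mem_iInter, Finset.mem_filter]
    exact fun A hA => h2 A hA.2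
  · refine le_integral_spin ((hle v ∅).trans ?_)
    rw [contourTail_empty]
    exact hsmall v

end InfiniteVolume

/-! ### Convergence of box averages of nearly additive set functions. -/

section BoxAverages

variable {d : ℕ}

/-- The translate of a finite set of sites. -/
def shift (a : Site d) (A : Finset (Site d)) : Finset (Site d) := A.map (Equiv.addRight a).toEmbedding

lemma mem_shift {a : Site d} {A : Finset (Site d)} {x : Site d} : x ∈ shift a A ↔ x - a ∈ A := by
  simp only [shift, Finset.mem_map_equiv, Equiv.addRight_symm, Equiv.coe_addRight, sub_eq_add_neg]

lemma card_shift (a : Site d) (A : Finset (Site d)) : (shift a A).card = A.card :=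
  Finset.card_map _

lemma edgeBoundary_shift (a : Site d) (A : Finset (Site d)) : edgeBoundary (shift a A) =
    (edgeBoundary A).map ((Equiv.addRight a).prodCongr (Equiv.refl (Fin d))).toEmbedding := by
  ext ⟨x, k⟩
  rw [Finset.mem_map_equiv, mem_edgeBoundary, mem_edgeBoundary, mem_shift, mem_shift]
  simp only [Equiv.prodCongr_symm, Equiv.prodCongr_apply, Prod.map, Equiv.addRight_symm,
    Equiv.coe_addRight, Equiv.refl_symm, Equiv.coe_refl, id, sub_eq_add_neg, add_right_comm]

lemma card_edgeBoundary_shift (a : Site d) (A : Finset (Site d)) :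
    (edgeBoundary (shift a A)).card = (edgeBoundary A).card := by
  rw [edgeBoundary_shift, Finset.card_map]

lemma mem_box {L : ℕ} {x : Site d} : x ∈ box d L ↔ ∀ k, -(L : ℤ) ≤ x k ∧ x k ≤ L := by
  simp only [box, Finset.mem_Icc, Pi.le_def, ← forall_and]

lemma card_box (d L : ℕ) : (box d L).card = (2 * L + 1) ^ d := by
  simp only [box, Pi.card_Icc, Int.card_Icc, Finset.prod_const, Finset.card_univ, Fintype.card_fin]
  congr 1
  omega

lemma card_box_pos (d L : ℕ) : (0 : ℝ) < (box d L).card := by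
  rw [card_box]; positivity

lemma box_mono {L M : ℕ} (h : L ≤ M) : box d L ⊆ box d M := fun x hx => by
  rw [mem_box] at hx ⊢
  exact fun k => ⟨by have := (hx k).1; omega, by have := (hx k).2; omega⟩

lemma tendsto_card_box_sub_div (d w : ℕ) :
    Tendsto (fun L : ℕ => ((box d (L - w)).card : ℝ) / (box d L).card) atTop (𝓝 1) := by
  have h1 : Tendsto (fun L : ℕ => 1 - 2 * (w : ℝ) / (2 * L + 1)) atTop (𝓝 (1 - 0)) := by
    refine tendsto_const_nhds.sub (Tendsto.div_atTop tendsto_const_nhds ?_)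
    refine tendsto_atTop_add_const_right _ _ (Tendsto.const_mul_atTop two_pos ?_)
    exact tendsto_natCast_atTop_atTop
  have h2 := h1.pow d
  rw [sub_zero, one_pow] at h2
  refine h2.congr' ?_
  filter_upwards [eventually_ge_atTop w] with L hL
  rw [card_box, card_box]
  push_cast [hL]
  rw [← div_pow]
  congr 1
  field_simp
  ring

/-- Sites of the next smaller box have no outside neighbour; each remaining site has at most `2 *
d`. -/
lemma card_edgeBoundary_box_le {m : ℕ} (hm : 1 ≤ m) : ((edgeBoundary (box d m)).card : ℝ) ≤
    2 * d * ((box d m).card - (box d (m - 1)).card) := by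
  classical
  have h1 : (edgeBoundary (box d m)).card ≤ ∑ i ∈ box d m, if i ∈ box d (m - 1) then 0 else 2 * d := by
    refine (card_edgeBoundary_le _).trans (Finset.sum_le_sum fun i _ => ?_)
    split_ifs with hi
    · rw [Nat.le_zero, Finset.card_eq_zero, Finset.filter_eq_empty_iff]
      intro j hj hjm
      refine hjm (mem_box.mpr fun l => ?_)
      have h2 := mem_box.mp hi l
      obtain ⟨k, rfl | rfl⟩ := (isNeighbor_iff i j).mp (mem_nbrs.mp hj)
      · have := abs_unitVec_le k l
        simp only [Pi.add_apply]
        omega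
      · have := abs_unitVec_le k l
        simp only [Pi.add_apply] at h2
        omega
    · exact (Finset.card_filter_le _ _).trans (card_nbrs_le i)
  have h2 : ∑ i ∈ box d m, (if i ∈ box d (m - 1) then 0 else 2 * d) =
      (box d m \ box d (m - 1)).card * (2 * d) := by
    rw [← Finset.sum_const_nat fun _ _ => rfl, Finset.sdiff_eq_filter, Finset.sum_filter]
    exact Finset.sum_congr rfl fun i _ => by split_ifs <;> simp_all
  rw [h2, Finset.card_sdiff_of_subset (box_mono (Nat.sub_le m 1))] at h1
  have h3 := Finset.card_le_card (box_mono (d := d) (Nat.sub_le m 1))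
  have h4 : ((edgeBoundary (box d m)).card : ℝ) ≤
      (((box d m).card - (box d (m - 1)).card : ℕ) : ℝ) * (2 * d) := by exact_mod_cast h1
  rw [Nat.cast_sub h3] at h4
  linarith

lemma tendsto_card_edgeBoundary_box_div (d : ℕ) :
    Tendsto (fun L : ℕ => ((edgeBoundary (box d L)).card : ℝ) / (box d L).card) atTop (𝓝 0) := by
  have h1 : Tendsto (fun L : ℕ => 2 * (d : ℝ) * (1 - ((box d (L - 1)).card : ℝ) / (box d L).card))
      atTop (𝓝 (2 * d * (1 - 1))) :=
    (tendsto_const_nhds.sub (tendsto_card_box_sub_div d 1)).const_mul _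
  rw [sub_self, mul_zero] at h1
  refine tendsto_of_tendsto_of_tendsto_of_le_of_le' tendsto_const_nhds h1
    (Eventually.of_forall fun L => by positivity) ?_
  filter_upwards [eventually_ge_atTop 1] with L hL
  have h2 := card_box_pos d L
  rw [div_le_iff₀ h2, mul_assoc, sub_mul, div_mul_cancel₀ _ h2.ne', one_mul]
  exact card_edgeBoundary_box_le hL

/-- The index of the cell of side `2 * m + 1` that contains a site. -/
def cellIndex (m : ℕ) (x : Site d) : Site d := fun k => (x k + m) / (2 * m + 1)

/-- The cell of side `2 * m + 1` with a given index. -/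
def cell (m : ℕ) (u : Site d) : Finset (Site d) := shift (fun k => (2 * m + 1) * u k) (box d m)

lemma mem_cell {m : ℕ} {u x : Site d} : x ∈ cell m u ↔ cellIndex m x = u := by
  rw [cell, mem_shift, mem_box, funext_iff]
  refine forall_congr' fun k => ?_
  have hw : (0 : ℤ) < 2 * m + 1 := by positivity
  rw [cellIndex, Int.ediv_eq_iff_of_pos hw]
  simp only [Pi.sub_apply, mul_comm (u k)]
  constructor
  · rintro ⟨h1, h2⟩; constructor <;> linarith
  · rintro ⟨h1, h2⟩; constructor <;> linarith

lemma abs_biUnion_sub_sum_le {ι : Type*} [DecidableEq ι] {p : Finset (Site d) → ℝ} {K : ℝ}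
    (hadd : ∀ A B, Disjoint A B → |p (A ∪ B) - p A - p B| ≤ K * (edgeBoundary B).card)
    (A : Finset (Site d)) (𝓤 : Finset ι) (f : ι → Finset (Site d))
    (hf : (𝓤 : Set ι).PairwiseDisjoint f) (hA : ∀ u ∈ 𝓤, Disjoint A (f u)) :
    |p (A ∪ 𝓤.biUnion f) - p A - ∑ u ∈ 𝓤, p (f u)| ≤ K * ∑ u ∈ 𝓤, ((edgeBoundary (f u)).card : ℝ) := by
  induction 𝓤 using Finset.induction_on with
  | empty => simp
  | insert u 𝓤 hu ih =>
    have h1 := ih (hf.subset (by simp)) fun v hv => hA v (by simp [hv])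
    have h2 : Disjoint (A ∪ 𝓤.biUnion f) (f u) := by
      rw [Finset.disjoint_union_left, Finset.disjoint_biUnion_left]
      refine ⟨hA u (by simp), fun v hv => hf (by simp [hv]) (by simp) fun h => hu (h ▸ hv)⟩
    have h3 := hadd _ _ h2
    rw [Finset.biUnion_insert, Finset.sum_insert hu, Finset.sum_insert hu, mul_add,
      Finset.union_comm (f u), ← Finset.union_assoc]
    have h4 := abs_add_le (p (A ∪ 𝓤.biUnion f ∪ f u) - p (A ∪ 𝓤.biUnion f) - p (f u))
      (p (A ∪ 𝓤.biUnion f) - p A - ∑ u ∈ 𝓤, p (f u))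
    refine le_trans (le_of_eq ?_) (h4.trans (add_le_add h3 h1))
    congr 1
    ring

lemma shift_singleton_zero (x : Site d) : shift x {0} = {x} := by
  ext y
  rw [mem_shift, Finset.mem_singleton, Finset.mem_singleton, sub_eq_zero]

/-- Tile the large box by translates of the small one and fill the rest with single sites. The first
error is the surface-to-volume ratio of a tile; the second is the leftover fraction, confined to a
layer of width `2 * m + 1`. -/
lemma abs_average_sub_average_le {p : Finset (Site d) → ℝ} {K : ℝ} (hK : 0 ≤ K)
    (htr : ∀ a A, p (shift a A) = p A)
    (hadd : ∀ A B, Disjoint A B → |p (A ∪ B) - p A - p B| ≤ K * (edgeBoundary B).card)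
    {m L : ℕ} (hL : 2 * m + 1 ≤ L) :
    |p (box d L) / (box d L).card - p (box d m) / (box d m).card| ≤
      K * ((edgeBoundary (box d m)).card / (box d m).card) +
      (1 - ((box d (L - (2 * m + 1))).card : ℝ) / (box d L).card) *
        (K * (edgeBoundary {(0 : Site d)}).card + |p {0}| + |p (box d m) / (box d m).card|) := by
  classical
  let 𝓤 := ((box d L).image (cellIndex m)).filter fun u => cell m u ⊆ box d L
  let U := 𝓤.biUnion (cell m)
  let R := box d L \ U
  have hUL : U ⊆ box d L := Finset.biUnion_subset.mpr fun u hu => (Finset.mem_filter.mp hu).2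
  have hdisj : (𝓤 : Set (Site d)).PairwiseDisjoint (cell m) := fun u _ v _ huv =>
    Finset.disjoint_left.mpr fun x hx hx' => huv ((mem_cell.mp hx).symm.trans (mem_cell.mp hx'))
  have hpempty : p ∅ = 0 := by
    have h := hadd ∅ ∅ (by simp)
    have h0 : edgeBoundary (∅ : Finset (Site d)) = ∅ := by ext e; simp [mem_edgeBoundary]
    rw [h0] at h
    simpa using h
  have h1 := abs_biUnion_sub_sum_le hadd ∅ 𝓤 (cell m) hdisj fun _ _ => by simp
  have h2 := abs_biUnion_sub_sum_le hadd U R (fun x => {x}) (by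
    intro x _ y _ hxy
    simpa using hxy) fun x hx => by simpa using (Finset.mem_sdiff.mp hx).2
  have hRL : U ∪ R.biUnion (fun x => {x}) = box d L := by
    rw [Finset.biUnion_singleton_eq_self, Finset.union_sdiff_of_subset hUL]
  have hps : ∀ x : Site d, p {x} = p {0} := fun x => by rw [← shift_singleton_zero x, htr]
  have hes : ∀ x : Site d, ((edgeBoundary {x}).card : ℝ) = (edgeBoundary {(0 : Site d)}).card :=
    fun x => by rw [← shift_singleton_zero x, card_edgeBoundary_shift]
  have hpc : ∀ u : Site d, p (cell m u) = p (box d m) := fun u => htr _ _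
  have hec : ∀ u : Site d, ((edgeBoundary (cell m u)).card : ℝ) = (edgeBoundary (box d m)).card :=
    fun u => by rw [cell, card_edgeBoundary_shift]
  rw [hRL] at h2
  simp only [hps, hes, hpc, hec, Finset.sum_const, nsmul_eq_mul, Finset.empty_union, hpempty,
    sub_zero] at h1 h2
  have hcard : (𝓤.card : ℝ) * (box d m).card + R.card = (box d L).card := by
    have h3 : U.card = 𝓤.card * (box d m).card := by
      rw [Finset.card_biUnion hdisj]
      exact Finset.sum_const_nat fun u _ => card_shift _ _
    have h4 := Finset.card_sdiff_add_card_eq_card hUL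
    rw [h3] at h4
    rw [← h4]
    push_cast
    ring
  have hR : (R.card : ℝ) ≤ (box d L).card - (box d (L - (2 * m + 1))).card := by
    have h3 : R ⊆ box d L \ box d (L - (2 * m + 1)) := by
      refine Finset.sdiff_subset_sdiff le_rfl fun x hx => ?_
      have hxL := box_mono (Nat.sub_le L (2 * m + 1)) hx
      refine Finset.mem_biUnion.mpr ⟨cellIndex m x, Finset.mem_filter.mpr
        ⟨Finset.mem_image_of_mem _ hxL, fun y hy => mem_box.mpr fun k => ?_⟩, mem_cell.mpr rfl⟩
      have hx' := (mem_box.mp hx) k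
      have h4 : x ∈ cell m (cellIndex m x) := mem_cell.mpr rfl
      rw [cell, mem_shift, mem_box] at hy h4
      have h5 := hy k
      have h6 := h4 k
      simp only [Pi.sub_apply] at h5 h6
      generalize (2 * (m : ℤ) + 1) * cellIndex m x k = z at h5 h6
      omega
    have h4 := Finset.card_le_card h3
    rw [Finset.card_sdiff_of_subset (box_mono (Nat.sub_le _ _))] at h4
    rw [← Nat.cast_sub (Finset.card_le_card (box_mono (Nat.sub_le _ _)))]
    exact_mod_cast h4
  set N : ℝ := ((box d L).card : ℝ) with hN
  set V : ℝ := ((box d m).card : ℝ) with hV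
  have hN0 : 0 < N := card_box_pos d L
  have hV0 : 0 < V := card_box_pos d m
  set a := p (box d m) / V with ha
  have hpa : p (box d m) = a * V := by rw [ha, div_mul_cancel₀ _ hV0.ne']
  set D : ℝ := ((edgeBoundary (box d m)).card : ℝ)
  set D₁ : ℝ := ((edgeBoundary {(0 : Site d)}).card : ℝ)
  have hD : 0 ≤ D := Nat.cast_nonneg _
  have hD₁ : 0 ≤ D₁ := Nat.cast_nonneg _
  set r : ℝ := (R.card : ℝ)
  set n : ℝ := (𝓤.card : ℝ)
  have hr0 : 0 ≤ r := Nat.cast_nonneg _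
  set q : ℝ := ((box d (L - (2 * m + 1))).card : ℝ)
  have hnV : n * D ≤ N * (D / V) := by
    rw [mul_div_assoc', le_div_iff₀ hV0]
    nlinarith
  have hkey : |p (box d L) - a * N| ≤ K * (N * (D / V)) + (N - q) * (K * D₁ + |p {0}| + |a|) := by
    have h3 : p (box d L) - a * N = (p (box d L) - p U - r * p {0}) + (p U - n * p (box d m)) +
        (r * p {0} + -(r * a)) := by
      rw [← hcard, hpa]; ring
    rw [h3]
    have h4 := abs_add_three (p (box d L) - p U - r * p {0}) (p U - n * p (box d m))
      (r * p {0} + -(r * a))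
    have h5 : |r * p {0} + -(r * a)| ≤ r * (|p {0}| + |a|) := by
      refine (abs_add_le _ _).trans (le_of_eq ?_)
      rw [abs_neg, abs_mul, abs_mul, abs_of_nonneg hr0, mul_add]
    have h6 : r * (K * D₁ + |p {0}| + |a|) ≤ (N - q) * (K * D₁ + |p {0}| + |a|) :=
      mul_le_mul_of_nonneg_right hR
        (add_nonneg (add_nonneg (mul_nonneg hK hD₁) (abs_nonneg _)) (abs_nonneg _))
    have h7 := mul_le_mul_of_nonneg_left hnV hK
    linarith
  have h8 : p (box d L) / N - a = (p (box d L) - a * N) / N := by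
    rw [sub_div, mul_div_cancel_right₀ _ hN0.ne']
  rw [h8, abs_div, abs_of_pos hN0, div_le_iff₀ hN0]
  refine hkey.trans (le_of_eq ?_)
  have h9 : (1 - q / N) * (K * D₁ + |p {0}| + |a|) * N =
      (N - q) * (K * D₁ + |p {0}| + |a|) := by
    rw [mul_right_comm, sub_mul, div_mul_cancel₀ _ hN0.ne', one_mul]
  rw [add_mul, h9]
  ring

/-- Averages over boxes of a translation invariant and nearly additive function converge. -/
theorem exists_tendsto_average {p : Finset (Site d) → ℝ} {K : ℝ} (hK : 0 ≤ K)
    (htr : ∀ a A, p (shift a A) = p A)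
    (hadd : ∀ A B, Disjoint A B → |p (A ∪ B) - p A - p B| ≤ K * (edgeBoundary B).card) :
    ∃ ℓ, Tendsto (fun L => p (box d L) / (box d L).card) atTop (𝓝 ℓ) := by
  refine cauchySeq_tendsto_of_complete (Metric.cauchySeq_iff'.mpr fun ε hε => ?_)
  have h1 : Tendsto (fun m : ℕ => K * (((edgeBoundary (box d m)).card : ℝ) / (box d m).card)) atTop
      (𝓝 (K * 0)) := (tendsto_card_edgeBoundary_box_div d).const_mul K
  rw [mul_zero] at h1
  obtain ⟨m, hm⟩ := (h1.eventually_lt_const (show 0 < ε / 4 by positivity)).exists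
  have h2 : Tendsto (fun L : ℕ => (1 - ((box d (L - (2 * m + 1))).card : ℝ) / (box d L).card) *
      (K * (edgeBoundary {(0 : Site d)}).card + |p {0}| + |p (box d m) / (box d m).card|)) atTop
      (𝓝 ((1 - 1) * (K * (edgeBoundary {(0 : Site d)}).card + |p {0}| +
        |p (box d m) / (box d m).card|))) :=
    (tendsto_const_nhds.sub (tendsto_card_box_sub_div d _)).mul_const _
  rw [sub_self, zero_mul] at h2
  obtain ⟨N, hN⟩ := eventually_atTop.mp
    ((h2.eventually_lt_const (show 0 < ε / 4 by positivity)).and (eventually_ge_atTop (2 * m + 1)))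
  have h3 : ∀ L ≥ N, |p (box d L) / (box d L).card - p (box d m) / (box d m).card| < ε / 2 :=
    fun L hL => by
      have h4 := abs_average_sub_average_le hK htr hadd (hN L hL).2
      have h5 := (hN L hL).1
      linarith
  refine ⟨N, fun L hL => ?_⟩
  have h4 := h3 L hL
  have h5 := h3 N le_rfl
  rw [abs_sub_comm] at h5
  rw [Real.dist_eq]
  refine lt_of_le_of_lt (abs_sub_le _ (p (box d m) / (box d m).card) _) ?_
  linarith

end BoxAverages

/-! ### Inequalities for logarithms of sums of exponentials. -/

section LogSumExp

/-- Sums of exponentials of nearby functions have nearby logarithms. -/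
lemma abs_log_sum_exp_sub_le {ι : Type*} [Fintype ι] [Nonempty ι] (u v : ι → ℝ) (c : ℝ)
    (h : ∀ i, |u i - v i| ≤ c) :
    |Real.log (∑ i, Real.exp (u i)) - Real.log (∑ i, Real.exp (v i))| ≤ c := by
  have key : ∀ u v : ι → ℝ, (∀ i, u i ≤ v i + c) →
      Real.log (∑ i, Real.exp (u i)) ≤ Real.log (∑ i, Real.exp (v i)) + c := by
    intro u v h
    have hpos : ∀ w : ι → ℝ, 0 < ∑ i, Real.exp (w i) := fun w =>
      Finset.sum_pos (fun _ _ => Real.exp_pos _) Finset.univ_nonempty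
    rw [← Real.log_exp c, ← Real.log_mul (hpos v).ne' (Real.exp_pos c).ne',
      Finset.sum_mul]
    refine Real.log_le_log (hpos u) (Finset.sum_le_sum fun i _ => ?_)
    rw [← Real.exp_add]
    exact Real.exp_le_exp.mpr (h i)
  rw [abs_le]
  have h1 := key u v fun i => by linarith [(abs_le.mp (h i)).2]
  have h2 := key v u fun i => by linarith [(abs_le.mp (h i)).1]
  constructor <;> linarith

/-- The logarithm of a sum of exponentials of affine functions is convex. -/
lemma convexOn_log_sum_exp {ι : Type*} [Fintype ι] [Nonempty ι] (u v : ι → ℝ) :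
    ConvexOn ℝ Set.univ fun t : ℝ => Real.log (∑ i, Real.exp (u i + t * v i)) := by
  refine ⟨convex_univ, fun x _ y _ a b ha hb hab => ?_⟩
  simp only [smul_eq_mul]
  have hpos : ∀ t, 0 < ∑ i, Real.exp (u i + t * v i) := fun t =>
    Finset.sum_pos (fun _ _ => Real.exp_pos _) Finset.univ_nonempty
  set X := ∑ i, Real.exp (u i + x * v i) with hX
  set Y := ∑ i, Real.exp (u i + y * v i) with hY
  have hX0 : 0 < X := hpos x
  have hY0 : 0 < Y := hpos y
  rw [Real.log_le_iff_le_exp (hpos _)]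
  -- Hölder's inequality: after normalizing by `X` and `Y`, convexity of the exponential applies
  -- term by term.
  have h1 : ∀ i, Real.exp (u i + (a * x + b * y) * v i) ≤ Real.exp (a * Real.log X + b * Real.log Y) *
      (a * (Real.exp (u i + x * v i) / X) + b * (Real.exp (u i + y * v i) / Y)) := by
    intro i
    have h2 := convexOn_exp.2 (Set.mem_univ (u i + x * v i - Real.log X))
      (Set.mem_univ (u i + y * v i - Real.log Y)) ha hb hab
    simp only [smul_eq_mul, Real.exp_sub, Real.exp_log hX0, Real.exp_log hY0] at h2
    refine le_trans (le_of_eq ?_) (mul_le_mul_of_nonneg_left h2 (Real.exp_nonneg _))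
    rw [← Real.exp_add]
    congr 1
    linear_combination (-u i) * hab
  refine (Finset.sum_le_sum fun i _ => h1 i).trans (le_of_eq ?_)
  rw [← Finset.mul_sum, Finset.sum_add_distrib, ← Finset.mul_sum, ← Finset.mul_sum,
    ← Finset.sum_div, ← Finset.sum_div, div_self hX0.ne', div_self hY0.ne', mul_one, mul_one, hab,
    mul_one]

/-- Jensen's inequality for the logarithm of an exponential average. -/
lemma le_log_sum_mul_exp {ι : Type*} [Fintype ι] (k y : ι → ℝ) (hk : ∀ i, 0 ≤ k i)
    (hk1 : ∑ i, k i = 1) : ∑ i, k i * y i ≤ Real.log (∑ i, k i * Real.exp (y i)) := by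
  set m := ∑ i, k i * y i with hm
  have h1 : Real.exp m ≤ ∑ i, k i * Real.exp (y i) := by
    -- The exponential lies above its tangent at the mean `m`; the linear terms average to zero.
    have h2 : ∀ i, Real.exp m * (k i * (1 + (y i - m))) ≤ k i * Real.exp (y i) := by
      intro i
      have h3 : Real.exp (y i) = Real.exp m * Real.exp (y i - m) := by
        rw [← Real.exp_add]; congr 1; ring
      have h4 := Real.add_one_le_exp (y i - m)
      rw [h3, mul_left_comm]
      refine mul_le_mul_of_nonneg_left (mul_le_mul_of_nonneg_left ?_ (Real.exp_nonneg _)) (hk i)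
      linarith
    refine le_trans (le_of_eq ?_) (Finset.sum_le_sum fun i _ => h2 i)
    rw [← Finset.mul_sum]
    have h5 : ∑ i, k i * (1 + (y i - m)) = 1 := by
      simp only [mul_add, mul_sub, mul_one, Finset.sum_add_distrib, Finset.sum_sub_distrib,
        ← Finset.sum_mul, hk1, one_mul, ← hm]
      ring
    rw [h5, mul_one]
  rw [← Real.log_exp m]
  exact Real.log_le_log (Real.exp_pos _) h1

end LogSumExp

/-! ### Free boundary conditions and near additivity of `log Z`. -/

section FreePartition

variable {d : ℕ}

/-- The energy of the pairs inside `Λ`. -/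
def innerEnergy (s J : ℝ) (Λ : Finset (Site d)) (σ : Config d) : ℝ :=
  ∑ i ∈ Λ, ∑ j ∈ Λ, 1 / 2 * (coupling s J i j * spin σ i * spin σ j)

/-- The exponent of the Boltzmann factor with free boundary condition. -/
def freeExponent (s J β h : ℝ) (Λ : Finset (Site d)) (σ : Config d) : ℝ :=
  -β * (innerEnergy s J Λ σ - h * ∑ i ∈ Λ, spin σ i)

/-- The partition function with free boundary condition. -/
def freePartition (s J β h : ℝ) (Λ : Finset (Site d)) : ℝ :=
  ∑ τ : Λ → ℤˣ, Real.exp (freeExponent s J β h Λ (glue Λ τ 1))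

/-- The total strength of the pairs with exactly one site in `Λ`. -/
def exitCoupling (s J : ℝ) (Λ : Finset (Site d)) : ℝ :=
  ∑ i ∈ Λ, ∑' j, (if j ∈ Λ then 0 else |coupling s J i j|)

lemma summable_ite_abs_coupling {s : ℝ} (hs : (d : ℝ) + 1 < s) (J : ℝ) (Λ : Finset (Site d))
    (i : Site d) : Summable fun j => (if j ∈ Λ then 0 else |coupling s J i j|) := by
  refine (summable_abs_coupling hs J i).of_nonneg_of_le (fun j => ?_) fun j => ?_ <;> split_ifs
  · exact le_rfl
  · exact abs_nonneg _
  · exact abs_nonneg _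
  · exact le_rfl

lemma abs_tsum_half_sub_sum_le (Λ : Finset (Site d)) (a : Site d → ℝ)
    (ha : Summable fun j => |a j|) :
    |∑' j, (if j ∈ Λ then (1 / 2 : ℝ) else 1) * a j - ∑ j ∈ Λ, 1 / 2 * a j| ≤
      ∑' j, (if j ∈ Λ then 0 else |a j|) := by
  have hout : Summable fun j => ‖if j ∈ Λ then 0 else a j‖ :=
    ha.of_nonneg_of_le (fun _ => norm_nonneg _) fun j => by
      rw [Real.norm_eq_abs]
      split_ifs
      · rw [abs_zero]; exact abs_nonneg _
      · exact le_rfl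
  have h1 : ∑ j ∈ Λ, 1 / 2 * a j = ∑' j, (if j ∈ Λ then 1 / 2 * a j else 0) := by
    rw [tsum_eq_sum (s := Λ) fun j hj => if_neg hj]
    exact Finset.sum_congr rfl fun j hj => (if_pos hj).symm
  have h2 : ∑' j, (if j ∈ Λ then (1 / 2 : ℝ) else 1) * a j =
      ∑' j, (if j ∈ Λ then 1 / 2 * a j else 0) + ∑' j, (if j ∈ Λ then 0 else a j) := by
    rw [← Summable.tsum_add (summable_of_ne_finset_zero (s := Λ) fun j hj => if_neg hj) hout.of_norm]
    exact tsum_congr fun j => by split_ifs <;> simp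
  rw [h2, h1, add_sub_cancel_left, ← Real.norm_eq_abs]
  refine (norm_tsum_le_tsum_norm hout).trans (le_of_eq (tsum_congr fun j => ?_))
  rw [Real.norm_eq_abs]
  split_ifs
  · exact abs_zero
  · rfl

lemma abs_hamiltonian_sub_innerEnergy_le {s : ℝ} (hs : (d : ℝ) + 1 < s) (J : ℝ)
    (Λ : Finset (Site d)) (σ : Config d) :
    |hamiltonian s J Λ σ - innerEnergy s J Λ σ| ≤ exitCoupling s J Λ := by
  unfold hamiltonian innerEnergy exitCoupling
  rw [← Finset.sum_sub_distrib]
  refine (Finset.abs_sum_le_sum_abs _ _).trans (Finset.sum_le_sum fun i _ => ?_)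
  have h := abs_tsum_half_sub_sum_le Λ (fun j => coupling s J i j * spin σ i * spin σ j)
    ((summable_abs_coupling hs J i).congr fun j => (abs_coupling_spin s J σ i j).symm)
  simp only [abs_coupling_spin] at h
  exact h

lemma innerEnergy_congr (s J : ℝ) {Λ : Finset (Site d)} {σ σ' : Config d}
    (h : ∀ i ∈ Λ, σ i = σ' i) : innerEnergy s J Λ σ = innerEnergy s J Λ σ' := by
  refine Finset.sum_congr rfl fun i hi => Finset.sum_congr rfl fun j hj => ?_
  simp only [spin, h i hi, h j hj]

lemma freeExponent_congr (s J β h : ℝ) {Λ : Finset (Site d)} {σ σ' : Config d}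
    (hσ : ∀ i ∈ Λ, σ i = σ' i) : freeExponent s J β h Λ σ = freeExponent s J β h Λ σ' := by
  unfold freeExponent
  rw [innerEnergy_congr s J hσ, Finset.sum_congr rfl fun i hi => by
    rw [spin, hσ i hi, ← spin]]

/-- Any boundary condition alters each exponent by at most `β` times the coupling across the
boundary. This is the source of independence from `η`. -/
lemma abs_log_partitionFunction_sub_le {s : ℝ} (hs : (d : ℝ) + 1 < s) (J : ℝ) {β : ℝ} (hβ : 0 ≤ β)
    (h : ℝ) (Λ : Finset (Site d)) (η : Config d) :
    |Real.log (partitionFunction s J β h Λ η) - Real.log (freePartition s J β h Λ)| ≤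
      β * exitCoupling s J Λ := by
  refine abs_log_sum_exp_sub_le _ _ _ fun τ => ?_
  have h1 : freeExponent s J β h Λ (glue Λ τ 1) = freeExponent s J β h Λ (glue Λ τ η) :=
    freeExponent_congr s J β h fun i hi => by rw [glue_of_mem hi, glue_of_mem hi]
  rw [h1, freeExponent, ← mul_sub, abs_mul, abs_neg, abs_of_nonneg hβ, sub_sub_sub_cancel_right]
  exact mul_le_mul_of_nonneg_left (abs_hamiltonian_sub_innerEnergy_le hs J Λ _) hβ

lemma innerEnergy_shift (s J : ℝ) (a : Site d) (A : Finset (Site d)) (σ : Config d) :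
    innerEnergy s J (shift a A) σ = innerEnergy s J A fun i => σ (i + a) := by
  simp only [innerEnergy, shift, Finset.sum_map, Equiv.coe_toEmbedding, Equiv.coe_addRight,
    coupling_add]
  rfl

lemma freePartition_shift (s J β h : ℝ) (a : Site d) (A : Finset (Site d)) :
    freePartition s J β h (shift a A) = freePartition s J β h A := by
  let e : A ≃ shift a A := (Equiv.addRight a).subtypeEquiv fun i => by
    rw [mem_shift, Equiv.coe_addRight, add_sub_cancel_right]
  refine (Fintype.sum_equiv (e.arrowCongr (Equiv.refl ℤˣ)) _ _ fun τ => ?_).symm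
  congr 1
  have h1 : (fun i => glue (shift a A) (e.arrowCongr (Equiv.refl ℤˣ) τ) (1 : Config d) (i + a)) =
      glue A τ 1 := by
    funext i
    by_cases hi : i ∈ A
    · have hi' : i + a ∈ shift a A := mem_shift.mpr (by simpa using hi)
      rw [glue_of_mem hi', glue_of_mem hi]
      simp only [Equiv.arrowCongr_apply, Equiv.coe_refl, Function.comp_apply, id]
      congr 1
      rw [Equiv.symm_apply_eq]
      rfl
    · have hi' : i + a ∉ shift a A := fun hc => hi (by simpa using mem_shift.mp hc)
      rw [glue_of_notMem hi', glue_of_notMem hi]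
      rfl
  rw [freeExponent, freeExponent, innerEnergy_shift, h1]
  congr 3
  simp only [shift, Finset.sum_map, Equiv.coe_toEmbedding, Equiv.coe_addRight]
  rw [← h1]
  rfl

lemma abs_innerEnergy_union_sub_le {s : ℝ} (hs : (d : ℝ) + 1 < s) (J : ℝ) {A B : Finset (Site d)}
    (hAB : Disjoint A B) (σ : Config d) :
    |innerEnergy s J (A ∪ B) σ - (innerEnergy s J A σ + innerEnergy s J B σ)| ≤
      exitCoupling s J B := by
  set a : Site d → Site d → ℝ := fun i j => coupling s J i j * spin σ i * spin σ j with ha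
  have hsymm : ∀ i j, a i j = a j i := fun i j => by
    simp only [ha]; rw [coupling_comm]; ring
  have h1 : innerEnergy s J (A ∪ B) σ - (innerEnergy s J A σ + innerEnergy s J B σ) =
      ∑ i ∈ B, ∑ j ∈ A, a i j := by
    have h2 : ∑ i ∈ A, ∑ j ∈ B, 1 / 2 * a i j = ∑ i ∈ B, ∑ j ∈ A, 1 / 2 * a i j := by
      rw [Finset.sum_comm]
      exact Finset.sum_congr rfl fun i _ => Finset.sum_congr rfl fun j _ => by rw [hsymm]
    unfold innerEnergy
    rw [Finset.sum_union hAB]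
    simp only [Finset.sum_union hAB, Finset.sum_add_distrib]
    rw [h2]
    simp only [← Finset.mul_sum]
    ring
  rw [h1]
  refine (Finset.abs_sum_le_sum_abs _ _).trans (Finset.sum_le_sum fun i _ => ?_)
  refine (Finset.abs_sum_le_sum_abs _ _).trans ?_
  refine le_trans (Finset.sum_le_sum fun j hj => ?_)
    ((summable_ite_abs_coupling hs J B i).sum_le_tsum A fun j _ => ?_)
  · rw [if_neg (Finset.disjoint_left.mp hAB hj)]
    exact (abs_coupling_spin s J σ i j).le
  · split_ifs
    · exact le_rfl
    · exact abs_nonneg _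

/-- Dropping the interaction between `A` and `B` factorizes the partition function. The error
involves only the exit coupling of `B`, so adding small pieces costs only their own boundaries. -/
lemma abs_log_freePartition_union_sub_le {s : ℝ} (hs : (d : ℝ) + 1 < s) (J : ℝ) {β : ℝ}
    (hβ : 0 ≤ β) (h : ℝ) {A B : Finset (Site d)} (hAB : Disjoint A B) :
    |Real.log (freePartition s J β h (A ∪ B)) - Real.log (freePartition s J β h A) -
      Real.log (freePartition s J β h B)| ≤ β * exitCoupling s J B := by
  classical
  have hpos : ∀ A : Finset (Site d), 0 < freePartition s J β h A := fun A =>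
    Finset.sum_pos (fun _ _ => Real.exp_pos _) Finset.univ_nonempty
  let e := Equiv.piFinsetUnion (fun _ : Site d => ℤˣ) hAB
  have h1 : freePartition s J β h (A ∪ B) = ∑ q : (A → ℤˣ) × (B → ℤˣ),
      Real.exp (freeExponent s J β h (A ∪ B) (glue (A ∪ B) (e q) 1)) :=
    (Equiv.sum_comp e _).symm
  have h2 : freePartition s J β h A * freePartition s J β h B = ∑ q : (A → ℤˣ) × (B → ℤˣ),
      Real.exp (freeExponent s J β h A (glue A q.1 1) + freeExponent s J β h B (glue B q.2 1)) := by
    unfold freePartition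
    rw [Finset.sum_mul_sum, Fintype.sum_prod_type]
    simp only [Real.exp_add]
  rw [sub_sub, ← Real.log_mul (hpos A).ne' (hpos B).ne', h1, h2]
  refine abs_log_sum_exp_sub_le _ _ _ fun q => ?_
  set σ := glue (A ∪ B) (e q) (1 : Config d) with hσ
  have hA : freeExponent s J β h A (glue A q.1 1) = freeExponent s J β h A σ :=
    freeExponent_congr s J β h fun i hi => by
      rw [hσ, glue_of_mem hi, glue_of_mem (Finset.mem_union_left B hi)]
      exact (Equiv.piFinsetUnion_left (fun _ : Site d => ℤˣ) hAB hi _).symm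
  have hB : freeExponent s J β h B (glue B q.2 1) = freeExponent s J β h B σ :=
    freeExponent_congr s J β h fun i hi => by
      rw [hσ, glue_of_mem hi, glue_of_mem (Finset.mem_union_right A hi)]
      exact (Equiv.piFinsetUnion_right (fun _ : Site d => ℤˣ) hAB hi _).symm
  have h3 : freeExponent s J β h (A ∪ B) σ - (freeExponent s J β h A σ + freeExponent s J β h B σ) =
      -β * (innerEnergy s J (A ∪ B) σ - (innerEnergy s J A σ + innerEnergy s J B σ)) := by
    unfold freeExponent
    rw [Finset.sum_union hAB]
    ring
  rw [hA, hB, h3, abs_mul, abs_neg, abs_of_nonneg hβ]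
  exact mul_le_mul_of_nonneg_left (abs_innerEnergy_union_sub_le hs J hAB σ) hβ

end FreePartition

/-! ### Pressure, free energy and spontaneous magnetization. -/

section Pressure

variable {d : ℕ}

/-- The pressure exists and does not depend on the boundary condition. -/
theorem exists_tendsto_log_partitionFunction {s : ℝ} (hs : (d : ℝ) + 1 < s) (J : ℝ) {β : ℝ}
    (hβ : 0 ≤ β) (h : ℝ) : ∃ P, ∀ η : Config d,
      Tendsto (fun L => Real.log (partitionFunction s J β h (box d L) η) / (box d L).card) atTop
        (𝓝 P) := by
  set C := ∑' x : Site d, |coupling s J 0 x| * latticeNorm x with hC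
  have hC0 : 0 ≤ C := tsum_nonneg fun _ => by positivity
  have hexit : ∀ A : Finset (Site d), β * exitCoupling s J A ≤ β * C * (edgeBoundary A).card :=
    fun A => by
      rw [mul_assoc]
      exact mul_le_mul_of_nonneg_left (sum_coupling_exit_le hs J A) hβ
  obtain ⟨P, hP⟩ := exists_tendsto_average (p := fun A : Finset (Site d) =>
      Real.log (freePartition s J β h A)) (mul_nonneg hβ hC0)
    (fun a A => by rw [freePartition_shift])
    fun A B hAB => (abs_log_freePartition_union_sub_le hs J hβ h hAB).trans (hexit B)
  refine ⟨P, fun η => ?_⟩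
  have h1 : Tendsto (fun L : ℕ => Real.log (partitionFunction s J β h (box d L) η) / (box d L).card -
      Real.log (freePartition s J β h (box d L)) / (box d L).card) atTop (𝓝 0) := by
    have h2 := (tendsto_card_edgeBoundary_box_div d).const_mul (β * C)
    rw [mul_zero] at h2
    refine squeeze_zero_norm (fun L => ?_) h2
    rw [← sub_div, Real.norm_eq_abs, abs_div, abs_of_pos (card_box_pos d L), mul_div_assoc']
    gcongr
    exact (abs_log_partitionFunction_sub_le hs J hβ h _ η).trans (hexit _)
  simpa using h1.add hP

/-- The pressure. -/
def pressure (d : ℕ) (s J β h : ℝ) : ℝ :=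
  limUnder atTop fun L : ℕ =>
    Real.log (partitionFunction s J β h (box d L) fun _ => 1) / (box d L).card

lemma tendsto_pressure {s : ℝ} (hs : (d : ℝ) + 1 < s) (J : ℝ) {β : ℝ} (hβ : 0 ≤ β) (h : ℝ)
    (η : Config d) : Tendsto (fun L =>
      Real.log (partitionFunction s J β h (box d L) η) / (box d L).card) atTop
        (𝓝 (pressure d s J β h)) := by
  obtain ⟨P, hP⟩ := exists_tendsto_log_partitionFunction hs J hβ h
  rw [pressure, (hP fun _ => 1).limUnder_eq]
  exact hP η

lemma tendsto_boxFreeEnergy {s : ℝ} (hs : (d : ℝ) + 1 < s) (J : ℝ) {β : ℝ} (hβ : 0 ≤ β) (h : ℝ)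
    (η : Config d) : Tendsto (fun L => boxFreeEnergy s J β h L η) atTop
      (𝓝 (-(1 / β) * pressure d s J β h)) := by
  refine ((tendsto_pressure hs J hβ h η).const_mul (-(1 / β))).congr fun L => ?_
  rw [boxFreeEnergy, one_div_mul_eq_div]

lemma freeEnergy_eq {s : ℝ} (hs : (d : ℝ) + 1 < s) (J : ℝ) {β : ℝ} (hβ : 0 ≤ β) (h : ℝ) :
    freeEnergy d s J β h = -(1 / β) * pressure d s J β h :=
  (tendsto_boxFreeEnergy hs J hβ h _).limUnder_eq

lemma convexOn_log_partitionFunction (s J β : ℝ) (Λ : Finset (Site d)) (η : Config d) :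
    ConvexOn ℝ Set.univ fun h => Real.log (partitionFunction s J β h Λ η) := by
  refine (convexOn_log_sum_exp (fun τ : Λ → ℤˣ => -β * hamiltonian s J Λ (glue Λ τ η))
    fun τ => β * ∑ i ∈ Λ, spin (glue Λ τ η) i).congr fun h _ => ?_
  simp only [partitionFunction, boltzmann]
  congr 1
  refine Finset.sum_congr rfl fun τ _ => ?_
  congr 1
  ring

lemma convexOn_pressure {s : ℝ} (hs : (d : ℝ) + 1 < s) (J : ℝ) {β : ℝ} (hβ : 0 ≤ β) :
    ConvexOn ℝ Set.univ fun h => pressure d s J β h := by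
  refine ⟨convex_univ, fun x _ y _ a b ha hb hab => ?_⟩
  have hx := (tendsto_pressure hs J hβ x (fun _ : Site d => 1)).const_mul a
  have hy := (tendsto_pressure hs J hβ y (fun _ : Site d => 1)).const_mul b
  refine le_of_tendsto_of_tendsto' (tendsto_pressure hs J hβ (a • x + b • y) fun _ => 1)
    (hx.add hy) fun L => ?_
  have h1 := (convexOn_log_partitionFunction s J β (box d L) fun _ => 1).2 (Set.mem_univ x)
    (Set.mem_univ y) ha hb hab
  simp only [smul_eq_mul] at h1 ⊢
  rw [mul_div_assoc', mul_div_assoc', ← add_div]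
  exact div_le_div_of_nonneg_right h1 (card_box_pos d L).le

/-- The pressure grows at least linearly in the field if the magnetization is bounded below. -/
lemma mul_le_log_partitionFunction_sub {s : ℝ} (J : ℝ) {β : ℝ} (hβ : 0 ≤ β) {h m : ℝ} (hh : 0 ≤ h)
    (Λ : Finset (Site d)) (η : Config d)
    (hm : ∀ v, m ≤ ∫ σ, spin σ v ∂(finiteGibbs s J β Λ η)) :
    β * h * m * Λ.card ≤ Real.log (partitionFunction s J β h Λ η) -
      Real.log (partitionFunction s J β 0 Λ η) := by
  have hZ := partitionFunction_pos s J β 0 Λ η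
  -- The ratio is the zero-field expectation of the exponential of the field term, to which Jensen's
  -- inequality applies.
  have h1 : partitionFunction s J β h Λ η / partitionFunction s J β 0 Λ η =
      ∑ τ : Λ → ℤˣ, gibbsKernel s J β Λ τ η *
        Real.exp (β * h * ∑ i ∈ Λ, spin (glue Λ τ η) i) := by
    rw [partitionFunction, Finset.sum_div]
    refine Finset.sum_congr rfl fun τ _ => ?_
    rw [gibbsKernel, div_mul_eq_mul_div]
    congr 1
    unfold boltzmann
    rw [← Real.exp_add]
    congr 1
    ring
  rw [← Real.log_div (partitionFunction_pos s J β h Λ η).ne' hZ.ne', h1]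
  refine le_trans ?_ (le_log_sum_mul_exp _ _ (fun τ => (gibbsKernel_pos _ _ _ _ _ _).le)
    (sum_gibbsKernel s J β Λ η))
  have h2 : ∑ τ : Λ → ℤˣ, gibbsKernel s J β Λ τ η * (β * h * ∑ i ∈ Λ, spin (glue Λ τ η) i) =
      β * h * ∑ i ∈ Λ, ∫ σ, spin σ i ∂(finiteGibbs s J β Λ η) := by
    have h3 : ∀ i, ∫ σ, spin σ i ∂(finiteGibbs s J β Λ η) =
        ∑ τ : Λ → ℤˣ, gibbsKernel s J β Λ τ η * spin (glue Λ τ η) i := fun i =>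
      integral_finiteGibbs s J β Λ η _ (continuous_spin i).measurable.stronglyMeasurable
    simp only [h3]
    rw [Finset.sum_comm, Finset.mul_sum]
    refine Finset.sum_congr rfl fun τ _ => ?_
    rw [← Finset.mul_sum]
    ring
  rw [h2, mul_assoc (β * h)]
  refine mul_le_mul_of_nonneg_left ?_ (mul_nonneg hβ hh)
  have h4 := Finset.card_nsmul_le_sum Λ (fun i => ∫ σ, spin σ i ∂(finiteGibbs s J β Λ η)) m
    fun i _ => hm i
  rw [nsmul_eq_mul] at h4
  linarith

/-- The right derivative of the free energy exists, and the spontaneous magnetization is bounded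
below by the magnetization in finite volume. -/
theorem hasDerivWithinAt_freeEnergy {s : ℝ} (hs : (d : ℝ) + 1 < s) (J : ℝ) {β : ℝ} (hβ : 0 < β)
    {m : ℝ} (hm : ∀ L v, m ≤ ∫ σ, spin σ v ∂(finiteGibbs s J β (box d L) fun _ => 1)) :
    HasDerivWithinAt (fun h => freeEnergy d s J β h) (-spontaneousMagnetization d s J β)
      (Set.Ici 0) 0 ∧ m ≤ spontaneousMagnetization d s J β := by
  have hconv := convexOn_pressure (d := d) hs J hβ.le
  have hder := (hconv.hasDerivWithinAt_rightDeriv_of_mem_interior (x := 0) (by simp))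
  set D := derivWithin (fun h => pressure d s J β h) (Set.Ioi 0) 0
  have hder2 : HasDerivWithinAt (fun h => freeEnergy d s J β h) (-(1 / β) * D) (Set.Ici 0) 0 := by
    have h1 := (hasDerivWithinAt_Ioi_iff_Ici.mp hder).const_mul (-(1 / β))
    exact h1.congr_of_mem (fun h _ => freeEnergy_eq hs J hβ.le h) Set.self_mem_Ici
  have hmag : spontaneousMagnetization d s J β = 1 / β * D := by
    rw [spontaneousMagnetization, hder2.derivWithin (uniqueDiffOn_Ici 0 0 Set.self_mem_Ici)]
    ring
  refine ⟨by rw [hmag, ← neg_mul]; exact hder2, ?_⟩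
  -- Every secant slope from 0 to a positive field is at least `β * m`, hence so is the right
  -- derivative.
  have hslope : β * m ≤ D := by
    refine ge_of_tendsto (hasDerivWithinAt_iff_tendsto_slope' (by simp) |>.mp hder) ?_
    filter_upwards [self_mem_nhdsWithin] with h hh
    have hh' : 0 < h := hh
    have h2 : β * h * m ≤ pressure d s J β h - pressure d s J β 0 := by
      refine ge_of_tendsto' ((tendsto_pressure hs J hβ.le h fun _ : Site d => 1).sub
        (tendsto_pressure hs J hβ.le 0 fun _ => 1)) fun L => ?_
      rw [← sub_div, le_div_iff₀ (card_box_pos d L)]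
      exact mul_le_log_partitionFunction_sub J hβ.le hh'.le _ _ (hm L)
    rw [slope_def_field, sub_zero, le_div_iff₀ hh']
    linarith
  rw [hmag, one_div_mul_eq_div, le_div_iff₀ hβ]
  linarith

end Pressure

/-! ### Symmetries, translation invariance and extremality. -/

section Transformations

variable {d : ℕ}

/-- Translation of configurations. -/
def translate (a : Site d) (σ : Config d) : Config d := fun i => σ (i + a)

lemma measurable_translate (a : Site d) : Measurable (translate a : Config d → Config d) :=
  measurable_pi_lambda _ fun i => measurable_pi_apply (i + a)

lemma flipSet_translate (a : Site d) (T : Finset (Site d)) (σ : Config d) :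
    flipSet T (translate a σ) = translate a (flipSet (shift a T) σ) := by
  funext i
  by_cases h : i ∈ T
  · have h' : i + a ∈ shift a T := mem_shift.mpr (by simpa using h)
    rw [flipSet_of_mem h, translate, translate, flipSet_of_mem h']
  · have h' : i + a ∉ shift a T := fun hc => h (by simpa using mem_shift.mp hc)
    rw [flipSet_of_notMem h, translate, translate, flipSet_of_notMem h']

lemma flipEnergy_translate (s J : ℝ) (a : Site d) (T : Finset (Site d)) (σ : Config d) :
    flipEnergy s J T (translate a σ) = flipEnergy s J (shift a T) σ := by
  have hsum : ∀ f : Site d → ℝ, ∑ i ∈ shift a T, f i = ∑ i ∈ T, f (i + a) := fun f =>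
    Finset.sum_map _ _ _
  unfold flipEnergy
  rw [hsum]
  congr 1
  refine Finset.sum_congr rfl fun i _ => Eq.trans (tsum_congr fun j => ?_)
    ((Equiv.addRight a).tsum_eq fun j => if j ∈ shift a T then 0 else
      coupling s J (i + a) j * spin σ (i + a) * spin σ j)
  have h1 : j + a ∈ shift a T ↔ j ∈ T := by rw [mem_shift, add_sub_cancel_right]
  rw [Equiv.coe_addRight]
  by_cases hj : j ∈ T
  · rw [if_pos hj, if_pos (h1.mpr hj)]
  · rw [if_neg hj, if_neg fun hc => hj (h1.mp hc), coupling_add]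
    rfl

/-- Flip invariance is preserved by energy preserving maps that intertwine the flips. -/
lemma FlipInvariant.map {s J β : ℝ} (hs : (d : ℝ) + 1 < s) {μ : Measure (Config d)}
    (h : FlipInvariant s J β μ) {φ : Config d → Config d} (hφ : Measurable φ)
    (r : Finset (Site d) → Finset (Site d)) (h1 : ∀ T σ, flipSet T (φ σ) = φ (flipSet (r T) σ))
    (h2 : ∀ T σ, flipEnergy s J T (φ σ) = flipEnergy s J (r T) σ) :
    FlipInvariant s J β (μ.map φ) := by
  intro T g hg
  have hge : Measurable fun σ : Config d =>
      g σ * ENNReal.ofReal (Real.exp (-β * flipEnergy s J T σ)) :=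
    hg.mul ((measurable_flipEnergy hs J T).const_mul _).exp.ennreal_ofReal
  have hgf : Measurable fun σ => g (flipSet T σ) := hg.comp (measurable_flipSet T)
  rw [lintegral_map hgf hφ, lintegral_map hge hφ]
  simp only [h1, h2]
  exact h (r T) (fun σ => g (φ σ)) (hg.comp hφ)

lemma FlipInvariant.map_translate {s J β : ℝ} (hs : (d : ℝ) + 1 < s) {μ : Measure (Config d)}
    (h : FlipInvariant s J β μ) (a : Site d) : FlipInvariant s J β (μ.map (translate a)) :=
  h.map hs (measurable_translate a) (shift a) (flipSet_translate a) (flipEnergy_translate s J a)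

lemma IsEdgeComponent.map {γ : Finset (Edge d)} {S : Set (Edge d)} (h : IsEdgeComponent γ S)
    (E : Edge d ≃ Edge d) (hE : ∀ e f, edgeAdj (E e) (E f) ↔ edgeAdj e f) :
    IsEdgeComponent (γ.map E.toEmbedding) {e | E.symm e ∈ S} := by
  have hE' : ∀ e f, edgeAdj (E.symm e) (E.symm f) ↔ edgeAdj e f := fun e f => by
    rw [← hE, E.apply_symm_apply, E.apply_symm_apply]
  refine ⟨h.nonempty.map, fun e he => ?_, fun a ha b hb hab => ?_, fun U hU hne hcl => ?_⟩
  · exact h.subset _ (Finset.mem_map_equiv.mp he)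
  · exact Finset.mem_map_equiv.mpr (h.closed _ (Finset.mem_map_equiv.mp ha) _ hb ((hE' a b).mpr hab))
  · have h1 : U.map E.symm.toEmbedding = γ := by
      refine h.connected _ ?_ hne.map ?_
      · intro e he
        have := hU (Finset.mem_map_equiv.mp he)
        rw [Finset.mem_map_equiv] at this
        simpa using this
      · intro a ha b hb hab
        rw [Finset.mem_map_equiv] at ha ⊢
        exact hcl _ ha _ (Finset.mem_map_equiv.mpr (by simpa using hb)) ((hE a b).mpr hab)
    rw [← h1, Finset.map_map]
    simp

lemma IsContour.translate {σ : Config d} {A : Finset (Site d)} (h : IsContour σ A) (a : Site d) :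
    IsContour (translate a σ) (shift (-a) A) := by
  have h1 := IsEdgeComponent.map h ((Equiv.addRight (-a)).prodCongr (Equiv.refl (Fin d)))
    fun e f => by simp [edgeAdj]
  rw [IsContour, edgeBoundary_shift]
  convert h1 using 1
  ext e
  simp [disagree, LongRangeIsing.translate, add_right_comm]

lemma Enclosed.map_translate {μ : Measure (Config d)} (h : Enclosed μ) (a : Site d) :
    Enclosed (μ.map (translate a)) := by
  intro v
  have hm : MeasurableSet {σ : Config d | σ v = -1 → ∃ A, v ∈ A ∧ IsContour σ A} := by
    have h1 : {σ : Config d | σ v = -1 → ∃ A, v ∈ A ∧ IsContour σ A} =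
        {σ | σ v = -1}ᶜ ∪ ⋃ A, ({_σ | v ∈ A} ∩ {σ | IsContour σ A}) := by
      ext σ
      simp only [Set.mem_ofPred_eq, Set.mem_union, Set.mem_compl_iff, Set.mem_iUnion,
        Set.mem_inter_iff, imp_iff_not_or]
    rw [h1]
    have h2 : Measurable fun σ : Config d => σ v := measurable_pi_apply v
    exact (h2 (measurableSet_singleton (-1))).compl.union
      (MeasurableSet.iUnion fun A => (MeasurableSet.const _).inter (measurableSet_isContour A))
  rw [ae_map_iff (measurable_translate a).aemeasurable hm]
  filter_upwards [h (v + a)] with σ hσ hv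
  obtain ⟨A, hA, hc⟩ := hσ hv
  exact ⟨shift (-a) A, mem_shift.mpr (by simpa using hA), hc.translate a⟩

lemma measurable_neg_config : Measurable (Neg.neg : Config d → Config d) :=
  measurable_pi_lambda _ fun i => by
    have h1 : Measurable (Neg.neg : ℤˣ → ℤˣ) := measurable_of_finite _
    exact h1.comp (measurable_pi_apply i)

lemma spin_neg (σ : Config d) (i : Site d) : spin (-σ) i = -spin σ i := by simp [spin]

lemma flipSet_neg (T : Finset (Site d)) (σ : Config d) : flipSet T (-σ) = -flipSet T σ := by
  funext i
  by_cases h : i ∈ T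
  · rw [flipSet_of_mem h, Pi.neg_apply, Pi.neg_apply, flipSet_of_mem h]
  · rw [flipSet_of_notMem h, Pi.neg_apply, Pi.neg_apply, flipSet_of_notMem h]

lemma FlipInvariant.map_neg {s J β : ℝ} (hs : (d : ℝ) + 1 < s) {μ : Measure (Config d)}
    (h : FlipInvariant s J β μ) : FlipInvariant s J β (μ.map Neg.neg) :=
  h.map hs measurable_neg_config id flipSet_neg fun T σ => by
    simp only [flipEnergy, spin_neg, mul_neg, neg_mul, neg_neg, id]

lemma map_neg_map_neg (μ : Measure (Config d)) : (μ.map Neg.neg).map Neg.neg = μ := by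
  rw [Measure.map_map measurable_neg_config measurable_neg_config]
  have : (Neg.neg : Config d → Config d) ∘ Neg.neg = id := funext fun σ => neg_neg σ
  rw [this, Measure.map_id]

lemma IsGibbs.map_neg {s J β : ℝ} (hs : (d : ℝ) + 1 < s) {μ : Measure (Config d)}
    (h : IsGibbs s J β μ) : IsGibbs s J β (μ.map Neg.neg) := by
  have := h.isProbabilityMeasure
  have := Measure.isProbabilityMeasure_map (μ := μ) (measurable_neg_config (d := d)).aemeasurable
  exact ((h.flipInvariant hs).map_neg hs).isGibbs hs

lemma IsExtremalGibbs.map_neg {s J β : ℝ} (hs : (d : ℝ) + 1 < s) {μ : Measure (Config d)}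
    (h : IsExtremalGibbs s J β μ) : IsExtremalGibbs s J β (μ.map Neg.neg) := by
  refine mem_extremePoints_iff_left.mpr ⟨IsGibbs.map_neg hs h.1, fun ν hν ν' hν' hseg => ?_⟩
  obtain ⟨a, b, ha, hb, hab, heq⟩ := hseg
  have h1 : μ ∈ openSegment ℝ≥0 (ν.map Neg.neg) (ν'.map Neg.neg) := by
    refine ⟨a, b, ha, hb, hab, ?_⟩
    rw [← map_neg_map_neg μ, ← heq, Measure.map_add _ _ measurable_neg_config, Measure.map_smul,
      Measure.map_smul]
  rw [← h.2 (IsGibbs.map_neg hs hν) (IsGibbs.map_neg hs hν') h1, map_neg_map_neg]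

lemma IsTranslationInvariant.map_neg {μ : Measure (Config d)} (h : IsTranslationInvariant μ) :
    IsTranslationInvariant (μ.map Neg.neg) := by
  intro a
  have h1 := h a
  change Measure.map (translate a) (μ.map Neg.neg) = μ.map Neg.neg
  change Measure.map (translate a) μ = μ at h1
  rw [Measure.map_map (measurable_translate a) measurable_neg_config]
  nth_rewrite 2 [← h1]
  rw [Measure.map_map measurable_neg_config (measurable_translate a)]
  rfl

lemma integral_spin_map_neg (μ : Measure (Config d)) (v : Site d) :
    ∫ σ, spin σ v ∂(μ.map Neg.neg) = -∫ σ, spin σ v ∂μ := by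
  rw [integral_map measurable_neg_config.aemeasurable
    (continuous_spin v).measurable.aestronglyMeasurable, ← integral_neg]
  simp only [spin_neg]

/-- A translate is again flip invariant with enclosed minus spins, so uniqueness identifies it with
`μ`. -/
lemma isTranslationInvariant_of_enclosed (hd : 0 < d) {s : ℝ} (hs : (d : ℝ) + 1 < s) {J β : ℝ}
    (hJ : 0 ≤ J) (hβ : 0 ≤ β) {μ : Measure (Config d)} [IsProbabilityMeasure μ]
    (hμ : FlipInvariant s J β μ) (hμe : Enclosed μ) (hsmall : ∀ a : Site d,
      ∑' it, itemWeight (peierlsWeight d s J β) (linkBound s β) a it ≤ 1 / 2) :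
    IsTranslationInvariant μ := by
  intro a
  change μ.map (translate a) = μ
  have := Measure.isProbabilityMeasure_map (μ := μ) (measurable_translate a).aemeasurable
  exact eq_of_enclosed hd hs hJ hβ (hμ.map_translate hs a) hμ (hμe.map_translate a) hμe hsmall

/-- A component of a convex decomposition is absolutely continuous with respect to `μ`. It inherits
the almost sure enclosure and, being Gibbs, equals `μ` by uniqueness. -/
lemma isExtremalGibbs_of_enclosed (hd : 0 < d) {s : ℝ} (hs : (d : ℝ) + 1 < s) {J β : ℝ}
    (hJ : 0 ≤ J) (hβ : 0 ≤ β) {μ : Measure (Config d)} [IsProbabilityMeasure μ]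
    (hμ : FlipInvariant s J β μ) (hμe : Enclosed μ) (hsmall : ∀ a : Site d,
      ∑' it, itemWeight (peierlsWeight d s J β) (linkBound s β) a it ≤ 1 / 2) :
    IsExtremalGibbs s J β μ := by
  refine mem_extremePoints_iff_left.mpr ⟨hμ.isGibbs hs, fun ν hν ν' hν' hseg => ?_⟩
  obtain ⟨a, b, ha, hb, hab, heq⟩ := hseg
  have hac : ν ≪ μ := by
    refine Measure.AbsolutelyContinuous.mk fun S _ hS => ?_
    rw [← heq] at hS
    simp only [Measure.coe_add, Pi.add_apply, Measure.smul_apply, add_eq_zero] at hS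
    have h1 := hS.1
    rw [ENNReal.smul_def, smul_eq_mul, mul_eq_zero] at h1
    exact h1.resolve_left (by exact_mod_cast ha.ne')
  have := IsGibbs.isProbabilityMeasure hν
  exact eq_of_enclosed hd hs hJ hβ (IsGibbs.flipInvariant hs hν) hμ
    (fun v => hac.ae_le (hμe v)) hμe hsmall

end Transformations

/-! ### Choice of the constants. -/

section Constants

variable {d : ℕ}

lemma tsum_linkBound_le {s β : ℝ} (hs : (d : ℝ) + 1 < s) (hβ : 0 ≤ β) (i : Site d) :
    ∑' j, linkBound s β i j ≤
      ENNReal.ofReal (2 * d + 4 * β * ∑' j, longRange s (0 : Site d) j) := by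
  classical
  have h1 : ∀ j, linkBound s β i j ≤ (if j ∈ nbrs i then 1 else 0) +
      ENNReal.ofReal (4 * β * longRange s i j) := by
    intro j
    unfold linkBound
    by_cases h : IsNeighbor i j
    · rw [if_pos h, if_pos (mem_nbrs.mpr h)]
      exact le_self_add
    · rw [if_neg h]
      exact le_add_self
  have hK0 : ∀ j, 0 ≤ 4 * β * longRange s i j := fun j =>
    mul_nonneg (by positivity) (longRange_nonneg _ _ _)
  refine (ENNReal.tsum_le_tsum h1).trans ?_
  rw [ENNReal.tsum_add, ENNReal.ofReal_add (by positivity)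
    (mul_nonneg (by positivity) (tsum_nonneg fun j => longRange_nonneg _ _ _))]
  refine add_le_add ?_ (le_of_eq ?_)
  · rw [tsum_eq_sum (s := nbrs i) fun j hj => if_neg hj, Finset.sum_congr rfl fun j hj => if_pos hj,
      Finset.sum_const, nsmul_eq_mul, mul_one]
    refine ENNReal.le_ofReal_iff_toReal_le (ENNReal.natCast_ne_top _) (by positivity) |>.mpr ?_
    rw [ENNReal.toReal_natCast]
    exact_mod_cast card_nbrs_le i
  · rw [← ENNReal.ofReal_tsum_of_nonneg hK0 ((summable_longRange hs i).mul_left _), tsum_mul_left,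
      tsum_longRange]

/-- The constant `C₀`. -/
def peierlsConstant (d : ℕ) : ℝ := 8 * contourBase d * (2 * d + 1)

/-- The constant `J₀`. -/
def couplingThreshold (d : ℕ) (s : ℝ) : ℝ :=
  longRangeMoment d s + (2 * ∑' j, longRange s (0 : Site d) j + 1)

lemma peierlsConstant_pos (d : ℕ) : 0 < peierlsConstant d := by
  have := contourBase_pos d
  unfold peierlsConstant
  positivity

lemma couplingThreshold_pos (d : ℕ) (s : ℝ) : 0 < couplingThreshold d s := by
  have h1 := longRangeMoment_nonneg d s
  have h2 : 0 ≤ ∑' j, longRange s (0 : Site d) j := tsum_nonneg fun j => longRange_nonneg _ _ _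
  unfold couplingThreshold
  positivity

/-- The link sum `2d + 4βS` grows with `β`, so `J₀` exceeds the first moment by `M = 2S + 1`: the
extra decay `exp (-2βM)` beats `4βS`, leaving `2d + 1`, which `C₀` absorbs independently of `s`. The
value 1/8 leaves room for two factors 2 and the required bound 1/2. -/
lemma contourBase_mul_exp_le {s J β : ℝ} (hβ : 0 < β)
    (h : peierlsConstant d ≤ β * (J - couplingThreshold d s)) :
    contourBase d * Real.exp (-2 * β * (J - longRangeMoment d s)) *
      (2 * d + 4 * β * ∑' j, longRange s (0 : Site d) j) ≤ 1 / 8 ∧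
    contourBase d * Real.exp (-2 * β * (J - longRangeMoment d s)) ≤ 1 / 8 := by
  set κ := longRangeMoment d s with hκ
  set S := ∑' j, longRange s (0 : Site d) j with hS
  set b := contourBase d with hb
  have hb0 : 0 < b := contourBase_pos d
  have hS0 : 0 ≤ S := tsum_nonneg fun j => longRange_nonneg _ _ _
  set C := peierlsConstant d with hC
  have hCeq : C = 8 * b * (2 * d + 1) := rfl
  have hC0 : 0 < C := peierlsConstant_pos d
  have hd0 : (0 : ℝ) ≤ d := Nat.cast_nonneg d
  set M := 2 * S + 1 with hM
  have hM0 : 0 < M := by positivity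
  have hthr : couplingThreshold d s = κ + M := rfl
  rw [hthr] at h
  have hinv : ∀ t : ℝ, 0 < t → Real.exp (-t) ≤ 1 / t := fun t ht => by
    rw [Real.exp_neg, one_div]
    exact inv_anti₀ ht (by linarith [Real.add_one_le_exp t])
  have h1 : Real.exp (-2 * β * (J - κ)) ≤ Real.exp (-C) * Real.exp (-(2 * β * M)) := by
    rw [← Real.exp_add]
    exact Real.exp_le_exp.mpr (by nlinarith)
  have h2 : Real.exp (-C) ≤ 1 / C := hinv C hC0
  have h3 : Real.exp (-(2 * β * M)) ≤ 1 := Real.exp_le_one_iff.mpr (by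
    have : 0 ≤ 2 * β * M := by positivity
    linarith)
  have h4 : Real.exp (-(2 * β * M)) * (4 * β * S) ≤ 1 := by
    -- By `exp (-t) ≤ 1/t`, the product is at most `4βS / (2βM) = 2S / M`, which is at most one.
    have h5 := mul_le_mul_of_nonneg_right (hinv (2 * β * M) (by positivity))
      (show 0 ≤ 4 * β * S by positivity)
    refine h5.trans ?_
    rw [one_div_mul_eq_div, div_le_one (by positivity)]
    nlinarith
  have h6 : Real.exp (-(2 * β * M)) * (2 * d + 4 * β * S) ≤ 2 * d + 1 := by
    rw [mul_add]
    nlinarith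
  have hA : 0 ≤ 2 * (d : ℝ) + 4 * β * S := by positivity
  have h7 : b * (1 / C) * (2 * d + 1) = 1 / 8 := by
    rw [hCeq]
    field_simp
  constructor
  · calc b * Real.exp (-2 * β * (J - κ)) * (2 * d + 4 * β * S)
        ≤ b * (Real.exp (-C) * Real.exp (-(2 * β * M))) * (2 * d + 4 * β * S) := by gcongr
      _ = b * Real.exp (-C) * (Real.exp (-(2 * β * M)) * (2 * d + 4 * β * S)) := by ring
      _ ≤ b * (1 / C) * (2 * d + 1) := by gcongr
      _ = 1 / 8 := h7
  · calc b * Real.exp (-2 * β * (J - κ)) ≤ b * (Real.exp (-C) * Real.exp (-(2 * β * M))) := by gcongr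
      _ ≤ b * (1 / C * 1) := by gcongr
      _ ≤ b * (1 / C) * (2 * d + 1) := by
          rw [mul_one]
          exact le_mul_of_one_le_right (by positivity) (by linarith)
      _ = 1 / 8 := h7

lemma contourSum_peierlsWeight_le (hd : 2 ≤ d) {s J β : ℝ} (hβ : 0 < β)
    (h : peierlsConstant d ≤ β * (J - couplingThreshold d s)) (v : Site d) :
    contourSum (peierlsWeight d s J β) v ≤ ENNReal.ofReal (1 / 4) := by
  have h1 := (contourBase_mul_exp_le hβ h).2
  refine (contourSum_le hd (Real.exp_nonneg _) (by linarith) v).trans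
    (ENNReal.ofReal_le_ofReal (by linarith))

lemma tsum_itemWeight_peierlsWeight_le (hd : 2 ≤ d) {s J β : ℝ} (hs : (d : ℝ) + 1 < s) (hβ : 0 < β)
    (h : peierlsConstant d ≤ β * (J - couplingThreshold d s)) (a : Site d) :
    ∑' it, itemWeight (peierlsWeight d s J β) (linkBound s β) a it ≤ 1 / 2 := by
  obtain ⟨h1, h2⟩ := contourBase_mul_exp_le hβ h
  refine (tsum_itemWeight_le _ _ (fun a => contourSum_le hd (Real.exp_nonneg _) (by linarith) a)
    (tsum_linkBound_le hs hβ.le) a).trans ?_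
  have hb := contourBase_pos d
  rw [← ENNReal.ofReal_mul (by positivity), show (2 : ENNReal) = ENNReal.ofReal 2 by simp,
    ← ENNReal.ofReal_mul (by norm_num), ← ENNReal.ofReal_one, ← ENNReal.ofReal_div_of_pos (by norm_num)]
  exact ENNReal.ofReal_le_ofReal (by linarith)

end Constants

end LongRangeIsing

end

/-! ### The main theorem. -/

theorem theorem3 (d : ℕ) (hd : 2 ≤ d) :
    ∃ C₀ : ℝ, 0 < C₀ ∧ ∀ s : ℝ, (d : ℝ) + 1 < s →
      ∃ J₀ : ℝ, 0 < J₀ ∧ ∀ β J : ℝ, 0 < β → C₀ ≤ β * (J - J₀) →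
        -- the free energy exists as a limit independent of the boundary condition, its right
        -- derivative at zero field exists, and the spontaneous magnetization is positive
        ((∀ (h : ℝ) (η : LongRangeIsing.Config d),
            Tendsto (fun L : ℕ => LongRangeIsing.boxFreeEnergy s J β h L η) atTop
              (𝓝 (LongRangeIsing.freeEnergy d s J β h))) ∧
          HasDerivWithinAt (fun h => LongRangeIsing.freeEnergy d s J β h)
            (-LongRangeIsing.spontaneousMagnetization d s J β) (Set.Ici 0) 0 ∧
          0 < LongRangeIsing.spontaneousMagnetization d s J β) ∧
        -- two distinct translation-invariant extremal Gibbs states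
        ∃ μp μm : Measure (LongRangeIsing.Config d),
          μp ≠ μm ∧
          LongRangeIsing.IsTranslationInvariant μp ∧ LongRangeIsing.IsTranslationInvariant μm ∧
          LongRangeIsing.IsExtremalGibbs s J β μp ∧ LongRangeIsing.IsExtremalGibbs s J β μm ∧
          (∫ σ, LongRangeIsing.spin σ 0 ∂μp) = -(∫ σ, LongRangeIsing.spin σ 0 ∂μm) ∧
          0 < ∫ σ, LongRangeIsing.spin σ 0 ∂μp := by
  refine ⟨LongRangeIsing.peierlsConstant d, LongRangeIsing.peierlsConstant_pos d, fun s hs =>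
    ⟨LongRangeIsing.couplingThreshold d s, LongRangeIsing.couplingThreshold_pos d s,
      fun β J hβ h => ?_⟩⟩
  have hd0 : 0 < d := by omega
  have hJ : 0 ≤ J := by
    have h1 : 0 < J - LongRangeIsing.couplingThreshold d s :=
      pos_of_mul_pos_right ((LongRangeIsing.peierlsConstant_pos d).trans_le h) hβ.le
    linarith [LongRangeIsing.couplingThreshold_pos d s]
  have hsum := LongRangeIsing.contourSum_peierlsWeight_le hd hβ h
  have hsmall := LongRangeIsing.tsum_itemWeight_peierlsWeight_le hd hs hβ h
  -- The contour sum bounds the probability of a minus spin by 1/4, so the finite-volume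
  -- magnetization is at least `1 - 2/4`.
  obtain ⟨hder, hmag⟩ := LongRangeIsing.hasDerivWithinAt_freeEnergy hs J hβ (m := 1 / 2)
    fun L v => LongRangeIsing.le_integral_spin
      ((LongRangeIsing.finiteGibbs_unenclosed_le hd hs hJ hβ.le L v ∅).trans
        ((LongRangeIsing.contourTail_empty _ v).trans_le (hsum v)))
  refine ⟨⟨fun h' η => ?_, hder, by linarith⟩, ?_⟩
  · rw [LongRangeIsing.freeEnergy_eq hs J hβ.le h']
    exact LongRangeIsing.tendsto_boxFreeEnergy hs J hβ.le h' η
  · obtain ⟨μ, hμ, hflip, henc, hspin⟩ := LongRangeIsing.exists_plus_state hd hs hJ hβ.le hsum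
    have htr := LongRangeIsing.isTranslationInvariant_of_enclosed hd0 hs hJ hβ.le hflip henc hsmall
    have hext := LongRangeIsing.isExtremalGibbs_of_enclosed hd0 hs hJ hβ.le hflip henc hsmall
    have hneg := LongRangeIsing.integral_spin_map_neg μ 0
    have h0 := hspin 0
    refine ⟨μ, μ.map Neg.neg, fun heq => ?_, htr, htr.map_neg, hext, hext.map_neg hs, ?_, ?_⟩
    · rw [← heq] at hneg
      linarith
    · rw [hneg, neg_neg]
    · linarith
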